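/- Let $m_0>0$. On the half plane $\mathbb{R}^2_+=\{(\rho,z):\rho\ge 0\}$ put $r=\sqrt{\rho^2+z^2}$, $\rho=r\sin\theta$, $z=r\cos\theta$, and let $\Sigma=(r+m_0)^2+m_0^2\cos^2\theta$, $\eta_0=\frac{((r+m_0)^2+m_0^2)^2-m_0^2r^2\sin^2\theta}{\Sigma}\sin^2\theta$, $\omega_0=2m_0^2(\cos^3\theta-3\cos\theta)-\frac{2m_0^4\cos\theta\sin^4\theta}{\Sigma}$, $e^{\sigma_0}=\eta_0/\rho^2$, $e^{2q_0}=\Sigma\sin^2\theta/\eta_0$, $u_0=\ln\rho+\sigma_0+q_0$ be the extreme Kerr background of mass $m_0$ and angular momentum $m_0^2$ (horizon at $r=0$). Write $\partial f=(\partial_\rho f,\partial_z f)$, ${}^{(3)}\Delta f=\partial_\rho^2f+\partial_z^2f+\rho^{-1}\partial_\rho f$, and a dot for $\partial_t$. Let $I\subset\mathbb{R}$ be an open set of times and let $\sigma_1,\omega_1$ (perturbations of the norm and the twist of the axial Killing vector), $\beta_1^A$ (shift) and $\chi_{1AB}=\chi_{1BA}$ (second fundamental form) be functions of $t\in I$ and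 $(\rho,z)$ such that: $\sigma_1,\omega_1$ are smooth as axially symmetric functions on $I\times(\mathbb{R}^3\setminus\{0\})$ and $\beta_1,\chi_1$ are smooth for $\rho>0$; $\omega_1=0$ on the axis $\rho=0$, $z\neq 0$; $\sigma_1\to0$ and $\omega_1/r^2\to0$ as $r\to\infty$ at each time; and, with $$p=\dot\sigma_1-2\frac{\beta_1^\rho}{\rho}-\beta_1^A\partial_A\sigma_0,\qquad d=\dot\omega_1-\beta_1^A\partial_A\omega_0,$$ the linearized evolution equations $$-e^{2(\sigma_0+q_0)}\dot p+{}^{(3)}\Delta\sigma_1=\frac{2}{\eta_0^2}\left(\sigma_1|\partial\omega_0|^2-\partial\omega_1\cdot\partial\omega_0\right),$$ $$-e^{2(\sigma_0+q_0)}\dot d+{}^{(3)}\Delta\omega_1=4\frac{\partial_\rho\omega_1}{\rho}+2\,\partial\omega_1\cdot\partial\sigma_0+2\,\partial\omega_0\cdot\partial\sigma_1$$ hold for $\rho>0$. Let $m_2=\frac1{16}\int_{\mathbb{R}^2_+}\varepsilon_2\,d\rho\,dz\in[0,\infty]$, where $$\frac{\varepsilon_2}{\rho}=2e^{2(\sigma_0+q_0)}p^2+\frac{2e^{2(\sigma_0+q_0)}}{\eta_0^2}d^2+4e^{-2u_0}\chi_1^{AB}\chi_{1AB}+\left|\partial\sigma_1+\frac{\omega_1}{\eta_0^2}\partial\omega_0\right|^2+\left|\partial\left(\frac{\omega_1}{\eta_0}\right)-\frac{\sigma_1}{\eta_0}\partial\omega_0\right|^2+\left|\frac{\sigma_1}{\eta_0}\partial\omega_0-\frac{\omega_1}{\eta_0^2}\partial\eta_0\right|^2$$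 (indices moved with the flat metric), and let $\bar m_2$ be the same integral with $p,d,\chi_1,\sigma_1,\omega_1$ replaced by $\dot p,\dot d,\dot\chi_1,\dot\sigma_1,\dot\omega_1$. Put $\bar\omega_1=\omega_1/\eta_0^2$. Then for every $\delta>0$ there is a constant $C_\delta>0$, depending only on $m_0$ and $\delta$, such that for all such perturbations, and at every time $t\in I$ (all quantities taken at the time $t$), $$\Big(\sup_{r\ge\delta}|\sigma_1|\Big)^2\le C_\delta\,(\bar m_2+m_2),\qquad \Big(\sup_{\rho\ge\delta}|\bar\omega_1|\Big)^2\le C_\delta\,(\bar m_2+m_2).$$ -/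

import Mathlib

open MeasureTheory Filter Topology Set
open scoped ENNReal NNReal ContDiff Matrix

noncomputable section

namespace ExtremeKerr

/-! ### Calculus on the half plane

A point `x : ℝ × ℝ` has coordinates `ρ = x.1`, `z = x.2`.  Index `0` of `Fin 2` is `ρ`,
index `1` is `z`; two-dimensional indices are moved with the flat metric. -/

/-- The half plane `0 ≤ ρ`. -/
def halfPlane : Set (ℝ × ℝ) := {x | 0 ≤ x.1}

/-- `r = √(ρ² + z²)`. -/
def radius (x : ℝ × ℝ) : ℝ := √(x.1 ^ 2 + x.2 ^ 2)

/-- `∂_ρ f`. -/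
def dRho (f : ℝ × ℝ → ℝ) (x : ℝ × ℝ) : ℝ := deriv (fun s => f (s, x.2)) x.1

/-- `∂_z f`. -/
def dZ (f : ℝ × ℝ → ℝ) (x : ℝ × ℝ) : ℝ := deriv (fun s => f (x.1, s)) x.2

/-- `∂f = (∂_ρ f, ∂_z f)`. -/
def grad (f : ℝ × ℝ → ℝ) (x : ℝ × ℝ) : Fin 2 → ℝ := ![dRho f x, dZ f x]

/-- `|v|² = v · v`. -/
def normSq (v : Fin 2 → ℝ) : ℝ := v ⬝ᵥ v

/-- `⁽³⁾Δ f = ∂_ρ² f + ∂_z² f + ∂_ρ f / ρ`. -/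
def lap3 (f : ℝ × ℝ → ℝ) (x : ℝ × ℝ) : ℝ :=
  dRho (dRho f) x + dZ (dZ f) x + dRho f x / x.1

/-- The time derivative of a time-dependent field. -/
def dot (f : ℝ → ℝ × ℝ → ℝ) (t : ℝ) (x : ℝ × ℝ) : ℝ := deriv (fun s => f s x) t

/-- The region `r ≥ δ` of the half plane. -/
def Omega (δ : ℝ) : Set (ℝ × ℝ) := {x | x ∈ halfPlane ∧ δ ≤ radius x}

/-- The region `ρ ≥ δ` of the half plane. -/
def Gamma (δ : ℝ) : Set (ℝ × ℝ) := {x | x ∈ halfPlane ∧ δ ≤ x.1}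

/-! ### The extreme Kerr background of mass `m₀` and angular momentum `m₀²`

`ρ = r sin θ`, `z = r cos θ`, and `r + m₀` is the Boyer-Lindquist radius. -/

/-- `Σ = (r + m₀)² + m₀² cos² θ`. -/
def kerrSigma (m₀ : ℝ) (x : ℝ × ℝ) : ℝ :=
  (radius x + m₀) ^ 2 + m₀ ^ 2 * (x.2 / radius x) ^ 2

/-- The square norm of the axial Killing vector,
`η₀ = (((r + m₀)² + m₀²)² - m₀² r² sin² θ) sin² θ / Σ`. -/
def eta0 (m₀ : ℝ) (x : ℝ × ℝ) : ℝ :=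
  (((radius x + m₀) ^ 2 + m₀ ^ 2) ^ 2 - m₀ ^ 2 * x.1 ^ 2) * (x.1 / radius x) ^ 2
    / kerrSigma m₀ x

/-- The twist of the axial Killing vector,
`ω₀ = 2 m₀² (cos³ θ - 3 cos θ) - 2 m₀⁴ cos θ sin⁴ θ / Σ`. -/
def omega0 (m₀ : ℝ) (x : ℝ × ℝ) : ℝ :=
  2 * m₀ ^ 2 * ((x.2 / radius x) ^ 3 - 3 * (x.2 / radius x))
    - 2 * m₀ ^ 4 * (x.2 / radius x) * (x.1 / radius x) ^ 4 / kerrSigma m₀ x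

/-- `σ₀`, defined by `exp σ₀ = η₀ / ρ²`. -/
def sigma0 (m₀ : ℝ) (x : ℝ × ℝ) : ℝ := Real.log (eta0 m₀ x / x.1 ^ 2)

/-- `q₀`, defined by `exp (2 q₀) = Σ sin² θ / η₀`, so that the metric of the slices is
`exp (σ₀) (exp (2 q₀) (dρ² + dz²) + ρ² dφ²)`. -/
def q0 (m₀ : ℝ) (x : ℝ × ℝ) : ℝ :=
  Real.log (kerrSigma m₀ x * (x.1 / radius x) ^ 2 / eta0 m₀ x) / 2

/-- `u₀ = log ρ + σ₀ + q₀`. -/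
def u0 (m₀ : ℝ) (x : ℝ × ℝ) : ℝ := Real.log x.1 + sigma0 m₀ x + q0 m₀ x

/-! ### Perturbations -/

/-- `p = ∂ₜσ₁ - 2 β^ρ / ρ - β^A ∂_A σ₀`. -/
def pField (m₀ : ℝ) (σ₁ : ℝ → ℝ × ℝ → ℝ) (β : ℝ → ℝ × ℝ → Fin 2 → ℝ)
    (t : ℝ) (x : ℝ × ℝ) : ℝ :=
  dot σ₁ t x - 2 * (β t x 0 / x.1) - β t x ⬝ᵥ grad (sigma0 m₀) x

/-- `d = ∂ₜω₁ - β^A ∂_A ω₀`. -/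
def dField (m₀ : ℝ) (ω₁ : ℝ → ℝ × ℝ → ℝ) (β : ℝ → ℝ × ℝ → Fin 2 → ℝ)
    (t : ℝ) (x : ℝ × ℝ) : ℝ :=
  dot ω₁ t x - β t x ⬝ᵥ grad (omega0 m₀) x

/-- The rescaled perturbation `ω̄₁ = ω₁ / η₀²`. -/
def omegaBar (m₀ : ℝ) (ω₁ : ℝ → ℝ × ℝ → ℝ) (t : ℝ) (x : ℝ × ℝ) : ℝ :=
  ω₁ t x / eta0 m₀ x ^ 2

/-- The energy density divided by `ρ`, as a quadratic form in the fields
`p, d, χ_AB, s, w` on the half plane. -/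
def energyDensity (m₀ : ℝ) (p d : ℝ × ℝ → ℝ) (χ : Fin 2 → Fin 2 → ℝ × ℝ → ℝ)
    (s w : ℝ × ℝ → ℝ) (x : ℝ × ℝ) : ℝ :=
  2 * Real.exp (2 * (sigma0 m₀ x + q0 m₀ x)) * p x ^ 2
  + 2 * (Real.exp (2 * (sigma0 m₀ x + q0 m₀ x)) / eta0 m₀ x ^ 2) * d x ^ 2
  + 4 * Real.exp (-2 * u0 m₀ x) * ∑ A, ∑ B, χ A B x ^ 2
  + normSq (grad s x + (w x / eta0 m₀ x ^ 2) • grad (omega0 m₀) x)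
  + normSq (grad (fun y => w y / eta0 m₀ y) x - (s x / eta0 m₀ x) • grad (omega0 m₀) x)
  + normSq ((s x / eta0 m₀ x) • grad (omega0 m₀) x
      - (w x / eta0 m₀ x ^ 2) • grad (eta0 m₀) x)

/-- The energy `(1/16) ∫ ε dρ dz`, a number in `[0, ∞]`. -/
def energy (m₀ : ℝ) (p d : ℝ × ℝ → ℝ) (χ : Fin 2 → Fin 2 → ℝ × ℝ → ℝ)
    (s w : ℝ × ℝ → ℝ) : ℝ≥0∞ :=
  (1 / 16) * ∫⁻ x in halfPlane, ENNReal.ofReal (energyDensity m₀ p d χ s w x * x.1)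

/-- The mass `m₂` at time `t`. -/
def m2 (m₀ : ℝ) (σ₁ ω₁ : ℝ → ℝ × ℝ → ℝ) (β : ℝ → ℝ × ℝ → Fin 2 → ℝ)
    (χ₁ : Fin 2 → Fin 2 → ℝ → ℝ × ℝ → ℝ) (t : ℝ) : ℝ≥0∞ :=
  energy m₀ (pField m₀ σ₁ β t) (dField m₀ ω₁ β t) (fun A B => χ₁ A B t) (σ₁ t) (ω₁ t)

/-- The higher order mass `m̄₂` at time `t`: every field is replaced by its time derivative. -/
def m2bar (m₀ : ℝ) (σ₁ ω₁ : ℝ → ℝ × ℝ → ℝ) (β : ℝ → ℝ × ℝ → Fin 2 → ℝ)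
    (χ₁ : Fin 2 → Fin 2 → ℝ → ℝ × ℝ → ℝ) (t : ℝ) : ℝ≥0∞ :=
  energy m₀ (dot (pField m₀ σ₁ β) t) (dot (dField m₀ ω₁ β) t) (fun A B => dot (χ₁ A B) t)
    (dot σ₁ t) (dot ω₁ t)

/-- The axially symmetric function `(t, (x, y, z)) ↦ f t (√(x² + y²), z)` is smooth on
`I × (ℝ³ \ {0})`: smoothness up to and across the axis, away from the horizon `r = 0`. -/
def AxiallySmooth (I : Set ℝ) (f : ℝ → ℝ × ℝ → ℝ) : Prop :=
  ContDiffOn ℝ ∞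
    (fun y : ℝ × EuclideanSpace ℝ (Fin 3) => f y.1 (√(y.2 0 ^ 2 + y.2 1 ^ 2), y.2 2))
    (I ×ˢ {(0 : EuclideanSpace ℝ (Fin 3))}ᶜ)

/-- The function is smooth on `I × {ρ > 0}`. -/
def SmoothOffAxis (I : Set ℝ) (f : ℝ → ℝ × ℝ → ℝ) : Prop :=
  ContDiffOn ℝ ∞ (fun y : ℝ × (ℝ × ℝ) => f y.1 y.2) (I ×ˢ {x | 0 < x.1})

/-- The filter `r → ∞` in the half plane. -/
def atInfinity : Filter (ℝ × ℝ) := comap radius atTop ⊓ 𝓟 halfPlane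

/-- An axially symmetric linear perturbation of extreme Kerr in the maximal-isothermal gauge, on
the time set `I`, with norm `σ₁`, twist `ω₁`, shift `β` and second fundamental form `χ₁`.  No other
linearized equation and no condition at the horizon is imposed, and only weak fall off. -/
structure IsLinearPerturbation (m₀ : ℝ) (I : Set ℝ) (σ₁ ω₁ : ℝ → ℝ × ℝ → ℝ)
    (β : ℝ → ℝ × ℝ → Fin 2 → ℝ) (χ₁ : Fin 2 → Fin 2 → ℝ → ℝ × ℝ → ℝ) : Prop where
  smooth_sigma : AxiallySmooth I σ₁
  smooth_omega : AxiallySmooth I ω₁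
  smooth_shift : ∀ A, SmoothOffAxis I (fun t x => β t x A)
  smooth_chi : ∀ A B, SmoothOffAxis I (χ₁ A B)
  chi_symm : ∀ A B, ∀ t ∈ I, ∀ x : ℝ × ℝ, 0 < x.1 → χ₁ A B t x = χ₁ B A t x
  /-- The angular momentum is not perturbed. -/
  omega_axis : ∀ t ∈ I, ∀ z : ℝ, z ≠ 0 → ω₁ t (0, z) = 0
  sigma_infinity : ∀ t ∈ I, Tendsto (σ₁ t) atInfinity (𝓝 0)
  omega_infinity : ∀ t ∈ I, Tendsto (fun x => ω₁ t x / radius x ^ 2) atInfinity (𝓝 0)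
  evolution_sigma : ∀ t ∈ I, ∀ x : ℝ × ℝ, 0 < x.1 →
    -Real.exp (2 * (sigma0 m₀ x + q0 m₀ x)) * dot (pField m₀ σ₁ β) t x + lap3 (σ₁ t) x =
      2 / eta0 m₀ x ^ 2 *
        (σ₁ t x * normSq (grad (omega0 m₀) x) - grad (ω₁ t) x ⬝ᵥ grad (omega0 m₀) x)
  evolution_omega : ∀ t ∈ I, ∀ x : ℝ × ℝ, 0 < x.1 →
    -Real.exp (2 * (sigma0 m₀ x + q0 m₀ x)) * dot (dField m₀ ω₁ β) t x + lap3 (ω₁ t) x =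
      4 * (dRho (ω₁ t) x / x.1) + 2 * (grad (ω₁ t) x ⬝ᵥ grad (sigma0 m₀) x)
        + 2 * (grad (omega0 m₀) x ⬝ᵥ grad (σ₁ t) x)

end ExtremeKerr

end

/-! Fix a time and write s = σ₁, w = ω₁, v = w/η₀, a = ∂η₀/η₀, b = ∂ω₀/η₀. The three potential terms
of the energy density are |A|², |B|², |C|² with A = ∂s + v b, B = ∂v - s b, C = s b - v a. The proof
is elliptic: the evolution equations are solved for the Laplacians of s and w, and a Sobolev bound
turns L² control of the sources into a bound at a point. Only the kinetic part of the higher mass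
(through ṗ and ḋ) and the potential part of the mass enter.

Sobolev bound. In three dimensions f(x₀)² is at most a constant times the integral of |∇f|² + f²/L²
+ (Δf)² over the ball of radius L about x₀, uniformly for L ≥ ℓ (`exists_pointwise_bound`, and
`exists_axial_pointwise_bound` on the half plane). It follows by pairing a cut-off f with a
regularized Newton kernel. The uniformity in L allows balls whose radius grows with the distance
from the horizon.

Sources. In terms of A, B, C the Laplacians contain no derivative of the perturbation other than ṗ
and ḋ. What remains are products of background coefficients with A, B, C, s b and v b
(`sigma_pointwise_le`, `omega_pointwise_le`). Since |b|² is O(1/r²) for r ≥ d, the undifferentiated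
terms are controlled by (s² + v²)/r².

Hardy bound. A and B form a covariant derivative of the pair (s, v), and b acts on the pair as a
rotation, so it drops out of the derivative of κ = s² + v². Along a ray this gives |(√κ)'| ≤ (|A|² +
|B|²)^(1/2). As κ vanishes at infinity, Cauchy-Schwarz yields r κ(r) ≤ ∫ (|A|² + |B|²) t² dt.
Integrated over a dyadic shell, this bounds ∫ κ/r² by the energy with a constant independent of the
shell (`lintegral_shell_sq_le`). Shells suffice because each Sobolev ball lies in one. No condition
at the horizon is needed, as the rays are integrated from infinity.

For s at a point x₀ the ball has radius r₀/4; it avoids the horizon but may cross the axis, where s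
is smooth. For w it has radius ρ₀/4 and stays off the axis, so the weight needed is v²/ρ², stronger
than v²/r². The third term C supplies it: |a| is comparable to 1/ρ, and v a = s b - C. On that ball
η₀ is of size ρ₀², so w² is bounded by ρ₀⁴ times the energies. Dividing by η₀⁴ leaves ρ₀⁻⁴, which is
bounded for ρ₀ ≥ δ. -/

noncomputable section

namespace ExtremeKerr

/-! ### A pointwise bound in three dimensions -/

/-- Three-dimensional space with Cartesian coordinates `((x, y), z)`. -/
abbrev Space := (ℝ × ℝ) × ℝ

/-- The Euclidean square norm. -/
def sqNorm (x : Space) : ℝ := x.1.1 ^ 2 + x.1.2 ^ 2 + x.2 ^ 2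

/-- The coordinate vectors. -/
def axisVec : Fin 3 → Space := ![((1, 0), 0), ((0, 1), 0), ((0, 0), 1)]

/-- The Cartesian coordinates. -/
def coord (i : Fin 3) (x : Space) : ℝ := ![x.1.1, x.1.2, x.2] i

/-- The partial derivatives. -/
def partialD (i : Fin 3) (g : Space → ℝ) (x : Space) : ℝ := fderiv ℝ g x (axisVec i)

/-- The square length of the gradient. -/
def gradSq (g : Space → ℝ) (x : Space) : ℝ := ∑ i, partialD i g x ^ 2

/-- The flat Laplacian. -/
def flatLap (g : Space → ℝ) (x : Space) : ℝ := ∑ i, partialD i (partialD i g) x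

lemma continuous_sqNorm : Continuous sqNorm := by unfold sqNorm; fun_prop

lemma continuous_coord (i : Fin 3) : Continuous (coord i) := by
  unfold coord
  fin_cases i <;> simp <;> fun_prop

lemma sqNorm_nonneg (x : Space) : 0 ≤ sqNorm x := by unfold sqNorm; positivity

lemma sum_coord_sq (x : Space) : ∑ i, coord i x ^ 2 = sqNorm x := by
  simp [Fin.sum_univ_three, coord, sqNorm]

/-- The norm of `Space` is the maximum norm, so metric balls are cubes, while kernels and the
Laplacian are Euclidean. This comparison is the bridge between the two. -/
lemma norm_sq_le_sqNorm (x : Space) : ‖x‖ ^ 2 ≤ sqNorm x := by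
  have h : ‖x‖ ≤ √(sqNorm x) := by
    simp only [Prod.norm_def, Real.norm_eq_abs, sqNorm]
    refine max_le (max_le ?_ ?_) ?_ <;> refine Real.abs_le_sqrt ?_ <;> nlinarith [sq_nonneg x.1.1, sq_nonneg x.1.2, sq_nonneg x.2]
  calc ‖x‖ ^ 2 ≤ √(sqNorm x) ^ 2 := by gcongr
    _ = sqNorm x := Real.sq_sqrt (sqNorm_nonneg x)

lemma sqNorm_add_smul (x : Space) (t : ℝ) (i : Fin 3) :
    sqNorm (x + t • axisVec i) = sqNorm x + 2 * t * coord i x + t ^ 2 := by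
  fin_cases i <;> simp [sqNorm, axisVec, coord] <;> ring

lemma coord_add_smul (x : Space) (t : ℝ) (i : Fin 3) :
    coord i (x + t • axisVec i) = coord i x + t := by
  fin_cases i <;> simp [axisVec, coord]

/-- The regularized fundamental solution of the Laplacian. -/
def newton (e : ℝ) (x : Space) : ℝ := (√(sqNorm x + e))⁻¹

lemma sqrt_pos_of_sqNorm {e : ℝ} (he : 0 < e) (x : Space) : 0 < √(sqNorm x + e) :=
  Real.sqrt_pos.2 (by linarith [sqNorm_nonneg x])

lemma hasDerivAt_sqrt_sqNorm {e : ℝ} (he : 0 < e) (x : Space) (i : Fin 3) :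
    HasDerivAt (fun t : ℝ => √(sqNorm (x + t • axisVec i) + e))
      (coord i x / √(sqNorm x + e)) 0 := by
  have h : HasDerivAt (fun t : ℝ => sqNorm x + 2 * t * coord i x + t ^ 2 + e)
      (2 * coord i x) 0 := by
    have := ((((hasDerivAt_id (0 : ℝ)).const_mul 2).mul_const (coord i x)).const_add
      (sqNorm x)).add (hasDerivAt_pow 2 (0 : ℝ)) |>.add_const e
    convert! this using 1; simp
  have h2 := h.sqrt (by have := sqNorm_nonneg x; simp; linarith)
  simp only [sqNorm_add_smul]
  convert! h2 using 1
  have := (sqrt_pos_of_sqNorm he x).ne'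
  simp
  field_simp

lemma hasLineDerivAt_newton {e : ℝ} (he : 0 < e) (x : Space) (i : Fin 3) :
    HasLineDerivAt ℝ (newton e) (-coord i x / √(sqNorm x + e) ^ 3) x (axisVec i) := by
  have hS := (sqrt_pos_of_sqNorm he x).ne'
  have := (hasDerivAt_sqrt_sqNorm he x i).inv (by simpa using hS)
  unfold HasLineDerivAt newton
  convert! this using 1
  simp
  field_simp

lemma hasLineDerivAt_newton_deriv {e : ℝ} (he : 0 < e) (x : Space) (i : Fin 3) :
    HasLineDerivAt ℝ (fun x => -coord i x / √(sqNorm x + e) ^ 3)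
      (-1 / √(sqNorm x + e) ^ 3 + 3 * coord i x ^ 2 / √(sqNorm x + e) ^ 5) x (axisVec i) := by
  have hS := (sqrt_pos_of_sqNorm he x).ne'
  have h1 : HasDerivAt (fun t : ℝ => -(coord i (x + t • axisVec i))) (-1) 0 := by
    simp only [coord_add_smul]
    exact ((hasDerivAt_id (0 : ℝ)).const_add _).neg
  have := h1.div ((hasDerivAt_sqrt_sqNorm he x i).pow 3) (by simpa using hS)
  unfold HasLineDerivAt
  convert! this using 1
  simp
  field_simp

lemma continuous_inv_sqrt_sqNorm {e : ℝ} (he : 0 < e) (n : ℕ) :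
    Continuous fun x : Space => 1 / √(sqNorm x + e) ^ n := by
  have := continuous_sqNorm
  exact continuous_const.div (by fun_prop) fun x => pow_ne_zero _ (sqrt_pos_of_sqNorm he x).ne'

lemma continuous_newton {e : ℝ} (he : 0 < e) : Continuous (newton e) := by
  simpa [newton] using! continuous_inv_sqrt_sqNorm he 1

lemma continuous_newton_deriv {e : ℝ} (he : 0 < e) (i : Fin 3) :
    Continuous fun x : Space => -coord i x / √(sqNorm x + e) ^ 3 := by
  have := (continuous_coord i).neg.mul (continuous_inv_sqrt_sqNorm he 3)
  exact this.congr fun x => by simp [div_eq_mul_inv]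

lemma continuous_newton_deriv_deriv {e : ℝ} (he : 0 < e) (i : Fin 3) :
    Continuous fun x : Space =>
      -1 / √(sqNorm x + e) ^ 3 + 3 * coord i x ^ 2 / √(sqNorm x + e) ^ 5 := by
  have := (continuous_const (y := (-1 : ℝ))).mul (continuous_inv_sqrt_sqNorm he 3)
  have h2 := (((continuous_coord i).pow 2).const_mul 3).mul (continuous_inv_sqrt_sqNorm he 5)
  exact (this.add h2).congr fun x => by simp [div_eq_mul_inv]

instance isAddHaarMeasure_volume_real_prod : (volume : Measure (ℝ × ℝ)).IsAddHaarMeasure :=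
  inferInstanceAs ((volume : Measure ℝ).prod (volume : Measure ℝ)).IsAddHaarMeasure

instance isAddHaarMeasure_volume_space : (volume : Measure Space).IsAddHaarMeasure :=
  inferInstanceAs ((volume : Measure (ℝ × ℝ)).prod (volume : Measure ℝ)).IsAddHaarMeasure

/-! ### Integration by parts against the regularized Newton kernel -/

lemma integral_mul_partial {K K' : Space → ℝ} {g g' : Space → ℝ} {v : Space}
    (hK : Continuous K) (hK' : Continuous K') (hg : Continuous g) (hg' : Continuous g')
    (hgc : HasCompactSupport g) (hgc' : HasCompactSupport g')
    (hKd : ∀ x, HasLineDerivAt ℝ K (K' x) x v) (hgd : ∀ x, HasLineDerivAt ℝ g (g' x) x v) :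
    ∫ x, K x * g' x = -∫ x, K' x * g x :=
  integral_bilinear_hasLineDerivAt_right_eq_neg_left_of_integrable
    (B := ContinuousLinearMap.mul ℝ ℝ)
    ((hK'.mul hg).integrable_of_hasCompactSupport hgc.mul_left)
    ((hK.mul hg').integrable_of_hasCompactSupport hgc'.mul_left)
    ((hK.mul hg).integrable_of_hasCompactSupport hgc.mul_left)
    (fun x _ => hKd x) (fun x _ => hgd x)

section TestFunction

variable {g : Space → ℝ}

lemma contDiff_partialD (hg : ContDiff ℝ 2 g) (i : Fin 3) : ContDiff ℝ 1 (partialD i g) := by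
  unfold partialD
  exact (hg.fderiv_right (m := 1) (by norm_num)).clm_apply contDiff_const

lemma contDiff_partialD_partialD (hg : ContDiff ℝ 2 g) (i : Fin 3) :
    Continuous (partialD i (partialD i g)) := by
  have := contDiff_partialD hg i
  unfold partialD at this ⊢
  exact (this.continuous_fderiv (by norm_num)).clm_apply continuous_const

lemma hasCompactSupport_partialD (hc : HasCompactSupport g) (i : Fin 3) :
    HasCompactSupport (partialD i g) := by
  exact hc.fderiv_apply (𝕜 := ℝ) (axisVec i)

lemma hasLineDerivAt_partialD {x : Space} (hg : DifferentiableAt ℝ g x) (i : Fin 3) :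
    HasLineDerivAt ℝ g (partialD i g x) x (axisVec i) :=
  hg.hasFDerivAt.hasLineDerivAt _

lemma continuous_flatLap (hg : ContDiff ℝ 2 g) : Continuous (flatLap g) :=
  continuous_finsetSum _ fun i _ => contDiff_partialD_partialD hg i

lemma hasCompactSupport_flatLap (hc : HasCompactSupport g) : HasCompactSupport (flatLap g) := by
  have h := fun i => hasCompactSupport_partialD (hasCompactSupport_partialD hc i) i
  unfold flatLap
  simp only [Fin.sum_univ_three]
  exact ((h 0).add (h 1)).add (h 2)

lemma integral_newton_mul_partialD (hg : ContDiff ℝ 2 g) (hc : HasCompactSupport g)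
    {e : ℝ} (he : 0 < e) (i : Fin 3) :
    ∫ x, newton e x * partialD i (partialD i g) x =
      -∫ x, (-coord i x / √(sqNorm x + e) ^ 3) * partialD i g x :=
  integral_mul_partial (continuous_newton he) (continuous_newton_deriv he i)
    (contDiff_partialD hg i).continuous (contDiff_partialD_partialD hg i)
    (hasCompactSupport_partialD hc i)
    (hasCompactSupport_partialD (hasCompactSupport_partialD hc i) i)
    (fun x => hasLineDerivAt_newton he x i)
    (fun x => hasLineDerivAt_partialD ((contDiff_partialD hg i).differentiable (by norm_num) x) i)

lemma integral_newton_deriv_mul_partialD (hg : ContDiff ℝ 2 g) (hc : HasCompactSupport g)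
    {e : ℝ} (he : 0 < e) (i : Fin 3) :
    ∫ x, (-coord i x / √(sqNorm x + e) ^ 3) * partialD i g x =
      -∫ x, (-1 / √(sqNorm x + e) ^ 3 + 3 * coord i x ^ 2 / √(sqNorm x + e) ^ 5) * g x :=
  integral_mul_partial (continuous_newton_deriv he i) (continuous_newton_deriv_deriv he i)
    hg.continuous (contDiff_partialD hg i).continuous hc (hasCompactSupport_partialD hc i)
    (fun x => hasLineDerivAt_newton_deriv he x i)
    (fun x => hasLineDerivAt_partialD (hg.differentiable (by norm_num) x) i)

/-- Only one integration by parts. It serves e = 1: that kernel is not square integrable at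
infinity, but its gradient is. -/
lemma integral_newton_mul_flatLap (hg : ContDiff ℝ 2 g) (hc : HasCompactSupport g)
    {e : ℝ} (he : 0 < e) :
    ∫ x, newton e x * flatLap g x =
      -∫ x, ∑ i, (-coord i x / √(sqNorm x + e) ^ 3) * partialD i g x := by
  have h1 : ∀ i ∈ Finset.univ, Integrable fun x => newton e x * partialD i (partialD i g) x :=
    fun i _ => ((continuous_newton he).mul
      (contDiff_partialD_partialD hg i)).integrable_of_hasCompactSupport
      (hasCompactSupport_partialD (hasCompactSupport_partialD hc i) i).mul_left
  have h2 : ∀ i ∈ Finset.univ,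
      Integrable fun x => (-coord i x / √(sqNorm x + e) ^ 3) * partialD i g x :=
    fun i _ => ((continuous_newton_deriv he i).mul
      (contDiff_partialD hg i).continuous).integrable_of_hasCompactSupport
      (hasCompactSupport_partialD hc i).mul_left
  simp only [flatLap, Finset.mul_sum]
  rw [integral_finsetSum _ h1, integral_finsetSum _ h2, ← Finset.sum_neg_distrib]
  exact Finset.sum_congr rfl fun i _ => integral_newton_mul_partialD hg hc he i

/-- Two integrations by parts put the Laplacian on the kernel, where it equals -3 e / (|x|² +
e)^(5/2). This is an approximation of a negative multiple of the Dirac mass as e tends to 0. -/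
lemma integral_newton_mul_flatLap_eq (hg : ContDiff ℝ 2 g) (hc : HasCompactSupport g)
    {e : ℝ} (he : 0 < e) :
    ∫ x, newton e x * flatLap g x = -(3 * ∫ x, e / √(sqNorm x + e) ^ 5 * g x) := by
  have h1 : ∀ i ∈ Finset.univ, Integrable fun x => newton e x * partialD i (partialD i g) x :=
    fun i _ => ((continuous_newton he).mul
      (contDiff_partialD_partialD hg i)).integrable_of_hasCompactSupport
      (hasCompactSupport_partialD (hasCompactSupport_partialD hc i) i).mul_left
  have h2 : ∀ i ∈ Finset.univ, Integrable fun x =>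
      (-1 / √(sqNorm x + e) ^ 3 + 3 * coord i x ^ 2 / √(sqNorm x + e) ^ 5) * g x :=
    fun i _ => ((continuous_newton_deriv_deriv he i).mul
      hg.continuous).integrable_of_hasCompactSupport hc.mul_left
  have h3 : ∀ x, ∑ i, (-1 / √(sqNorm x + e) ^ 3 + 3 * coord i x ^ 2 / √(sqNorm x + e) ^ 5) * g x
      = -3 * (e / √(sqNorm x + e) ^ 5 * g x) := by
    intro x
    have hS := sqrt_pos_of_sqNorm he x
    have hq : √(sqNorm x + e) ^ 2 = sqNorm x + e :=
      Real.sq_sqrt (by linarith [sqNorm_nonneg x])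
    have hN := sum_coord_sq x
    simp only [Fin.sum_univ_three] at hN ⊢
    generalize √(sqNorm x + e) = S at *
    field_simp
    linear_combination (3 * hN - 3 * hq) * g x
  have h4 : ∀ i, ∫ x, newton e x * partialD i (partialD i g) x =
      ∫ x, (-1 / √(sqNorm x + e) ^ 3 + 3 * coord i x ^ 2 / √(sqNorm x + e) ^ 5) * g x := by
    intro i
    rw [integral_newton_mul_partialD hg hc he, integral_newton_deriv_mul_partialD hg hc he, neg_neg]
  simp only [flatLap, Finset.mul_sum]
  rw [integral_finsetSum _ h1, Finset.sum_congr rfl fun i _ => h4 i, ← integral_finsetSum _ h2]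
  simp only [h3, integral_const_mul]
  ring

end TestFunction

/-! ### Square integrability of the kernels -/

lemma finrank_space : Module.finrank ℝ Space = 3 := by simp [Module.finrank_prod]

lemma rpow_norm_eq (x : Space) (n : ℕ) :
    ((1 : ℝ) + ‖x‖ ^ 2) ^ (-(n : ℝ) / 2) = 1 / √(1 + ‖x‖ ^ 2) ^ n := by
  rw [Real.sqrt_eq_rpow, ← Real.rpow_natCast (_ ^ (1 / 2 : ℝ)) n, ← Real.rpow_mul (by positivity),
    one_div ((1 + ‖x‖ ^ 2) ^ _), ← Real.rpow_neg (by positivity)]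
  congr 1
  ring

lemma integrable_inv_one_add_pow {n : ℕ} (hn : 3 < n) :
    Integrable fun x : Space => 1 / √(sqNorm x + 1) ^ n := by
  have h := integrable_rpow_neg_one_add_norm_sq (E := Space) (μ := volume) (r := n)
    (by rw [finrank_space]; exact_mod_cast hn)
  refine h.mono' (continuous_inv_sqrt_sqNorm one_pos n).aestronglyMeasurable
    (Eventually.of_forall fun x => ?_)
  rw [rpow_norm_eq, Real.norm_of_nonneg (by positivity)]
  have := norm_sq_le_sqNorm x
  gcongr 1 / ?_ ^ _
  exact Real.sqrt_le_sqrt (by linarith)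

/-- The singularity |x|⁻² is integrable in dimension three and the tail decays like |x|⁻⁶. The
integral is first taken for the maximum norm, where it is radial, and the Euclidean version follows
by comparison. -/
lemma integrable_newton_sub_majorant :
    Integrable fun x : Space => 1 / (sqNorm x * (1 + sqNorm x) ^ 2) := by
  have h0 : Integrable fun x : Space => 1 / (‖x‖ ^ 2 * (1 + ‖x‖ ^ 2) ^ 2) := by
    rw [integrable_fun_norm_addHaar volume (f := fun y => 1 / (y ^ 2 * (1 + y ^ 2) ^ 2)),
      finrank_space]
    refine (integrable_inv_one_add_sq.integrableOn (s := Ioi (0 : ℝ))).mono' ?_ ?_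
    · exact (by fun_prop : Measurable fun y : ℝ =>
        y ^ (3 - 1) • (1 / (y ^ 2 * (1 + y ^ 2) ^ 2))).aestronglyMeasurable
    · refine (ae_restrict_iff' measurableSet_Ioi).2 (Eventually.of_forall fun y hy => ?_)
      have hy : 0 < y := hy
      rw [Real.norm_of_nonneg (by simp; positivity)]
      have h1 : y ^ (3 - 1) • (1 / (y ^ 2 * (1 + y ^ 2) ^ 2)) = 1 / (1 + y ^ 2) ^ 2 := by
        simp; field_simp
      rw [h1, ← one_div]
      gcongr
      nlinarith [sq_nonneg y, sq_nonneg (y ^ 2)]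
  refine h0.mono' ?_ ?_
  · have := continuous_sqNorm.measurable
    exact (by fun_prop : Measurable fun x : Space =>
      1 / (sqNorm x * (1 + sqNorm x) ^ 2)).aestronglyMeasurable
  · have h1 : ∀ᵐ x : Space, x ≠ 0 := by simp [ae_iff, measure_singleton]
    filter_upwards [h1] with x hx
    have := norm_sq_le_sqNorm x
    have := norm_pos_iff.2 hx
    have := sqNorm_nonneg x
    rw [Real.norm_of_nonneg (by positivity)]
    gcongr

/-- Subtracting the kernel with e = 1 removes the slow tail, so the difference is square integrable
uniformly in e. With U = |x| and T = √(|x|² + 1), T² - U² = 1 gives T - U ≤ 1/T, hence 1/U - 1/T ≤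
1/(U T²). -/
lemma newton_sub_sq_le {e : ℝ} (he : 0 < e) (he1 : e ≤ 1) {x : Space} (hx : x ≠ 0) :
    (newton e x - newton 1 x) ^ 2 ≤ 1 / (sqNorm x * (1 + sqNorm x) ^ 2) := by
  have hN : 0 < sqNorm x := by
    have := norm_sq_le_sqNorm x
    have := norm_pos_iff.2 hx
    nlinarith
  have hS := sqrt_pos_of_sqNorm he x
  have hT := sqrt_pos_of_sqNorm one_pos x
  have hU := Real.sqrt_pos.2 hN
  have hUS : √(sqNorm x) ≤ √(sqNorm x + e) := Real.sqrt_le_sqrt (by linarith)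
  have hST : √(sqNorm x + e) ≤ √(sqNorm x + 1) := Real.sqrt_le_sqrt (by linarith)
  have hT2 : √(sqNorm x + 1) ^ 2 = sqNorm x + 1 := Real.sq_sqrt (by linarith)
  have hU2 : √(sqNorm x) ^ 2 = sqNorm x := Real.sq_sqrt hN.le
  unfold newton
  have h0 : 0 ≤ (√(sqNorm x + e))⁻¹ - (√(sqNorm x + 1))⁻¹ :=
    sub_nonneg.2 (inv_anti₀ hS hST)
  have h1 : (√(sqNorm x + e))⁻¹ - (√(sqNorm x + 1))⁻¹ ≤ 1 / (√(sqNorm x) * (1 + sqNorm x)) := by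
    have h2 : (√(sqNorm x + e))⁻¹ ≤ (√(sqNorm x))⁻¹ := inv_anti₀ hU hUS
    have h3 : (√(sqNorm x))⁻¹ - (√(sqNorm x + 1))⁻¹ ≤ 1 / (√(sqNorm x) * (1 + sqNorm x)) := by
      generalize √(sqNorm x + 1) = T at *
      generalize √(sqNorm x) = U at *
      have hTU : T - U ≤ 1 / T := by
        rw [le_div_iff₀ hT]; nlinarith
      rw [← hU2]
      have : U⁻¹ - T⁻¹ = (T - U) * (1 / (U * T)) := by field_simp
      rw [this]
      calc (T - U) * (1 / (U * T)) ≤ (1 / T) * (1 / (U * T)) := by gcongr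
        _ = 1 / (U * T ^ 2) := by field_simp
        _ = _ := by rw [hT2, ← hU2]; ring_nf
    linarith
  calc _ ≤ (1 / (√(sqNorm x) * (1 + sqNorm x))) ^ 2 := by gcongr
    _ = _ := by rw [div_pow, mul_pow, hU2]; ring

lemma sum_newton_deriv_sq_le (x : Space) :
    ∑ i, (-coord i x / √(sqNorm x + 1) ^ 3) ^ 2 ≤ 1 / √(sqNorm x + 1) ^ 4 := by
  have hT := sqrt_pos_of_sqNorm one_pos x
  have hT2 : √(sqNorm x + 1) ^ 2 = sqNorm x + 1 := Real.sq_sqrt (by linarith [sqNorm_nonneg x])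
  simp only [div_pow, neg_sq, ← Finset.sum_div, sum_coord_sq]
  rw [div_le_div_iff₀ (by positivity) (by positivity)]
  generalize √(sqNorm x + 1) = T at *
  have : sqNorm x = T ^ 2 - 1 := by linarith
  rw [this]
  have := pow_pos hT 4
  nlinarith

/-! ### The bound at the origin for a test function -/

section TestFunction

variable {g : Space → ℝ}

lemma tendsto_integral_mul_smul (hg : Continuous g) (hc : HasCompactSupport g) :
    Tendsto (fun n : ℕ => ∫ y : Space, 1 / √(sqNorm y + 1) ^ 5 * g ((1 / ((n : ℝ) + 1)) • y)) atTop
      (𝓝 (∫ y : Space, 1 / √(sqNorm y + 1) ^ 5 * g 0)) := by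
  obtain ⟨M, hM⟩ := hc.exists_bound_of_continuous hg
  refine tendsto_integral_of_dominated_convergence (fun y => 1 / √(sqNorm y + 1) ^ 5 * M)
    (fun n => ?_) ((integrable_inv_one_add_pow (by norm_num)).mul_const _) (fun n => ?_) ?_
  · exact ((continuous_inv_sqrt_sqNorm one_pos 5).mul
      (hg.comp (continuous_const_smul _))).aestronglyMeasurable
  · refine Eventually.of_forall fun y => ?_
    rw [norm_mul, Real.norm_of_nonneg (by positivity)]
    gcongr
    exact hM _
  · refine Eventually.of_forall fun y => Tendsto.const_mul _ ?_
    have h : Tendsto (fun n : ℕ => (1 / ((n : ℝ) + 1)) • y) atTop (𝓝 0) := by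
      simpa using (tendsto_one_div_add_atTop_nhds_zero_nat (𝕜 := ℝ)).smul_const y
    exact (hg.tendsto 0).comp h

lemma sqNorm_smul (c : ℝ) (x : Space) : sqNorm (c • x) = c ^ 2 * sqNorm x := by
  simp [sqNorm]; ring

/-- The substitution x = c y turns the approximate Dirac mass with e = c² into a fixed integrable
profile tested against g(c y), ready for dominated convergence. -/
lemma integral_approx_eq {c : ℝ} (hc : 0 < c) :
    ∫ x, c ^ 2 / √(sqNorm x + c ^ 2) ^ 5 * g x =
      ∫ y : Space, 1 / √(sqNorm y + 1) ^ 5 * g (c • y) := by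
  have h := Measure.integral_comp_smul (μ := (volume : Measure Space))
    (fun x => c ^ 2 / √(sqNorm x + c ^ 2) ^ 5 * g x) c
  rw [finrank_space, abs_of_pos (by positivity), smul_eq_mul] at h
  rw [eq_comm, ← div_eq_inv_mul, div_eq_iff (by positivity)] at h
  rw [h, ← integral_mul_const]
  congr 1
  ext y
  have : √(sqNorm (c • y) + c ^ 2) = c * √(sqNorm y + 1) := by
    rw [sqNorm_smul, show c ^ 2 * sqNorm y + c ^ 2 = c ^ 2 * (sqNorm y + 1) by ring,
      Real.sqrt_mul (by positivity), Real.sqrt_sq hc.le]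
  rw [this]
  have := sqrt_pos_of_sqNorm one_pos y
  field_simp

/-- The constant of the pointwise bound. -/
def newtonConst : ℝ :=
  (∫ x : Space, 1 / (sqNorm x * (1 + sqNorm x) ^ 2)) + ∫ x : Space, 1 / √(sqNorm x + 1) ^ 4

/-- The mass of the Laplacian of the regularized fundamental solution, up to a factor. -/
def newtonMass : ℝ := ∫ y : Space, 1 / √(sqNorm y + 1) ^ 5

lemma newtonMass_pos : 0 < newtonMass := by
  refine (integral_pos_iff_support_of_nonneg (fun y => by positivity)
    (integrable_inv_one_add_pow (by norm_num))).2 ?_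
  have : (Function.support fun y : Space => 1 / √(sqNorm y + 1) ^ 5) = univ := by
    ext y
    simp [(sqrt_pos_of_sqNorm one_pos y).ne']
  rw [this]
  exact Measure.measure_univ_pos.2 (NeZero.ne _)

lemma integrable_gradSq_add (hg : ContDiff ℝ 2 g) (hc : HasCompactSupport g) :
    Integrable fun x => gradSq g x + flatLap g x ^ 2 := by
  refine Integrable.add (integrable_finsetSum _ fun i _ => ?_) ?_
  · simp only [pow_two]
    exact ((contDiff_partialD hg i).continuous.mul
      (contDiff_partialD hg i).continuous).integrable_of_hasCompactSupport
      (hasCompactSupport_partialD hc i).mul_left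
  · simp only [pow_two]
    exact ((continuous_flatLap hg).mul (continuous_flatLap hg)).integrable_of_hasCompactSupport
      (hasCompactSupport_flatLap hc).mul_left

/-- Split the kernel as (N_e - N_1) + N_1. The first part is in L² uniformly in e and is paired with
Δg; the second is integrated by parts once and its gradient, in L², is paired with ∇g. Young's
inequality then gives a bound independent of e. -/
lemma integral_approx_le (hg : ContDiff ℝ 2 g) (hc : HasCompactSupport g) {e : ℝ} (he : 0 < e)
    (he1 : e ≤ 1) :
    3 * ∫ x, e / √(sqNorm x + e) ^ 5 * g x ≤
      (newtonConst + ∫ x, (gradSq g x + flatLap g x ^ 2)) / 2 := by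
  have i1 : ∀ {e : ℝ}, 0 < e → Integrable fun x => newton e x * flatLap g x := fun he =>
    ((continuous_newton he).mul (continuous_flatLap hg)).integrable_of_hasCompactSupport
      (hasCompactSupport_flatLap hc).mul_left
  have i2 : Integrable fun x => ∑ i, (-coord i x / √(sqNorm x + 1) ^ 3) * partialD i g x :=
    integrable_finsetSum _ fun i _ => ((continuous_newton_deriv one_pos i).mul
      (contDiff_partialD hg i).continuous).integrable_of_hasCompactSupport
      (hasCompactSupport_partialD hc i).mul_left
  have h1 := integral_newton_mul_flatLap_eq hg hc he
  have h2 := integral_newton_mul_flatLap hg hc one_pos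
  have h3 : 3 * ∫ x, e / √(sqNorm x + e) ^ 5 * g x =
      ∫ x, ((newton 1 x * flatLap g x - newton e x * flatLap g x) +
        ∑ i, (-coord i x / √(sqNorm x + 1) ^ 3) * partialD i g x) := by
    have i3 : Integrable fun x => newton 1 x * flatLap g x - newton e x * flatLap g x :=
      (i1 one_pos).sub (i1 he)
    rw [integral_add i3 i2, integral_sub (i1 one_pos) (i1 he)]
    linarith
  rw [h3]
  have i4 : Integrable fun x : Space => 1 / √(sqNorm x + 1) ^ 4 :=
    integrable_inv_one_add_pow (by norm_num)
  have i5 : Integrable fun x : Space =>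
      1 / (sqNorm x * (1 + sqNorm x) ^ 2) + 1 / √(sqNorm x + 1) ^ 4 :=
    integrable_newton_sub_majorant.add i4
  have h4 : (newtonConst + ∫ x, (gradSq g x + flatLap g x ^ 2)) / 2 =
      ∫ x, (1 / (sqNorm x * (1 + sqNorm x) ^ 2) + 1 / √(sqNorm x + 1) ^ 4 +
        (gradSq g x + flatLap g x ^ 2)) / 2 := by
    rw [integral_div, integral_add i5 (integrable_gradSq_add hg hc),
      integral_add integrable_newton_sub_majorant i4]
    rfl
  rw [h4]
  refine integral_mono_ae (((i1 one_pos).sub (i1 he)).add i2)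
    ((i5.add (integrable_gradSq_add hg hc)).div_const 2) ?_
  have hx : ∀ᵐ x : Space, x ≠ 0 := by simp [ae_iff, measure_singleton]
  filter_upwards [hx] with x hx
  have k1 := newton_sub_sq_le he he1 hx
  have k2 := sum_newton_deriv_sq_le x
  simp only [gradSq, Fin.sum_univ_three] at k2 ⊢
  -- Each product is bounded by half the sum of the squares of its factors; the kernel squares are
  -- dominated by k1 and k2.
  nlinarith [sq_nonneg (newton e x - newton 1 x + flatLap g x),
    sq_nonneg (-coord 0 x / √(sqNorm x + 1) ^ 3 - partialD 0 g x),
    sq_nonneg (-coord 1 x / √(sqNorm x + 1) ^ 3 - partialD 1 g x),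
    sq_nonneg (-coord 2 x / √(sqNorm x + 1) ^ 3 - partialD 2 g x)]

lemma apply_zero_le (hg : ContDiff ℝ 2 g) (hc : HasCompactSupport g) :
    3 * newtonMass * g 0 ≤ (newtonConst + ∫ x, (gradSq g x + flatLap g x ^ 2)) / 2 := by
  have h := (tendsto_integral_mul_smul hg.continuous hc).const_mul 3
  rw [integral_mul_const, ← mul_assoc] at h
  refine le_of_tendsto h (Eventually.of_forall fun n => ?_)
  have hn : (0 : ℝ) < 1 / ((n : ℝ) + 1) := by positivity
  rw [← integral_approx_eq hn]
  refine integral_approx_le hg hc (by positivity) ?_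
  refine pow_le_one₀ hn.le ?_
  rw [div_le_one (by positivity)]
  linarith [n.cast_nonneg (α := ℝ)]

/-- A function is bounded at a point by the `L²` norms of its gradient and Laplacian. -/
lemma sq_apply_zero_le (hg : ContDiff ℝ 2 g) (hc : HasCompactSupport g) :
    (3 * newtonMass) ^ 2 * g 0 ^ 2 ≤
      newtonConst * ∫ x, (gradSq g x + flatLap g x ^ 2) := by
  set Q := ∫ x, (gradSq g x + flatLap g x ^ 2) with hQ
  -- The preceding bound is inhomogeneous in g. Applied to all multiples l g it says that a
  -- quadratic polynomial in l is nonnegative, and its discriminant gives the homogeneous bound for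
  -- the square.
  have key : ∀ l : ℝ, 0 ≤ Q / 2 * (l * l) + (-(3 * newtonMass * g 0)) * l + newtonConst / 2 := by
    intro l
    have hlg : ContDiff ℝ 2 fun x => l * g x := contDiff_const.mul hg
    have hlc : HasCompactSupport fun x => l * g x := hc.mul_left
    have h := apply_zero_le hlg hlc
    have hD : ∀ i (g : Space → ℝ), partialD i (fun x => l * g x) = fun x => l * partialD i g x := by
      intro i g
      ext x
      unfold partialD
      rw [show (fun x => l * g x) = l • g from rfl, fderiv_const_smul_field]
      simp
    have hQl : ∫ x, (gradSq (fun x => l * g x) x + flatLap (fun x => l * g x) x ^ 2) =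
        l * l * Q := by
      rw [hQ, ← integral_const_mul]
      congr 1
      ext x
      simp only [gradSq, flatLap, hD, Fin.sum_univ_three]
      ring
    rw [hQl] at h
    linarith
  have h := discrim_le_zero key
  unfold discrim at h
  linarith

end TestFunction

/-! ### Derivative rules and localization by a cutoff -/

lemma partialD_comp_smul {g : Space → ℝ} (hg : Differentiable ℝ g) (c : ℝ) (i : Fin 3)
    (y : Space) : partialD i (fun y => g (c • y)) y = c * partialD i g (c • y) := by
  have h : HasFDerivAt (fun y : Space => g (c • y))
      ((fderiv ℝ g (c • y)).comp (c • ContinuousLinearMap.id ℝ Space)) y :=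
    (hg (c • y)).hasFDerivAt.comp y ((hasFDerivAt_id y).const_smul c)
  unfold partialD
  rw [h.fderiv]
  simp

lemma partialD_comp_add (f : Space → ℝ) (x₀ : Space) (i : Fin 3) (y : Space) :
    partialD i (fun y => f (x₀ + y)) y = partialD i f (x₀ + y) := by
  unfold partialD
  rw [fderiv_comp_add_left]

lemma partialD_mul {f g : Space → ℝ} {y : Space} (hf : DifferentiableAt ℝ f y)
    (hg : DifferentiableAt ℝ g y) (i : Fin 3) :
    partialD i (fun y => f y * g y) y = partialD i f y * g y + f y * partialD i g y := by
  unfold partialD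
  rw [fderiv_fun_mul hf hg]
  simp
  ring

lemma partialD_add {f g : Space → ℝ} {y : Space} (hf : DifferentiableAt ℝ f y)
    (hg : DifferentiableAt ℝ g y) (i : Fin 3) :
    partialD i (fun y => f y + g y) y = partialD i f y + partialD i g y := by
  unfold partialD
  rw [fderiv_fun_add hf hg]
  simp

lemma partialD_congr {f g : Space → ℝ} {y : Space} (h : f =ᶠ[𝓝 y] g) (i : Fin 3) :
    partialD i f =ᶠ[𝓝 y] partialD i g :=
  h.fderiv.mono fun z hz => by unfold partialD; rw [hz]

lemma contDiffAt_partialD {f : Space → ℝ} {y : Space} (hf : ContDiffAt ℝ 2 f y) (i : Fin 3) :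
    ContDiffAt ℝ 1 (partialD i f) y := by
  unfold partialD
  exact (hf.fderiv_right (m := 1) (by norm_num)).clm_apply contDiffAt_const

lemma gradSq_flatLap_congr {f g : Space → ℝ} {y : Space} (h : f =ᶠ[𝓝 y] g) :
    gradSq f y = gradSq g y ∧ flatLap f y = flatLap g y :=
  ⟨Finset.sum_congr rfl fun i _ => by rw [(partialD_congr h i).eq_of_nhds],
    Finset.sum_congr rfl fun i _ => by rw [(partialD_congr (partialD_congr h i) i).eq_of_nhds]⟩

lemma partialD_partialD_mul {f g : Space → ℝ} {y : Space} (hf : ContDiffAt ℝ 2 f y)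
    (hg : ContDiffAt ℝ 2 g y) (i : Fin 3) :
    partialD i (partialD i fun y => f y * g y) y =
      partialD i (partialD i f) y * g y + 2 * (partialD i f y * partialD i g y) +
        f y * partialD i (partialD i g) y := by
  have ev : partialD i (fun y => f y * g y) =ᶠ[𝓝 y]
      fun y => partialD i f y * g y + f y * partialD i g y := by
    filter_upwards [hf.eventually (by simp), hg.eventually (by simp)] with z hz1 hz2
    exact partialD_mul (hz1.differentiableAt (by norm_num)) (hz2.differentiableAt (by norm_num)) i
  have df := hf.differentiableAt (by norm_num)
  have dg := hg.differentiableAt (by norm_num)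
  have df' := (contDiffAt_partialD hf i).differentiableAt (by norm_num)
  have dg' := (contDiffAt_partialD hg i).differentiableAt (by norm_num)
  rw [(partialD_congr ev i).eq_of_nhds, partialD_add (f := fun y => partialD i f y * g y)
    (g := fun y => f y * partialD i g y) (df'.fun_mul dg) (df.fun_mul dg'),
    partialD_mul df' dg, partialD_mul df dg']
  ring

/-- A cutoff supported in the ball of radius `1 / 2`. -/
def cutoff : ContDiffBump (0 : Space) := ⟨1 / 4, 1 / 2, by norm_num, by norm_num⟩

lemma contDiff_cutoff : ContDiff ℝ 2 (cutoff : Space → ℝ) := cutoff.contDiff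

lemma exists_cutoff_bound : ∃ M : ℝ, 0 ≤ M ∧ ∀ i y, |partialD i cutoff y| ≤ M ∧
    |partialD i (partialD i cutoff) y| ≤ M := by
  have h1 := fun i => (hasCompactSupport_partialD cutoff.hasCompactSupport
    i).exists_bound_of_continuous (contDiff_partialD contDiff_cutoff i).continuous
  have h2 := fun i => (hasCompactSupport_partialD (hasCompactSupport_partialD
    cutoff.hasCompactSupport i) i).exists_bound_of_continuous
    (contDiff_partialD_partialD contDiff_cutoff i)
  choose a ha using h1
  choose b hb using h2
  have ha0 : ∀ i, 0 ≤ a i := fun i => (norm_nonneg _).trans (ha i 0)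
  have hb0 : ∀ i, 0 ≤ b i := fun i => (norm_nonneg _).trans (hb i 0)
  refine ⟨∑ i, (a i + b i), Finset.sum_nonneg fun i _ => add_nonneg (ha0 i) (hb0 i), fun i y => ?_⟩
  have h : a i + b i ≤ ∑ i, (a i + b i) :=
    Finset.single_le_sum (f := fun i => a i + b i) (fun i _ => add_nonneg (ha0 i) (hb0 i))
      (Finset.mem_univ i)
  exact ⟨(ha i y).trans (by linarith [hb0 i]), (hb i y).trans (by linarith [ha0 i])⟩

section Localize

variable {f : Space → ℝ} {x₀ : Space} {L : ℝ}

/-- The function `f`, recentred at `x₀` and cut off at the scale `L`. -/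
def localized (f : Space → ℝ) (x₀ : Space) (L : ℝ) (y : Space) : ℝ :=
  cutoff (L⁻¹ • y) * f (x₀ + y)

lemma localized_eventually_eq_zero (hL : 0 < L) {y : Space} (hy : L ≤ ‖y‖) :
    localized f x₀ L =ᶠ[𝓝 y] fun _ => 0 := by
  have h : ∀ᶠ z in 𝓝 y, L / 2 < ‖z‖ :=
    continuous_norm.continuousAt.eventually_const_lt (by linarith)
  filter_upwards [h] with z hz
  have : cutoff (L⁻¹ • z) = 0 := by
    refine cutoff.zero_of_le_dist ?_
    rw [dist_zero_right, norm_smul, Real.norm_of_nonneg (by positivity)]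
    change 1 / 2 ≤ _
    rw [← div_eq_inv_mul, le_div_iff₀ hL]
    linarith
  simp [localized, this]

lemma contDiffAt_translate (hf : ContDiffOn ℝ 2 f (Metric.ball x₀ L)) {y : Space} (hy : ‖y‖ < L) :
    ContDiffAt ℝ 2 (fun y => f (x₀ + y)) y := by
  have : ContDiffAt ℝ 2 f (x₀ + y) := hf.contDiffAt (Metric.isOpen_ball.mem_nhds (by simpa using hy))
  exact this.comp y (by fun_prop)

lemma contDiff_scaled_cutoff : ContDiff ℝ 2 fun y : Space => cutoff (L⁻¹ • y) :=
  contDiff_cutoff.comp (by fun_prop)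

lemma contDiff_localized (hL : 0 < L) (hf : ContDiffOn ℝ 2 f (Metric.ball x₀ L)) :
    ContDiff ℝ 2 (localized f x₀ L) := by
  refine contDiff_iff_contDiffAt.2 fun y => ?_
  by_cases hy : ‖y‖ < L
  · exact contDiff_scaled_cutoff.contDiffAt.mul (contDiffAt_translate hf hy)
  · exact contDiffAt_const.congr_of_eventuallyEq (localized_eventually_eq_zero hL (not_lt.1 hy))

lemma hasCompactSupport_localized (hL : 0 < L) : HasCompactSupport (localized f x₀ L) := by
  refine HasCompactSupport.intro (isCompact_closedBall (0 : Space) L) fun y hy => ?_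
  have hy : L < ‖y‖ := by simpa using hy
  exact (localized_eventually_eq_zero hL hy.le).eq_of_nhds

/-- Every derivative falling on the cutoff costs a factor 1/L. In the term L⁻² f of the Laplacian,
squared, one factor L⁻² stays with f² as the Hardy weight and the other is bounded by ℓ⁻². Thus the
constant does not depend on L. -/
lemma localized_bound {M ℓ : ℝ}
    (hb : ∀ i y, |partialD i cutoff y| ≤ M ∧ |partialD i (partialD i cutoff) y| ≤ M)
    (hℓ : 0 < ℓ) (hL : ℓ ≤ L) (hf : ContDiffOn ℝ 2 f (Metric.ball x₀ L)) {y : Space}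
    (hy : ‖y‖ < L) :
    gradSq (localized f x₀ L) y + flatLap (localized f x₀ L) y ^ 2 ≤
      (6 * M ^ 2 + 63 * M ^ 2 / ℓ ^ 2 + 5) *
      (gradSq f (x₀ + y) + f (x₀ + y) ^ 2 / L ^ 2 + flatLap f (x₀ + y) ^ 2) := by
  have hL0 : 0 < L := hℓ.trans_le hL
  have cz : ContDiff ℝ 2 fun y : Space => cutoff (L⁻¹ • y) := contDiff_scaled_cutoff
  have cF := contDiffAt_translate hf hy
  have dcut : Differentiable ℝ (cutoff : Space → ℝ) := contDiff_cutoff.differentiable (by norm_num)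
  have z1 : ∀ i, partialD i (fun y : Space => cutoff (L⁻¹ • y)) =
      fun y => L⁻¹ * partialD i cutoff (L⁻¹ • y) :=
    fun i => funext fun y => partialD_comp_smul dcut _ i y
  have z2 : ∀ i, partialD i (partialD i fun y : Space => cutoff (L⁻¹ • y)) y =
      L⁻¹ ^ 2 * partialD i (partialD i cutoff) (L⁻¹ • y) := by
    intro i
    have dp : Differentiable ℝ (partialD i (cutoff : Space → ℝ)) :=
      (contDiff_partialD contDiff_cutoff i).differentiable (by norm_num)
    rw [z1, partialD_mul (f := fun _ => L⁻¹) (g := fun y => partialD i cutoff (L⁻¹ • y))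
      (by fun_prop) (dp.fun_comp (by fun_prop) |>.differentiableAt), partialD_comp_smul dp]
    simp [partialD]
    ring
  have F1 : ∀ i, partialD i (fun y => f (x₀ + y)) = fun y => partialD i f (x₀ + y) :=
    fun i => funext fun y => partialD_comp_add f x₀ i y
  have g1 : ∀ i, partialD i (localized f x₀ L) y =
      L⁻¹ * partialD i cutoff (L⁻¹ • y) * f (x₀ + y) +
        cutoff (L⁻¹ • y) * partialD i f (x₀ + y) := by
    intro i
    have := partialD_mul (cz.contDiffAt.differentiableAt (x := y) (by norm_num))
      (cF.differentiableAt (by norm_num)) i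
    rw [z1, F1] at this
    exact this
  have g2 : ∀ i, partialD i (partialD i (localized f x₀ L)) y =
      L⁻¹ ^ 2 * partialD i (partialD i cutoff) (L⁻¹ • y) * f (x₀ + y) +
        2 * (L⁻¹ * partialD i cutoff (L⁻¹ • y) * partialD i f (x₀ + y)) +
        cutoff (L⁻¹ • y) * partialD i (partialD i f) (x₀ + y) := by
    intro i
    have := partialD_partialD_mul (cz.contDiffAt (x := y)) cF i
    rw [z2, z1, F1, partialD_comp_add] at this
    exact this
  have hz0 : 0 ≤ cutoff (L⁻¹ • y) := cutoff.nonneg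
  have hz1 : cutoff (L⁻¹ • y) ≤ 1 := cutoff.le_one
  have hcl : L⁻¹ ^ 2 ≤ 1 / ℓ ^ 2 := by
    rw [inv_pow, ← one_div]
    gcongr
  have hsq1 : ∀ i, partialD i cutoff (L⁻¹ • y) ^ 2 ≤ M ^ 2 := fun i =>
    sq_le_sq' (neg_le_of_abs_le (hb i _).1) (le_of_abs_le (hb i _).1)
  have hsq2 : ∀ i, partialD i (partialD i cutoff) (L⁻¹ • y) ^ 2 ≤ M ^ 2 := fun i =>
    sq_le_sq' (neg_le_of_abs_le (hb i _).2) (le_of_abs_le (hb i _).2)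
  have hzz : cutoff (L⁻¹ • y) ^ 2 ≤ 1 := pow_le_one₀ hz0 hz1
  have hA : gradSq (localized f x₀ L) y ≤
      6 * M ^ 2 * (f (x₀ + y) ^ 2 / L ^ 2) + 2 * gradSq f (x₀ + y) := by
    have : ∀ i, partialD i (localized f x₀ L) y ^ 2 ≤
        2 * M ^ 2 * (f (x₀ + y) ^ 2 / L ^ 2) + 2 * partialD i f (x₀ + y) ^ 2 := by
      intro i
      rw [g1]
      calc _ ≤ 2 * (L⁻¹ * partialD i cutoff (L⁻¹ • y) * f (x₀ + y)) ^ 2 +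
            2 * (cutoff (L⁻¹ • y) * partialD i f (x₀ + y)) ^ 2 := by
              nlinarith [sq_nonneg (L⁻¹ * partialD i cutoff (L⁻¹ • y) * f (x₀ + y) -
                cutoff (L⁻¹ • y) * partialD i f (x₀ + y))]
        _ = 2 * partialD i cutoff (L⁻¹ • y) ^ 2 * (f (x₀ + y) ^ 2 / L ^ 2) +
            2 * (cutoff (L⁻¹ • y) ^ 2 * partialD i f (x₀ + y) ^ 2) := by
              field_simp
        _ ≤ 2 * M ^ 2 * (f (x₀ + y) ^ 2 / L ^ 2) + 2 * (1 * partialD i f (x₀ + y) ^ 2) := by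
              have := hsq1 i
              gcongr
        _ = _ := by ring
    unfold gradSq
    have h0 := this 0
    have h1 := this 1
    have h2 := this 2
    simp only [Fin.sum_univ_three]
    linarith
  have hB : flatLap (localized f x₀ L) y ^ 2 ≤ 27 * M ^ 2 / ℓ ^ 2 * (f (x₀ + y) ^ 2 / L ^ 2) +
      36 * M ^ 2 / ℓ ^ 2 * gradSq f (x₀ + y) + 3 * flatLap f (x₀ + y) ^ 2 := by
    have e : flatLap (localized f x₀ L) y =
        L⁻¹ ^ 2 * f (x₀ + y) * (∑ i, partialD i (partialD i cutoff) (L⁻¹ • y)) +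
        2 * L⁻¹ * (∑ i, partialD i cutoff (L⁻¹ • y) * partialD i f (x₀ + y)) +
        cutoff (L⁻¹ • y) * flatLap f (x₀ + y) := by
      unfold flatLap
      simp only [g2, Fin.sum_univ_three]
      ring
    have c1 : (∑ i, partialD i (partialD i cutoff) (L⁻¹ • y)) ^ 2 ≤ 9 * M ^ 2 := by
      have := sq_sum_le_card_mul_sum_sq (s := Finset.univ)
        (f := fun i => partialD i (partialD i cutoff) (L⁻¹ • y))
      simp only [Fin.sum_univ_three, Finset.card_univ, Fintype.card_fin, Nat.cast_ofNat] at this ⊢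
      linarith [hsq2 0, hsq2 1, hsq2 2]
    have c2 : (∑ i, partialD i cutoff (L⁻¹ • y) * partialD i f (x₀ + y)) ^ 2 ≤
        3 * M ^ 2 * gradSq f (x₀ + y) := by
      refine (Finset.sum_mul_sq_le_sq_mul_sq _ _ _).trans ?_
      refine mul_le_mul_of_nonneg_right ?_ (Finset.sum_nonneg fun i _ => sq_nonneg _)
      simp only [Fin.sum_univ_three]
      linarith [hsq1 0, hsq1 1, hsq1 2]
    rw [e]
    generalize (∑ i, partialD i (partialD i cutoff) (L⁻¹ • y)) = a at *
    generalize (∑ i, partialD i cutoff (L⁻¹ • y) * partialD i f (x₀ + y)) = b at *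
    generalize cutoff (L⁻¹ • y) = z at *
    have hG : 0 ≤ gradSq f (x₀ + y) := Finset.sum_nonneg fun i _ => sq_nonneg _
    calc _ ≤ 3 * (L⁻¹ ^ 2 * f (x₀ + y) * a) ^ 2 + 3 * (2 * L⁻¹ * b) ^ 2 +
          3 * (z * flatLap f (x₀ + y)) ^ 2 := by
            nlinarith [sq_nonneg (L⁻¹ ^ 2 * f (x₀ + y) * a - 2 * L⁻¹ * b),
              sq_nonneg (L⁻¹ ^ 2 * f (x₀ + y) * a - z * flatLap f (x₀ + y)),
              sq_nonneg (2 * L⁻¹ * b - z * flatLap f (x₀ + y))]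
      _ = 3 * (L⁻¹ ^ 2 * a ^ 2 * (f (x₀ + y) ^ 2 / L ^ 2)) + 12 * (L⁻¹ ^ 2 * b ^ 2) +
          3 * (z ^ 2 * flatLap f (x₀ + y) ^ 2) := by
            field_simp
            ring
      _ ≤ 3 * (1 / ℓ ^ 2 * (9 * M ^ 2) * (f (x₀ + y) ^ 2 / L ^ 2)) +
          12 * (1 / ℓ ^ 2 * (3 * M ^ 2 * gradSq f (x₀ + y))) +
          3 * (1 * flatLap f (x₀ + y) ^ 2) := by gcongr
      _ = _ := by ring
  have hG : 0 ≤ gradSq f (x₀ + y) := Finset.sum_nonneg fun i _ => sq_nonneg _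
  have hF : 0 ≤ f (x₀ + y) ^ 2 / L ^ 2 := by positivity
  have hD := sq_nonneg (flatLap f (x₀ + y))
  have hM2 : 0 ≤ M ^ 2 := sq_nonneg M
  have hMl : 0 ≤ M ^ 2 / ℓ ^ 2 := by positivity
  have r1 : 27 * M ^ 2 / ℓ ^ 2 = 27 * (M ^ 2 / ℓ ^ 2) := by ring
  have r2 : 36 * M ^ 2 / ℓ ^ 2 = 36 * (M ^ 2 / ℓ ^ 2) := by ring
  have r3 : 63 * M ^ 2 / ℓ ^ 2 = 63 * (M ^ 2 / ℓ ^ 2) := by ring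
  rw [r1, r2] at hB
  rw [r3]
  generalize M ^ 2 / ℓ ^ 2 = m at *
  generalize f (x₀ + y) ^ 2 / L ^ 2 = p at *
  generalize gradSq f (x₀ + y) = q at *
  generalize flatLap f (x₀ + y) ^ 2 = w at *
  nlinarith [mul_nonneg hM2 hG, mul_nonneg hM2 hD, mul_nonneg hMl hG, mul_nonneg hMl hF,
    mul_nonneg hMl hD, mul_nonneg hM2 hF]

end Localize

/-- The value of a function at the centre of a ball of radius at least `ℓ` is bounded by integrals
over the ball. -/
theorem exists_pointwise_bound {ℓ : ℝ} (hℓ : 0 < ℓ) :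
    ∃ C : ℝ≥0, ∀ (f : Space → ℝ) (x₀ : Space) (L : ℝ), ℓ ≤ L →
      ContDiffOn ℝ 2 f (Metric.ball x₀ L) →
      ENNReal.ofReal (f x₀ ^ 2) ≤ C * ∫⁻ x in Metric.ball x₀ L,
        ENNReal.ofReal (gradSq f x + f x ^ 2 / L ^ 2 + flatLap f x ^ 2) := by
  obtain ⟨M, hM, hb⟩ := exists_cutoff_bound
  have hmu := newtonMass_pos
  set K := 6 * M ^ 2 + 63 * M ^ 2 / ℓ ^ 2 + 5 with hK
  have hK0 : 0 ≤ K := by positivity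
  have hN : 0 ≤ newtonConst := add_nonneg
    (integral_nonneg fun x => by have := sqNorm_nonneg x; positivity)
    (integral_nonneg fun x => by positivity)
  refine ⟨Real.toNNReal (newtonConst / (3 * newtonMass) ^ 2) * Real.toNNReal K,
    fun f x₀ L hL hf => ?_⟩
  have hL0 : 0 < L := hℓ.trans_le hL
  have h := sq_apply_zero_le (contDiff_localized hL0 hf) (hasCompactSupport_localized hL0)
  have h0 : localized f x₀ L 0 = f x₀ := by
    have : cutoff (0 : Space) = 1 := cutoff.one_of_mem_closedBall (by simp [cutoff])
    simp [localized, this]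
  rw [h0] at h
  set q : Space → ℝ := fun x => gradSq f x + f x ^ 2 / L ^ 2 + flatLap f x ^ 2 with hq
  have hint := integrable_gradSq_add (contDiff_localized hL0 hf)
    (hasCompactSupport_localized (f := f) (x₀ := x₀) hL0)
  have hle : ∫⁻ y, ENNReal.ofReal
      (gradSq (localized f x₀ L) y + flatLap (localized f x₀ L) y ^ 2) ≤
      ∫⁻ x, (Metric.ball x₀ L).indicator (fun x => ENNReal.ofReal (K * q x)) x := by
    rw [← lintegral_add_left_eq_self ((Metric.ball x₀ L).indicator _) x₀]
    refine lintegral_mono fun y => ?_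
    by_cases hy : ‖y‖ < L
    · rw [indicator_of_mem (by simpa using hy)]
      exact ENNReal.ofReal_le_ofReal (localized_bound hb hℓ hL hf hy)
    -- Outside the ball the localized function vanishes in a neighbourhood of y, so all its
    -- derivatives vanish there too.
    · have := gradSq_flatLap_congr (localized_eventually_eq_zero (f := f) (x₀ := x₀) hL0
        (not_lt.1 hy))
      have hz : ∀ i, partialD i (fun _ : Space => (0 : ℝ)) = fun _ => 0 := fun i => by
        ext; simp [partialD]
      rw [this.1, this.2]
      simp [gradSq, flatLap, hz]
  rw [lintegral_indicator Metric.isOpen_ball.measurableSet] at hle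
  have h2 : f x₀ ^ 2 ≤ newtonConst / (3 * newtonMass) ^ 2 * ∫ y,
      (gradSq (localized f x₀ L) y + flatLap (localized f x₀ L) y ^ 2) := by
    rw [div_mul_eq_mul_div, le_div_iff₀ (by positivity)]
    linarith
  calc ENNReal.ofReal (f x₀ ^ 2) ≤ _ := ENNReal.ofReal_le_ofReal h2
    _ = ENNReal.ofReal (newtonConst / (3 * newtonMass) ^ 2) * ∫⁻ y, ENNReal.ofReal
      (gradSq (localized f x₀ L) y + flatLap (localized f x₀ L) y ^ 2) := by
        rw [ENNReal.ofReal_mul (by positivity), ofReal_integral_eq_lintegral_ofReal hint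
          (Eventually.of_forall fun y => add_nonneg
            (Finset.sum_nonneg fun i _ => sq_nonneg _) (sq_nonneg _))]
    _ ≤ ENNReal.ofReal (newtonConst / (3 * newtonMass) ^ 2) *
        ∫⁻ x in Metric.ball x₀ L, ENNReal.ofReal (K * q x) := by gcongr
    _ = _ := by
        simp only [ENNReal.ofReal_mul hK0]
        rw [lintegral_const_mul' _ _ ENNReal.ofReal_ne_top, ← mul_assoc, ENNReal.coe_mul]
        rfl

/-! ### Axially symmetric functions -/

/-- The interior `0 < ρ` of the half plane. -/
def interiorPlane : Set (ℝ × ℝ) := {p | 0 < p.1}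

lemma isOpen_interiorPlane : IsOpen interiorPlane := isOpen_lt continuous_const continuous_fst

/-- The cylindrical coordinates `(ρ, z)` of a point of space. -/
def cyl (x : Space) : ℝ × ℝ := (√(x.1.1 ^ 2 + x.1.2 ^ 2), x.2)

lemma continuous_cyl : Continuous cyl := by unfold cyl; fun_prop

/-- The axially symmetric function on space with the given values on the half plane. -/
def lift (S : ℝ × ℝ → ℝ) (x : Space) : ℝ := S (cyl x)

section Lift

variable {S : ℝ × ℝ → ℝ} {x : Space} {p : ℝ × ℝ}

lemma dRho_eq_fderiv (hS : DifferentiableAt ℝ S p) : dRho S p = fderiv ℝ S p (1, 0) := by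
  have h : HasDerivAt (fun s : ℝ => (s, p.2)) (1, 0) p.1 :=
    (hasDerivAt_id p.1).prodMk (hasDerivAt_const _ _)
  exact (HasFDerivAt.comp_hasDerivAt (x := p.1) (l := S) hS.hasFDerivAt h).deriv

lemma dZ_eq_fderiv (hS : DifferentiableAt ℝ S p) : dZ S p = fderiv ℝ S p (0, 1) := by
  have h : HasDerivAt (fun s : ℝ => (p.1, s)) (0, 1) p.2 :=
    (hasDerivAt_const _ _).prodMk (hasDerivAt_id p.2)
  exact (HasFDerivAt.comp_hasDerivAt (x := p.2) (l := S) hS.hasFDerivAt h).deriv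

lemma fderiv_apply_eq (hS : DifferentiableAt ℝ S p) (a b : ℝ) :
    fderiv ℝ S p (a, b) = a * dRho S p + b * dZ S p := by
  rw [dRho_eq_fderiv hS, dZ_eq_fderiv hS, ← smul_eq_mul a, ← smul_eq_mul b, ← map_smul, ← map_smul,
    ← map_add]
  simp

lemma cyl_fst_sq (x : Space) : (cyl x).1 ^ 2 = x.1.1 ^ 2 + x.1.2 ^ 2 :=
  Real.sq_sqrt (by positivity)

lemma contDiffAt_cyl (hx : 0 < (cyl x).1) : ContDiffAt ℝ 2 cyl x := by
  have : x.1.1 ^ 2 + x.1.2 ^ 2 ≠ 0 := (Real.sqrt_pos.1 hx).ne'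
  have h1 : ContDiffAt ℝ 2 (fun x : Space => x.1.1 ^ 2 + x.1.2 ^ 2) x := by fun_prop
  exact (h1.sqrt this).prodMk (by fun_prop : ContDiffAt ℝ 2 (fun x : Space => x.2) x)

lemma hasLineDerivAt_cyl (hx : 0 < (cyl x).1) (i : Fin 3) :
    HasLineDerivAt ℝ cyl (![(x.1.1 / (cyl x).1, 0), (x.1.2 / (cyl x).1, 0), (0, 1)] i) x
      (axisVec i) := by
  have h0 : x.1.1 ^ 2 + x.1.2 ^ 2 ≠ 0 := (Real.sqrt_pos.1 hx).ne'
  have hne : √(x.1.1 ^ 2 + x.1.2 ^ 2) ≠ 0 := hx.ne'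
  unfold HasLineDerivAt
  fin_cases i
  · have h : HasDerivAt (fun t : ℝ => √((x.1.1 + t) ^ 2 + x.1.2 ^ 2)) (x.1.1 / (cyl x).1) 0 := by
      have h1 : HasDerivAt (fun t : ℝ => (x.1.1 + t) ^ 2 + x.1.2 ^ 2) (2 * x.1.1) 0 := by
        simpa using (((hasDerivAt_id (0 : ℝ)).const_add x.1.1).pow 2).add_const (x.1.2 ^ 2)
      convert! h1.sqrt (by simpa using h0) using 1
      simp [cyl]
      field_simp
    simpa [cyl, axisVec] using h.prodMk (hasDerivAt_const 0 x.2)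
  · have h : HasDerivAt (fun t : ℝ => √(x.1.1 ^ 2 + (x.1.2 + t) ^ 2)) (x.1.2 / (cyl x).1) 0 := by
      have h1 : HasDerivAt (fun t : ℝ => x.1.1 ^ 2 + (x.1.2 + t) ^ 2) (2 * x.1.2) 0 := by
        simpa using (((hasDerivAt_id (0 : ℝ)).const_add x.1.2).pow 2).const_add (x.1.1 ^ 2)
      convert! h1.sqrt (by simpa using h0) using 1
      simp [cyl]
      field_simp
    simpa [cyl, axisVec] using h.prodMk (hasDerivAt_const 0 x.2)
  · simpa [cyl, axisVec] using
      (hasDerivAt_const (0 : ℝ) (√(x.1.1 ^ 2 + x.1.2 ^ 2))).prodMk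
        ((hasDerivAt_id (0 : ℝ)).const_add x.2)

/-- The horizontal derivatives are written as a coordinate times the axially symmetric function
S_ρ/ρ, so that the same lemma and the product rule give the second derivatives. -/
lemma partialD_lift (hx : 0 < (cyl x).1) (hS : DifferentiableAt ℝ S (cyl x)) :
    partialD 0 (lift S) x = x.1.1 * (dRho S (cyl x) / (cyl x).1) ∧
    partialD 1 (lift S) x = x.1.2 * (dRho S (cyl x) / (cyl x).1) ∧
    partialD 2 (lift S) x = dZ S (cyl x) := by
  have hc := (contDiffAt_cyl hx).differentiableAt (by norm_num)
  have h : ∀ i, partialD i (lift S) x = fderiv ℝ S (cyl x)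
      (![(x.1.1 / (cyl x).1, 0), (x.1.2 / (cyl x).1, 0), (0, 1)] i) := by
    intro i
    rw [← (hasLineDerivAt_cyl hx i).lineDeriv, hc.lineDeriv_eq_fderiv]
    exact congrArg (· (axisVec i)) (hS.hasFDerivAt.comp x hc.hasFDerivAt).fderiv
  refine ⟨?_, ?_, ?_⟩ <;> rw [h] <;> simp only [Matrix.cons_val] <;> rw [fderiv_apply_eq hS] <;>
    ring

lemma differentiableAt_lift (hx : 0 < (cyl x).1) (hS : DifferentiableAt ℝ S (cyl x)) :
    DifferentiableAt ℝ (lift S) x :=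
  hS.comp x ((contDiffAt_cyl hx).differentiableAt (by norm_num))

lemma gradSq_lift (hx : 0 < (cyl x).1) (hS : DifferentiableAt ℝ S (cyl x)) :
    gradSq (lift S) x = normSq (grad S (cyl x)) := by
  obtain ⟨h0, h1, h2⟩ := partialD_lift hx hS
  have := cyl_fst_sq x
  simp only [gradSq, Fin.sum_univ_three, h0, h1, h2, normSq, grad, dotProduct, Fin.sum_univ_two,
    Matrix.cons_val_zero, Matrix.cons_val_one]
  field_simp
  linear_combination (-dRho S (cyl x) ^ 2) * this

lemma contDiffOn_dRho (hS : ContDiffOn ℝ 2 S interiorPlane) :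
    ContDiffOn ℝ 1 (dRho S) interiorPlane := by
  have h : ContDiffOn ℝ 1 (fun p => fderiv ℝ S p (1, 0)) interiorPlane :=
    (hS.fderiv_of_isOpen isOpen_interiorPlane (by norm_num)).clm_apply contDiffOn_const
  exact h.congr fun p hp => dRho_eq_fderiv
    ((hS.contDiffAt (isOpen_interiorPlane.mem_nhds hp)).differentiableAt (by norm_num))

lemma contDiffOn_dZ (hS : ContDiffOn ℝ 2 S interiorPlane) :
    ContDiffOn ℝ 1 (dZ S) interiorPlane := by
  have h : ContDiffOn ℝ 1 (fun p => fderiv ℝ S p (0, 1)) interiorPlane :=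
    (hS.fderiv_of_isOpen isOpen_interiorPlane (by norm_num)).clm_apply contDiffOn_const
  exact h.congr fun p hp => dZ_eq_fderiv
    ((hS.contDiffAt (isOpen_interiorPlane.mem_nhds hp)).differentiableAt (by norm_num))

lemma continuousOn_dRho_of_contDiffOn (hS : ContDiffOn ℝ 1 S interiorPlane) :
    ContinuousOn (dRho S) interiorPlane := by
  have h : ContinuousOn (fun p => fderiv ℝ S p (1, 0)) interiorPlane :=
    (hS.continuousOn_fderiv_of_isOpen isOpen_interiorPlane (by norm_num)).clm_apply
      continuousOn_const
  exact h.congr fun p hp => dRho_eq_fderiv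
    ((hS.contDiffAt (isOpen_interiorPlane.mem_nhds hp)).differentiableAt (by norm_num))

lemma continuousOn_dZ_of_contDiffOn (hS : ContDiffOn ℝ 1 S interiorPlane) :
    ContinuousOn (dZ S) interiorPlane := by
  have h : ContinuousOn (fun p => fderiv ℝ S p (0, 1)) interiorPlane :=
    (hS.continuousOn_fderiv_of_isOpen isOpen_interiorPlane (by norm_num)).clm_apply
      continuousOn_const
  exact h.congr fun p hp => dZ_eq_fderiv
    ((hS.contDiffAt (isOpen_interiorPlane.mem_nhds hp)).differentiableAt (by norm_num))

lemma continuousOn_normSq_grad (hS : ContDiffOn ℝ 1 S interiorPlane) :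
    ContinuousOn (fun p => normSq (grad S p)) interiorPlane := by
  simp only [normSq, grad, dotProduct, Fin.sum_univ_two, Matrix.cons_val_zero, Matrix.cons_val_one]
  have h1 := continuousOn_dRho_of_contDiffOn hS
  have h2 := continuousOn_dZ_of_contDiffOn hS
  exact (h1.mul h1).add (h2.mul h2)

lemma continuousOn_lap3 (hS : ContDiffOn ℝ 2 S interiorPlane) :
    ContinuousOn (lap3 S) interiorPlane := by
  unfold lap3
  refine ((continuousOn_dRho_of_contDiffOn (contDiffOn_dRho hS)).add
    (continuousOn_dZ_of_contDiffOn (contDiffOn_dZ hS))).add ?_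
  exact (contDiffOn_dRho hS).continuousOn.div continuousOn_fst fun p hp => ne_of_gt hp

lemma differentiableAt_of_interior (hS : ContDiffOn ℝ 1 S interiorPlane) (hp : p ∈ interiorPlane) :
    DifferentiableAt ℝ S p :=
  (hS.contDiffAt (isOpen_interiorPlane.mem_nhds hp)).differentiableAt (by norm_num)

/-- With T = S_ρ/ρ the horizontal part of the Laplacian is the divergence of (x T, y T), that is 2 T
+ ρ T_ρ = S_ρρ + S_ρ/ρ. -/
lemma flatLap_lift (hx : 0 < (cyl x).1) (hS : ContDiffOn ℝ 2 S interiorPlane) :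
    flatLap (lift S) x = lap3 S (cyl x) := by
  have hS1 : ContDiffOn ℝ 1 S interiorPlane := hS.of_le (by norm_num)
  have hev : ∀ᶠ y in 𝓝 x, 0 < (cyl y).1 :=
    (continuous_fst.comp continuous_cyl).continuousAt.eventually_const_lt hx
  have hT : ContDiffOn ℝ 1 (fun p : ℝ × ℝ => dRho S p / p.1) interiorPlane :=
    (contDiffOn_dRho hS).div contDiffOn_fst fun p hp => ne_of_gt hp
  have e0 : partialD 0 (lift S) =ᶠ[𝓝 x] fun y => y.1.1 * lift (fun p => dRho S p / p.1) y := by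
    filter_upwards [hev] with y hy
    exact (partialD_lift hy (differentiableAt_of_interior hS1 hy)).1
  have e1 : partialD 1 (lift S) =ᶠ[𝓝 x] fun y => y.1.2 * lift (fun p => dRho S p / p.1) y := by
    filter_upwards [hev] with y hy
    exact (partialD_lift hy (differentiableAt_of_interior hS1 hy)).2.1
  have e2 : partialD 2 (lift S) =ᶠ[𝓝 x] lift (dZ S) := by
    filter_upwards [hev] with y hy
    exact (partialD_lift hy (differentiableAt_of_interior hS1 hy)).2.2
  have dT := differentiableAt_of_interior hT hx
  have dTx := differentiableAt_lift hx dT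
  obtain ⟨t0, t1, -⟩ := partialD_lift hx dT
  have hzz := (partialD_lift hx (differentiableAt_of_interior (contDiffOn_dZ hS) hx)).2.2
  have hR : dRho (fun p => dRho S p / p.1) (cyl x) =
      dRho (dRho S) (cyl x) / (cyl x).1 - dRho S (cyl x) / (cyl x).1 ^ 2 := by
    have hd := differentiableAt_of_interior (contDiffOn_dRho hS) hx
    have h : HasDerivAt (fun s : ℝ => dRho S (s, (cyl x).2)) (dRho (dRho S) (cyl x)) (cyl x).1 := by
      have hc : DifferentiableAt ℝ (fun s : ℝ => dRho S (s, (cyl x).2)) (cyl x).1 :=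
        DifferentiableAt.comp (cyl x).1 (g := dRho S) (f := fun s : ℝ => (s, (cyl x).2)) hd
          (by fun_prop)
      exact hc.hasDerivAt
    have h2 := (h.div (hasDerivAt_id (cyl x).1) hx.ne').deriv
    unfold dRho at h2 ⊢
    simp only [id] at h2
    refine h2.trans ?_
    field_simp
  have c0 : partialD 0 (fun y : Space => y.1.1) x = 1 := by
    have h : HasFDerivAt (fun y : Space => y.1.1) ((ContinuousLinearMap.fst ℝ ℝ ℝ).comp
      (ContinuousLinearMap.fst ℝ (ℝ × ℝ) ℝ)) x :=
        ((ContinuousLinearMap.fst ℝ ℝ ℝ).comp (ContinuousLinearMap.fst ℝ (ℝ × ℝ) ℝ)).hasFDerivAt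
    rw [partialD, h.fderiv]; simp [axisVec]
  have c1 : partialD 1 (fun y : Space => y.1.2) x = 1 := by
    have h : HasFDerivAt (fun y : Space => y.1.2) ((ContinuousLinearMap.snd ℝ ℝ ℝ).comp
      (ContinuousLinearMap.fst ℝ (ℝ × ℝ) ℝ)) x :=
        ((ContinuousLinearMap.snd ℝ ℝ ℝ).comp (ContinuousLinearMap.fst ℝ (ℝ × ℝ) ℝ)).hasFDerivAt
    rw [partialD, h.fderiv]; simp [axisVec]
  have hsq := cyl_fst_sq x
  simp only [flatLap, Fin.sum_univ_three]
  rw [(partialD_congr e0 0).eq_of_nhds, (partialD_congr e1 1).eq_of_nhds,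
    (partialD_congr e2 2).eq_of_nhds, partialD_mul (by fun_prop) dTx,
    partialD_mul (by fun_prop) dTx, t0, t1, hzz, hR, c0, c1]
  simp only [lap3, lift]
  generalize dRho (dRho S) (cyl x) = a
  generalize dRho S (cyl x) = b
  generalize dZ (dZ S) (cyl x) = c
  generalize (cyl x).1 = r at *
  field_simp
  linear_combination (a * r - b) * (-hsq)

end Lift

/-! ### Integration in cylindrical coordinates -/

/-- The densities are known to be continuous only for ρ > 0; extension by zero makes them globally
measurable, as the changes of variables below require. -/
lemma measurable_indicator_ofReal {F : ℝ × ℝ → ℝ} (hF : ContinuousOn F interiorPlane)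
    {W : Set (ℝ × ℝ)} (hW : MeasurableSet W) (hWi : W ⊆ interiorPlane) :
    Measurable (W.indicator fun p => ENNReal.ofReal (F p)) := by
  classical
  have h : ContinuousOn (fun p => ENNReal.ofReal (F p)) W :=
    ENNReal.continuous_ofReal.comp_continuousOn (hF.mono hWi)
  rw [← Set.piecewise_eq_indicator]
  exact h.measurable_piecewise continuousOn_const hW

lemma lintegral_cyl {Φ : ℝ × ℝ → ℝ≥0∞} (hΦ : Measurable Φ) :
    ∫⁻ x, Φ (cyl x) = ENNReal.ofReal (2 * Real.pi) *
      ∫⁻ p in interiorPlane, Φ p * ENNReal.ofReal p.1 := by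
  have hI : interiorPlane = Ioi (0 : ℝ) ×ˢ (univ : Set ℝ) := by
    ext p; simp [interiorPlane]
  have hm : Measurable fun p : ℝ × ℝ => Φ p * ENNReal.ofReal p.1 := by fun_prop
  have h2 : ∫⁻ x, Φ (cyl x) = ∫⁻ z, ∫⁻ u, Φ (cyl (u, z)) :=
    lintegral_prod_symm' (μ := (volume : Measure (ℝ × ℝ))) (ν := (volume : Measure ℝ)) _
      (hΦ.comp continuous_cyl.measurable)
  rw [h2, hI, Measure.volume_eq_prod, ← Measure.prod_restrict, Measure.restrict_univ,
    lintegral_prod_symm' _ hm, ← lintegral_const_mul' _ _ ENNReal.ofReal_ne_top]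
  refine lintegral_congr fun z => ?_
  rw [← Measure.volume_eq_prod, ← lintegral_comp_polarCoord_symm]
  have h1 : ∫⁻ p in polarCoord.target, ENNReal.ofReal p.1 • Φ (cyl (polarCoord.symm p, z)) =
      ∫⁻ p in polarCoord.target, Φ (p.1, z) * ENNReal.ofReal p.1 := by
    refine setLIntegral_congr_fun polarCoord.open_target.measurableSet fun p hp => ?_
    have hp : 0 < p.1 := by
      rw [polarCoord_target] at hp; exact hp.1
    have : cyl (polarCoord.symm p, z) = (p.1, z) := by
      simp only [cyl, polarCoord_symm_apply]
      rw [mul_pow, mul_pow, ← mul_add, Real.cos_sq_add_sin_sq, mul_one, Real.sqrt_sq hp.le]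
    simp only [this, smul_eq_mul]
    rw [mul_comm]
  have hm2 : Measurable fun p : ℝ × ℝ => Φ (p.1, z) * ENNReal.ofReal p.1 := by fun_prop
  rw [h1, polarCoord_target, Measure.volume_eq_prod, ← Measure.prod_restrict,
    lintegral_prod_symm' _ hm2]
  simp only [lintegral_const, Measure.restrict_apply MeasurableSet.univ, univ_inter,
    Real.volume_Ioo]
  rw [mul_comm]
  congr 2
  ring

lemma ae_cyl_pos : ∀ᵐ x : Space, 0 < (cyl x).1 := by
  have h : volume (({(0 : ℝ × ℝ)} : Set (ℝ × ℝ)) ×ˢ (univ : Set ℝ)) = 0 := by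
    rw [Measure.volume_eq_prod, Measure.prod_prod]
    simp
  refine measure_mono_null (fun x hx => ?_) h
  simp only [mem_compl_iff, mem_ofPred_eq, not_lt, cyl] at hx
  have h0 : x.1.1 ^ 2 + x.1.2 ^ 2 = 0 :=
    le_antisymm (Real.sqrt_eq_zero'.1 (le_antisymm hx (Real.sqrt_nonneg _))) (by positivity)
  have h1 : x.1.1 = 0 := by nlinarith [sq_nonneg x.1.1, sq_nonneg x.1.2]
  have h2 : x.1.2 = 0 := by nlinarith [sq_nonneg x.1.1, sq_nonneg x.1.2]
  exact ⟨Prod.ext h1 h2, mem_univ _⟩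

/-- The pointwise bound for axially symmetric functions, with integrals over the half plane. -/
theorem exists_axial_pointwise_bound {ℓ : ℝ} (hℓ : 0 < ℓ) :
    ∃ C : ℝ≥0, ∀ (S : ℝ × ℝ → ℝ) (x₀ : Space) (L : ℝ) (W : Set (ℝ × ℝ)), ℓ ≤ L →
      ContDiffOn ℝ 2 S interiorPlane → ContDiffOn ℝ 2 (lift S) (Metric.ball x₀ L) →
      MeasurableSet W → W ⊆ interiorPlane →
      (∀ x ∈ Metric.ball x₀ L, 0 < (cyl x).1 → cyl x ∈ W) →
      ENNReal.ofReal (S (cyl x₀) ^ 2) ≤ C * ∫⁻ p in W,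
        ENNReal.ofReal ((normSq (grad S p) + S p ^ 2 / L ^ 2 + lap3 S p ^ 2) * p.1) := by
  obtain ⟨C, hC⟩ := exists_pointwise_bound hℓ
  refine ⟨C * Real.toNNReal (2 * Real.pi), fun S x₀ L W hL hS hl hW hWi hball => ?_⟩
  set q : ℝ × ℝ → ℝ := fun p => normSq (grad S p) + S p ^ 2 / L ^ 2 + lap3 S p ^ 2 with hq
  have hqc : ContinuousOn q interiorPlane :=
    ((continuousOn_normSq_grad (hS.of_le (by norm_num))).add
      ((hS.continuousOn.pow 2).div_const _)).add ((continuousOn_lap3 hS).pow 2)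
  have hq0 : ∀ p, 0 ≤ q p := fun p => by
    have : 0 ≤ normSq (grad S p) := by
      simp only [normSq, dotProduct, Fin.sum_univ_two]
      exact add_nonneg (mul_self_nonneg _) (mul_self_nonneg _)
    positivity
  refine (hC (lift S) x₀ L hL hl).trans ?_
  rw [ENNReal.coe_mul, mul_assoc]
  gcongr
  calc _ ≤ ∫⁻ x, W.indicator (fun p => ENNReal.ofReal (q p)) (cyl x) := by
        rw [← lintegral_indicator Metric.isOpen_ball.measurableSet]
        -- The ball may meet the axis, where the cylindrical formulas for gradient and Laplacian are
        -- not available; the axis is a null set.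
        refine lintegral_mono_ae ?_
        filter_upwards [ae_cyl_pos] with x hx
        by_cases hb : x ∈ Metric.ball x₀ L
        · rw [indicator_of_mem hb, indicator_of_mem (hball x hb hx),
            gradSq_lift hx (differentiableAt_of_interior (hS.of_le (by norm_num)) hx),
            flatLap_lift hx hS]
          rfl
        · rw [indicator_of_notMem hb]
          exact zero_le
    _ = ENNReal.ofReal (2 * Real.pi) * ∫⁻ p in interiorPlane,
          W.indicator (fun p => ENNReal.ofReal (q p)) p * ENNReal.ofReal p.1 :=
        lintegral_cyl (measurable_indicator_ofReal hqc hW hWi)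
    _ = _ := by
        congr 1
        have : ∀ p, W.indicator (fun p => ENNReal.ofReal (q p)) p * ENNReal.ofReal p.1 =
            W.indicator (fun p => ENNReal.ofReal (q p * p.1)) p := by
          intro p
          by_cases hp : p ∈ W
          · simp [hp, ENNReal.ofReal_mul (hq0 p)]
          · simp [hp]
        simp only [this]
        rw [setLIntegral_indicator hW, inter_eq_self_of_subset_left hWi]

/-! ### Decay along rays -/

/-- A one-dimensional Hardy type bound for a function that decays at infinity. -/
lemma ofReal_mul_le_lintegral_of_decay {κ κ' Y : ℝ → ℝ} (hκ0 : ∀ r, 0 < r → 0 ≤ κ r)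
    (hκ : ∀ r, 0 < r → HasDerivAt κ (κ' r) r) (hY0 : ∀ r, 0 < r → 0 ≤ Y r)
    (hY : ContinuousOn Y (Ioi 0)) (hle : ∀ r, 0 < r → κ' r ^ 2 ≤ 4 * κ r * Y r)
    (hlim : Tendsto κ atTop (𝓝 0)) {r : ℝ} (hr : 0 < r) :
    ENNReal.ofReal (κ r * r) ≤ ∫⁻ t in Ioi 0, ENNReal.ofReal (Y t * t ^ 2) := by
  by_cases htop : ∫⁻ t in Ioi 0, ENNReal.ofReal (Y t * t ^ 2) = ⊤
  · rw [htop]; exact le_top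
  have hcont : ContinuousOn (fun t => Y t * t ^ 2) (Ioi 0) := hY.mul (by fun_prop)
  have hnn : 0 ≤ᵐ[volume.restrict (Ioi 0)] fun t => Y t * t ^ 2 :=
    (ae_restrict_iff' measurableSet_Ioi).2 (Eventually.of_forall fun t ht =>
      mul_nonneg (hY0 t ht) (sq_nonneg t))
  have hint : IntegrableOn (fun t => Y t * t ^ 2) (Ioi 0) := by
    refine ⟨hcont.aestronglyMeasurable measurableSet_Ioi, ?_⟩
    rw [hasFiniteIntegral_iff_ofReal hnn]
    exact lt_top_iff_ne_top.2 htop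
  rw [← ofReal_integral_eq_lintegral_ofReal hint hnn]
  refine ENNReal.ofReal_le_ofReal ?_
  set T := ∫ t in Ioi 0, Y t * t ^ 2 with hT
  have hT0 : 0 ≤ T := setIntegral_nonneg measurableSet_Ioi fun t ht =>
    mul_nonneg (hY0 t ht) (sq_nonneg t)
  -- Since |(√κ)'| ≤ √Y, Young's inequality √Y ≤ 1/(2 l t²) + (l/2) Y t² is integrated from r to N.
  -- The first term is the derivative of -1/(2 l t), which is moved to the other side. The shift by
  -- ε keeps the root differentiable at zeros of κ.
  have step : ∀ l, 0 < l → ∀ ε, 0 < ε → ∀ N, r < N →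
      √(κ r + ε) ≤ √(κ N + ε) + 1 / (2 * l * r) + l / 2 * T := by
    intro l hl ε hε N hN
    have hpos : ∀ t ∈ Icc r N, 0 < t := fun t ht => hr.trans_le ht.1
    have hd : ∀ t ∈ Icc r N, HasDerivAt (fun t => -√(κ t + ε) + (2 * l)⁻¹ * t⁻¹)
        (-(κ' t / (2 * √(κ t + ε))) + (2 * l)⁻¹ * -(t ^ 2)⁻¹) t := by
      intro t ht
      have h0 := hpos t ht
      have h1 : κ t + ε ≠ 0 := by linarith [hκ0 t h0]
      exact (((hκ t h0).add_const ε).sqrt h1).neg.add ((hasDerivAt_inv h0.ne').const_mul _)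
    have hsub : Icc r N ⊆ Ioi 0 := fun t ht => hpos t ht
    have h := intervalIntegral.sub_le_integral_of_hasDeriv_right_of_le hN.le
      (fun t ht => (hd t ht).continuousAt.continuousWithinAt)
      (fun t ht => (hd t (Ioo_subset_Icc_self ht)).hasDerivWithinAt)
      (φ := fun t => l / 2 * (Y t * t ^ 2)) ((hint.mono_set hsub).const_mul _) (by
        intro t ht
        have h0 := hpos t (Ioo_subset_Icc_self ht)
        have hk := hκ0 t h0
        have hy := hY0 t h0
        have hS : 0 < √(κ t + ε) := Real.sqrt_pos.2 (by linarith)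
        have hS2 : √(κ t + ε) ^ 2 = κ t + ε := Real.sq_sqrt (by linarith)
        set u := κ' t / (2 * √(κ t + ε)) with hu
        have hu2 : u ^ 2 ≤ Y t := by
          rw [hu, div_pow, mul_pow, hS2, div_le_iff₀ (by positivity)]
          have := hle t h0
          nlinarith
        have e1 : l / 2 * (Y t * t ^ 2) - (-u + (2 * l)⁻¹ * -(t ^ 2)⁻¹) =
            (l * t ^ 2) / 2 * ((Y t - u ^ 2) + (u + (l * t ^ 2)⁻¹) ^ 2) := by
          field_simp
          ring
        have e2 : 0 ≤ (l * t ^ 2) / 2 * ((Y t - u ^ 2) + (u + (l * t ^ 2)⁻¹) ^ 2) := by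
          have : 0 ≤ Y t - u ^ 2 := by linarith
          positivity
        linarith)
    have h2 : ∫ t in r..N, l / 2 * (Y t * t ^ 2) ≤ l / 2 * T := by
      rw [intervalIntegral.integral_const_mul, intervalIntegral.integral_of_le hN.le]
      gcongr
      exact setIntegral_mono_set hint hnn
        (Eventually.of_forall fun t (ht : t ∈ Ioc r N) => hr.trans ht.1)
    have h3 : 0 < (2 * l)⁻¹ * N⁻¹ := by
      have := hr.trans hN
      positivity
    have h4 : (2 * l)⁻¹ * r⁻¹ = 1 / (2 * l * r) := by field_simp
    linarith
  have step2 : ∀ l, 0 < l → √(κ r) ≤ 1 / (2 * l * r) + l / 2 * T := by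
    intro l hl
    have h1 : ∀ ε, 0 < ε → √(κ r + ε) ≤ √ε + 1 / (2 * l * r) + l / 2 * T := by
      intro ε hε
      have ht : Tendsto (fun N => √(κ N + ε) + 1 / (2 * l * r) + l / 2 * T) atTop
          (𝓝 (√(0 + ε) + 1 / (2 * l * r) + l / 2 * T)) :=
        (((hlim.add_const ε).sqrt).add_const _).add_const _
      rw [zero_add] at ht
      exact ge_of_tendsto ht ((eventually_gt_atTop r).mono fun N hN => step l hl ε hε N hN)
    have ht : Tendsto (fun ε : ℝ => √ε + 1 / (2 * l * r) + l / 2 * T) (𝓝[>] 0)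
        (𝓝 (√0 + 1 / (2 * l * r) + l / 2 * T)) :=
      ((((Real.continuous_sqrt.tendsto 0).mono_left nhdsWithin_le_nhds)).add_const _).add_const _
    rw [Real.sqrt_zero, zero_add] at ht
    refine ge_of_tendsto ht (eventually_mem_nhdsWithin.mono fun ε hε => ?_)
    exact (Real.sqrt_le_sqrt (by linarith [mem_Ioi.1 hε])).trans (h1 ε hε)
  -- Optimizing over l, through the discriminant, replaces Cauchy-Schwarz and gives κ(r) ≤ T/r. For
  -- l ≤ 0 the polynomial is trivially nonnegative.
  have key : ∀ l : ℝ, 0 ≤ T / 2 * (l * l) + (-√(κ r)) * l + 1 / (2 * r) := by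
    intro l
    rcases le_or_gt l 0 with hl | hl
    · have := mul_nonneg (Real.sqrt_nonneg (κ r)) (neg_nonneg.2 hl)
      have h1 : 0 ≤ T / 2 * (l * l) := mul_nonneg (by positivity) (mul_self_nonneg l)
      have h2 : 0 < 1 / (2 * r) := by positivity
      linarith
    · have h := mul_le_mul_of_nonneg_left (step2 l hl) hl.le
      have e : l * (1 / (2 * l * r) + l / 2 * T) = 1 / (2 * r) + T / 2 * (l * l) := by field_simp
      linarith
  have h := discrim_le_zero key
  unfold discrim at h
  rw [neg_sq, Real.sq_sqrt (hκ0 r hr)] at h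
  have e : 4 * (T / 2) * (1 / (2 * r)) = T / r := by field_simp; ring
  rw [e, sub_nonpos, le_div_iff₀ hr] at h
  exact h

/-- The point of the plane on the ray at angle `θ` and distance `r`. -/
def rayPoint (θ r : ℝ) : ℝ × ℝ := (r * Real.cos θ, r * Real.sin θ)

lemma lintegral_interiorPlane_polar {F : ℝ × ℝ → ℝ≥0∞} (hF : Measurable F) :
    ∫⁻ p in interiorPlane, F p = ∫⁻ θ in Ioo (-Real.pi) Real.pi, ∫⁻ r in Ioi 0,
      ENNReal.ofReal r * interiorPlane.indicator F (rayPoint θ r) := by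
  have hm := hF.indicator isOpen_interiorPlane.measurableSet
  have hm2 : Measurable fun p : ℝ × ℝ =>
      ENNReal.ofReal p.1 * interiorPlane.indicator F (rayPoint p.2 p.1) :=
    (by fun_prop : Measurable fun p : ℝ × ℝ => ENNReal.ofReal p.1).mul
      (hm.comp (by unfold rayPoint; fun_prop))
  rw [← lintegral_indicator isOpen_interiorPlane.measurableSet, ← lintegral_comp_polarCoord_symm,
    polarCoord_target, Measure.volume_eq_prod, ← Measure.prod_restrict]
  exact lintegral_prod_symm' _ hm2

/-- The angle is measured from the ρ axis, not from the symmetry axis, so the half plane corresponds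
to cos θ > 0. -/
lemma rayPoint_mem {θ r : ℝ} (hr : 0 < r) : rayPoint θ r ∈ interiorPlane ↔ 0 < Real.cos θ := by
  simp [interiorPlane, rayPoint, hr]

lemma radius_rayPoint {θ r : ℝ} (hr : 0 ≤ r) : radius (rayPoint θ r) = r := by
  rw [radius, rayPoint, mul_pow, mul_pow, ← mul_add, Real.cos_sq_add_sin_sq, mul_one,
    Real.sqrt_sq hr]

/-- The dyadic shell around radius `R` in the interior of the half plane. -/
def shell (R : ℝ) : Set (ℝ × ℝ) := {p | 0 < p.1 ∧ R / 2 < radius p ∧ radius p < 2 * R}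

lemma continuous_radius : Continuous radius := by unfold radius; fun_prop

lemma measurableSet_shell (R : ℝ) : MeasurableSet (shell R) :=
  ((isOpen_lt continuous_const continuous_fst).inter
    ((isOpen_lt continuous_const continuous_radius).inter
      (isOpen_lt continuous_radius continuous_const))).measurableSet

lemma shell_subset (R : ℝ) : shell R ⊆ interiorPlane := fun _ hp => hp.1

lemma radius_pos {p : ℝ × ℝ} (hp : 0 < p.1) : 0 < radius p :=
  Real.sqrt_pos.2 (by positivity)

/-- In polar coordinates the integrand on a ray is κ cos θ dr, since ρ = r cos θ. The ray bound
makes it at most cos θ · T/r, where cos θ · T is the contribution of the ray to the right-hand side.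
On the shell 1/r ≤ 2/R and the radial length is 3R/2, whence the factor 3. -/
lemma lintegral_shell_le {κ Y : ℝ × ℝ → ℝ} (hκ : ContinuousOn κ interiorPlane)
    (hκ0 : ∀ p ∈ interiorPlane, 0 ≤ κ p) (hY : ContinuousOn Y interiorPlane)
    (h : ∀ θ, 0 < Real.cos θ → ∀ r, 0 < r → ENNReal.ofReal (κ (rayPoint θ r) * r) ≤
      ∫⁻ t in Ioi 0, ENNReal.ofReal (Y (rayPoint θ t) * t ^ 2)) {R : ℝ} (hR : 0 < R) :
    ∫⁻ p in shell R, ENNReal.ofReal (κ p / radius p ^ 2 * p.1) ≤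
      3 * ∫⁻ p in interiorPlane, ENNReal.ofReal (Y p * p.1) := by
  have hm1 : Measurable ((shell R).indicator fun p => ENNReal.ofReal (κ p / radius p ^ 2 * p.1)) :=
    measurable_indicator_ofReal ((hκ.div (continuous_radius.pow 2).continuousOn fun p hp =>
      pow_ne_zero 2 (radius_pos hp).ne').mul continuousOn_fst) (measurableSet_shell R)
      (shell_subset R)
  have hm2 : Measurable (interiorPlane.indicator fun p => ENNReal.ofReal (Y p * p.1)) :=
    measurable_indicator_ofReal (hY.mul continuousOn_fst) isOpen_interiorPlane.measurableSet
      subset_rfl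
  have e1 : ∫⁻ p in shell R, ENNReal.ofReal (κ p / radius p ^ 2 * p.1) = ∫⁻ p in interiorPlane,
      (shell R).indicator (fun p => ENNReal.ofReal (κ p / radius p ^ 2 * p.1)) p := by
    rw [setLIntegral_indicator (measurableSet_shell R),
      inter_eq_self_of_subset_left (shell_subset R)]
  have e2 : ∫⁻ p in interiorPlane, ENNReal.ofReal (Y p * p.1) = ∫⁻ p in interiorPlane,
      interiorPlane.indicator (fun p => ENNReal.ofReal (Y p * p.1)) p := by
    rw [setLIntegral_indicator isOpen_interiorPlane.measurableSet, inter_self]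
  rw [e1, e2, lintegral_interiorPlane_polar hm1, lintegral_interiorPlane_polar hm2,
    ← lintegral_const_mul' _ _ (by norm_num)]
  refine lintegral_mono fun θ => ?_
  by_cases hθ : 0 < Real.cos θ
  swap
  · refine (le_of_eq ?_).trans zero_le
    rw [setLIntegral_congr_fun (g := fun _ => 0) measurableSet_Ioi fun r hr => ?_, lintegral_zero]
    simp [indicator_of_notMem (mt (rayPoint_mem hr).1 hθ)]
  have r2 : ∫⁻ r in Ioi 0, ENNReal.ofReal r * interiorPlane.indicator
      (interiorPlane.indicator fun p => ENNReal.ofReal (Y p * p.1)) (rayPoint θ r) =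
      ENNReal.ofReal (Real.cos θ) * ∫⁻ t in Ioi 0, ENNReal.ofReal (Y (rayPoint θ t) * t ^ 2) := by
    rw [← lintegral_const_mul' _ _ ENNReal.ofReal_ne_top]
    refine setLIntegral_congr_fun measurableSet_Ioi fun r hr => ?_
    have hr : 0 < r := hr
    simp only [indicator_of_mem ((rayPoint_mem hr).2 hθ)]
    rw [← ENNReal.ofReal_mul hr.le, ← ENNReal.ofReal_mul hθ.le]
    congr 1
    simp only [rayPoint]
    ring
  simp only [r2]
  set T := ∫⁻ t in Ioi 0, ENNReal.ofReal (Y (rayPoint θ t) * t ^ 2) with hT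
  have r1 : ∀ r ∈ Ioi (0 : ℝ), ENNReal.ofReal r * interiorPlane.indicator
      ((shell R).indicator fun p => ENNReal.ofReal (κ p / radius p ^ 2 * p.1)) (rayPoint θ r) ≤
      (Ioo (R / 2) (2 * R)).indicator
        (fun _ => ENNReal.ofReal (Real.cos θ) * T * ENNReal.ofReal (2 / R)) r := by
    intro r hr
    have hr : 0 < r := hr
    have hmem := (rayPoint_mem hr).2 hθ
    rw [indicator_of_mem hmem]
    by_cases hs : r ∈ Ioo (R / 2) (2 * R)
    · have hsh : rayPoint θ r ∈ shell R :=
        ⟨hmem, by rw [radius_rayPoint hr.le]; exact hs.1, by rw [radius_rayPoint hr.le]; exact hs.2⟩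
      rw [indicator_of_mem hsh, indicator_of_mem hs, radius_rayPoint hr.le,
        ← ENNReal.ofReal_mul hr.le]
      have e : r * (κ (rayPoint θ r) / r ^ 2 * (rayPoint θ r).1) =
          Real.cos θ * (κ (rayPoint θ r) * r) * (1 / r) := by
        simp only [rayPoint]
        field_simp
      have hk := hκ0 _ hmem
      rw [e, ENNReal.ofReal_mul (by positivity), ENNReal.ofReal_mul hθ.le]
      refine mul_le_mul' (mul_le_mul' le_rfl (h θ hθ r hr)) (ENNReal.ofReal_le_ofReal ?_)
      · rw [div_le_div_iff₀ hr hR]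
        linarith [hs.1]
    · have hsh : rayPoint θ r ∉ shell R := fun hh => hs (by
        have := hh.2
        rw [radius_rayPoint hr.le] at this
        exact this)
      rw [indicator_of_notMem hsh]
      simp
  calc _ ≤ ∫⁻ r in Ioi 0, (Ioo (R / 2) (2 * R)).indicator
        (fun _ => ENNReal.ofReal (Real.cos θ) * T * ENNReal.ofReal (2 / R)) r :=
        setLIntegral_mono' measurableSet_Ioi r1
    _ = ENNReal.ofReal (Real.cos θ) * T * ENNReal.ofReal (2 / R) *
        volume (Ioo (R / 2) (2 * R) ∩ Ioi 0) := by
        rw [setLIntegral_indicator measurableSet_Ioo, setLIntegral_const]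
    _ ≤ ENNReal.ofReal (Real.cos θ) * T * ENNReal.ofReal (2 / R) *
        ENNReal.ofReal (2 * R - R / 2) := by
        gcongr
        rw [← Real.volume_Ioo]
        exact measure_mono inter_subset_left
    _ = 3 * (ENNReal.ofReal (Real.cos θ) * T) := by
        rw [mul_assoc, ← ENNReal.ofReal_mul (by positivity),
          show 2 / R * (2 * R - R / 2) = 3 by field_simp; norm_num, mul_comm]
        norm_num

lemma normSq_nonneg (v : Fin 2 → ℝ) : 0 ≤ normSq v := by
  simp only [normSq, dotProduct, Fin.sum_univ_two]
  exact add_nonneg (mul_self_nonneg _) (mul_self_nonneg _)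

lemma hasDerivAt_rayPoint {S : ℝ × ℝ → ℝ} {θ r : ℝ} (hS : DifferentiableAt ℝ S (rayPoint θ r)) :
    HasDerivAt (fun r => S (rayPoint θ r))
      (Real.cos θ * dRho S (rayPoint θ r) + Real.sin θ * dZ S (rayPoint θ r)) r := by
  rw [← fderiv_apply_eq hS]
  have h : HasDerivAt (rayPoint θ) (Real.cos θ, Real.sin θ) r := by
    have h1 := ((hasDerivAt_id r).mul_const (Real.cos θ)).prodMk
      ((hasDerivAt_id r).mul_const (Real.sin θ))
    simpa [rayPoint] using! h1
  exact hS.hasFDerivAt.comp_hasDerivAt r h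

/-- The `L²` norm over a shell of a pair of functions is controlled by a metric covariant
derivative. -/
theorem lintegral_shell_sq_le {s v : ℝ × ℝ → ℝ} {b : ℝ × ℝ → Fin 2 → ℝ}
    (hs : ContDiffOn ℝ 1 s interiorPlane) (hv : ContDiffOn ℝ 1 v interiorPlane)
    (hY : ContinuousOn (fun p => normSq (grad s p + v p • b p) + normSq (grad v p - s p • b p))
      interiorPlane)
    (hlim : ∀ θ, 0 < Real.cos θ →
      Tendsto (fun r => s (rayPoint θ r) ^ 2 + v (rayPoint θ r) ^ 2) atTop (𝓝 0))
    {R : ℝ} (hR : 0 < R) :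
    ∫⁻ p in shell R, ENNReal.ofReal ((s p ^ 2 + v p ^ 2) / radius p ^ 2 * p.1) ≤
      3 * ∫⁻ p in interiorPlane, ENNReal.ofReal
        ((normSq (grad s p + v p • b p) + normSq (grad v p - s p • b p)) * p.1) := by
  refine lintegral_shell_le (κ := fun p => s p ^ 2 + v p ^ 2)
    ((hs.continuousOn.pow 2).add (hv.continuousOn.pow 2)) (fun p _ => by positivity) hY
    (fun θ hθ r hr => ?_) hR
  have hmaps : MapsTo (rayPoint θ) (Ioi 0) interiorPlane := fun t ht => (rayPoint_mem ht).2 hθ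
  refine ofReal_mul_le_lintegral_of_decay (κ := fun r => s (rayPoint θ r) ^ 2 + v (rayPoint θ r) ^ 2)
    (κ' := fun r => 2 * s (rayPoint θ r) *
      (Real.cos θ * dRho s (rayPoint θ r) + Real.sin θ * dZ s (rayPoint θ r)) +
      2 * v (rayPoint θ r) *
      (Real.cos θ * dRho v (rayPoint θ r) + Real.sin θ * dZ v (rayPoint θ r)))
    (fun r _ => by positivity) (fun r hr => ?_)
    (fun r _ => add_nonneg (normSq_nonneg _) (normSq_nonneg _))
    (hY.comp (by unfold rayPoint; fun_prop) hmaps) (fun r _ => ?_) (hlim θ hθ) hr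
  · have h1 := (hasDerivAt_rayPoint (differentiableAt_of_interior hs (hmaps hr))).pow 2
    have h2 := (hasDerivAt_rayPoint (differentiableAt_of_interior hv (hmaps hr))).pow 2
    convert! h1.add h2 using 1
    simp
  · simp only [normSq, grad, dotProduct, Fin.sum_univ_two, Pi.add_apply,
      Pi.sub_apply, Pi.smul_apply, smul_eq_mul, Matrix.cons_val_zero, Matrix.cons_val_one]
    have hcs := Real.cos_sq_add_sin_sq θ
    generalize Real.cos θ = c at *
    generalize Real.sin θ = d at *
    generalize rayPoint θ r = p
    generalize dRho s p = s0
    generalize dRho v p = v0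
    generalize dZ s p = s1
    generalize dZ v p = v1
    generalize b p 0 = b0
    generalize b p 1 = b1
    generalize s p = S
    generalize v p = V
    -- The connection terms S V b and -V S b cancel, so ordinary derivatives may be replaced by
    -- covariant ones in κ'.
    have e : 2 * S * (c * s0 + d * s1) + 2 * V * (c * v0 + d * v1) =
        2 * (S * (c * (s0 + V * b0) + d * (s1 + V * b1)) +
          V * (c * (v0 - S * b0) + d * (v1 - S * b1))) := by ring
    rw [e]
    generalize s0 + V * b0 = a0
    generalize s1 + V * b1 = a1
    generalize v0 - S * b0 = c0
    generalize v1 - S * b1 = c1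
    have f1 : (c * a0 + d * a1) ^ 2 ≤ a0 * a0 + a1 * a1 := by
      have : (a0 * a0 + a1 * a1) * (c ^ 2 + d ^ 2) = (c * a0 + d * a1) ^ 2 + (c * a1 - d * a0) ^ 2 := by
        ring
      rw [hcs] at this
      nlinarith [sq_nonneg (c * a1 - d * a0)]
    have f2 : (c * c0 + d * c1) ^ 2 ≤ c0 * c0 + c1 * c1 := by
      have : (c0 * c0 + c1 * c1) * (c ^ 2 + d ^ 2) = (c * c0 + d * c1) ^ 2 + (c * c1 - d * c0) ^ 2 := by
        ring
      rw [hcs] at this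
      nlinarith [sq_nonneg (c * c1 - d * c0)]
    generalize c * a0 + d * a1 = A at *
    generalize c * c0 + d * c1 = C at *
    have f3 : (S * A + V * C) ^ 2 ≤ (S ^ 2 + V ^ 2) * (A ^ 2 + C ^ 2) := by
      nlinarith [sq_nonneg (S * C - V * A)]
    have f4 : (S ^ 2 + V ^ 2) * (A ^ 2 + C ^ 2) ≤
        (S ^ 2 + V ^ 2) * (a0 * a0 + a1 * a1 + (c0 * c0 + c1 * c1)) := by
      gcongr
    nlinarith

/-! ### The background in the coordinates `r` and `c = cos θ` -/

/-- `Σ` as a function of `r` and `c`. -/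
def polSigma (m r c : ℝ) : ℝ := (r + m) ^ 2 + m ^ 2 * c ^ 2

/-- `η₀ / sin² θ` as a function of `r` and `c`. -/
def polH (m r c : ℝ) : ℝ := (r + m) ^ 2 + m ^ 2 + 2 * m ^ 3 * (r + m) * (1 - c ^ 2) / polSigma m r c

/-- `η₀` as a function of `r` and `c`. -/
def polEta (m r c : ℝ) : ℝ := (1 - c ^ 2) * polH m r c

/-- The radial derivative of `η₀`. -/
def polEtaR (m r c : ℝ) : ℝ :=
  (1 - c ^ 2) * (2 * (r + m) +
    2 * m ^ 3 * (1 - c ^ 2) * (m ^ 2 * c ^ 2 - (r + m) ^ 2) / polSigma m r c ^ 2)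

/-- The derivative of `η₀` with respect to `c`. -/
def polEtaC (m r c : ℝ) : ℝ :=
  -2 * c * (polH m r c +
    (1 - c ^ 2) * (2 * m ^ 3 * (r + m) * ((r + m) ^ 2 + m ^ 2) / polSigma m r c ^ 2))

/-- `ω₀` as a function of `r` and `c`. -/
def polOmega (m r c : ℝ) : ℝ :=
  2 * m ^ 2 * (c ^ 3 - 3 * c) - 2 * m ^ 4 * c * (1 - c ^ 2) ^ 2 / polSigma m r c

/-- The radial derivative of `ω₀`. -/
def polOmegaR (m r c : ℝ) : ℝ :=
  4 * m ^ 4 * c * (1 - c ^ 2) ^ 2 * (r + m) / polSigma m r c ^ 2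

/-- The derivative of `ω₀` with respect to `c`. -/
def polOmegaC (m r c : ℝ) : ℝ :=
  (1 - c ^ 2) * (-(6 * m ^ 2) - 2 * m ^ 4 * (1 - 5 * c ^ 2) / polSigma m r c +
    4 * m ^ 6 * c ^ 2 * (1 - c ^ 2) / polSigma m r c ^ 2)

/-! ### Derivatives and bounds in polar variables -/

section Polar

variable {m r c : ℝ}

lemma sq_le_polSigma : (r + m) ^ 2 ≤ polSigma m r c := by
  unfold polSigma; nlinarith [sq_nonneg (m * c)]

lemma polSigma_pos (hm : 0 < m) (hr : 0 < r) : 0 < polSigma m r c :=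
  lt_of_lt_of_le (by positivity) sq_le_polSigma

lemma hasDerivAt_polSigma {f g : ℝ → ℝ} {f' g' t : ℝ} (hf : HasDerivAt f f' t)
    (hg : HasDerivAt g g' t) : HasDerivAt (fun t => polSigma m (f t) (g t))
      (2 * (f t + m) * f' + m ^ 2 * (2 * g t * g')) t := by
  have := ((hf.add_const m).pow 2).add ((hg.pow 2).const_mul (m ^ 2))
  convert! this using 1
  simp

lemma hasDerivAt_polEta (hm : 0 < m) {f g : ℝ → ℝ} {f' g' t : ℝ} (hf : HasDerivAt f f' t)
    (hg : HasDerivAt g g' t) (h0 : 0 < f t) : HasDerivAt (fun t => polEta m (f t) (g t))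
      (polEtaR m (f t) (g t) * f' + polEtaC m (f t) (g t) * g') t := by
  have hS := (polSigma_pos (c := g t) hm h0).ne'
  have hu := (hg.pow 2).const_sub 1
  have hH := (((hf.add_const m).pow 2).add_const (m ^ 2)).add
    ((((hf.add_const m).const_mul (2 * m ^ 3)).mul hu).div (hasDerivAt_polSigma hf hg) hS)
  convert! hu.mul hH using 1
  simp only [polEtaR, polEtaC, polH, Pi.add_apply, Pi.mul_apply, Pi.pow_apply, Pi.div_apply]
  have e : polSigma m (f t) (g t) = (f t + m) ^ 2 + m ^ 2 * (g t) ^ 2 := rfl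
  generalize polSigma m (f t) (g t) = S at *
  field_simp
  rw [e]
  push_cast
  ring

lemma hasDerivAt_polOmega (hm : 0 < m) {f g : ℝ → ℝ} {f' g' t : ℝ} (hf : HasDerivAt f f' t)
    (hg : HasDerivAt g g' t) (h0 : 0 < f t) : HasDerivAt (fun t => polOmega m (f t) (g t))
      (polOmegaR m (f t) (g t) * f' + polOmegaC m (f t) (g t) * g') t := by
  have hS := (polSigma_pos (c := g t) hm h0).ne'
  have hu := ((hg.pow 2).const_sub 1).pow 2
  have hH := (((hg.pow 3).sub (hg.const_mul 3)).const_mul (2 * m ^ 2)).sub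
    (((hg.const_mul (2 * m ^ 4)).mul hu).div (hasDerivAt_polSigma hf hg) hS)
  convert! hH using 1
  simp only [polOmegaR, polOmegaC, Pi.mul_apply, Pi.pow_apply]
  have e : polSigma m (f t) (g t) = (f t + m) ^ 2 + m ^ 2 * (g t) ^ 2 := rfl
  generalize polSigma m (f t) (g t) = S at *
  field_simp
  rw [e]
  push_cast
  ring

lemma sq_le_polH (hm : 0 < m) (hr : 0 < r) (hc : c ^ 2 ≤ 1) : (r + m) ^ 2 ≤ polH m r c := by
  have hS := polSigma_pos (c := c) hm hr
  have h1 : 0 ≤ 1 - c ^ 2 := by linarith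
  have : 0 ≤ 2 * m ^ 3 * (r + m) * (1 - c ^ 2) / polSigma m r c := by positivity
  unfold polH
  nlinarith [sq_nonneg m]

lemma polH_le (hm : 0 < m) (hr : 0 < r) (hc : c ^ 2 ≤ 1) : polH m r c ≤ 4 * (r + m) ^ 2 := by
  have hS := polSigma_pos (c := c) hm hr
  have h1 : 0 ≤ 1 - c ^ 2 := by linarith
  have h2 : 2 * m ^ 3 * (r + m) * (1 - c ^ 2) / polSigma m r c ≤ 2 * (r + m) ^ 2 := by
    rw [div_le_iff₀ hS]
    calc 2 * m ^ 3 * (r + m) * (1 - c ^ 2) ≤ 2 * (r + m) ^ 3 * (r + m) * 1 := by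
          gcongr
          · linarith
          · nlinarith [sq_nonneg c]
      _ = 2 * (r + m) ^ 2 * (r + m) ^ 2 := by ring
      _ ≤ _ := by gcongr; exact sq_le_polSigma
  unfold polH
  nlinarith

/-- The correction X to the leading term 2(r + m) satisfies 0 ≤ X ≤ 2m, because Σ ≥ (r + m)². -/
lemma polEtaR_mem (hm : 0 < m) (hr : 0 < r) (hc : c ^ 2 ≤ 1) :
    (1 - c ^ 2) * (2 * r) ≤ polEtaR m r c ∧ polEtaR m r c ≤ (1 - c ^ 2) * (2 * (r + m)) := by
  have hS := polSigma_pos (c := c) hm hr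
  have h1 : 0 ≤ 1 - c ^ 2 := by linarith
  have h2 : 0 ≤ (r + m) ^ 2 - m ^ 2 * c ^ 2 := by nlinarith [sq_nonneg m]
  set X := 2 * m ^ 3 * (1 - c ^ 2) * ((r + m) ^ 2 - m ^ 2 * c ^ 2) / polSigma m r c ^ 2 with hX
  have hX0 : 0 ≤ X := by positivity
  have hX1 : X ≤ 2 * m := by
    rw [hX, div_le_iff₀ (by positivity)]
    calc 2 * m ^ 3 * (1 - c ^ 2) * ((r + m) ^ 2 - m ^ 2 * c ^ 2)
        ≤ 2 * m ^ 3 * 1 * (r + m) ^ 2 := by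
          gcongr
          · nlinarith [sq_nonneg c]
          · nlinarith [sq_nonneg (m * c)]
      _ = 2 * m * (m ^ 2 * (r + m) ^ 2) := by ring
      _ ≤ 2 * m * ((r + m) ^ 2 * (r + m) ^ 2) := by gcongr; linarith
      _ ≤ 2 * m * (polSigma m r c * polSigma m r c) := by
          gcongr <;> exact sq_le_polSigma
      _ = _ := by ring
  have e : polEtaR m r c = (1 - c ^ 2) * (2 * (r + m) - X) := by
    rw [hX]; unfold polEtaR; ring
  rw [e]
  constructor <;> gcongr <;> linarith

/-- The two terms in the bracket are nonnegative, so dropping the correction X gives the lower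
bound. Both are at most 4(r + m)², and 4 · 8² = 256. -/
lemma polEtaC_sq_mem (hm : 0 < m) (hr : 0 < r) (hc : c ^ 2 ≤ 1) :
    4 * c ^ 2 * polH m r c ^ 2 ≤ polEtaC m r c ^ 2 ∧ polEtaC m r c ^ 2 ≤ 256 * (r + m) ^ 4 := by
  have hS := polSigma_pos (c := c) hm hr
  have h1 : 0 ≤ 1 - c ^ 2 := by linarith
  set X := (1 - c ^ 2) * (2 * m ^ 3 * (r + m) * ((r + m) ^ 2 + m ^ 2) / polSigma m r c ^ 2) with hX
  have hX0 : 0 ≤ X := by positivity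
  have hX1 : X ≤ 4 * (r + m) ^ 2 := by
    have h2 : 2 * m ^ 3 * (r + m) * ((r + m) ^ 2 + m ^ 2) / polSigma m r c ^ 2 ≤
        4 * (r + m) ^ 2 := by
      rw [div_le_iff₀ (by positivity)]
      calc 2 * m ^ 3 * (r + m) * ((r + m) ^ 2 + m ^ 2)
          ≤ 2 * (r + m) ^ 3 * (r + m) * ((r + m) ^ 2 + (r + m) ^ 2) := by gcongr <;> linarith
        _ = 4 * (r + m) ^ 2 * ((r + m) ^ 2 * (r + m) ^ 2) := by ring
        _ ≤ 4 * (r + m) ^ 2 * (polSigma m r c * polSigma m r c) := by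
            gcongr <;> exact sq_le_polSigma
        _ = _ := by ring
    calc X ≤ 1 * (4 * (r + m) ^ 2) := by
          rw [hX]; gcongr; nlinarith [sq_nonneg c]
      _ = _ := one_mul _
  have hH0 : 0 ≤ polH m r c := (sq_nonneg _).trans (sq_le_polH hm hr hc)
  have hH1 := polH_le hm hr hc
  have e : polEtaC m r c ^ 2 = 4 * c ^ 2 * (polH m r c + X) ^ 2 := by
    rw [hX]; unfold polEtaC; ring
  rw [e]
  constructor
  · gcongr; linarith
  · calc 4 * c ^ 2 * (polH m r c + X) ^ 2 ≤ 4 * 1 * (8 * (r + m) ^ 2) ^ 2 := by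
          gcongr; linarith
      _ = _ := by ring

lemma polOmegaR_sq_le (hm : 0 < m) (hr : 0 < r) (hc : c ^ 2 ≤ 1) :
    polOmegaR m r c ^ 2 ≤ 16 * m ^ 2 * (1 - c ^ 2) ^ 2 := by
  have hS := polSigma_pos (c := c) hm hr
  have h1 : 0 ≤ 1 - c ^ 2 := by linarith
  have h2 : m ^ 3 * (r + m) ≤ polSigma m r c ^ 2 := by
    calc m ^ 3 * (r + m) ≤ (r + m) ^ 3 * (r + m) := by gcongr; linarith
      _ = (r + m) ^ 2 * (r + m) ^ 2 := by ring
      _ ≤ polSigma m r c * polSigma m r c := by gcongr <;> exact sq_le_polSigma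
      _ = _ := by ring
  have h3 : m ^ 3 * (r + m) / polSigma m r c ^ 2 ≤ 1 := (div_le_one (by positivity)).2 h2
  have e : polOmegaR m r c ^ 2 = 16 * m ^ 2 * (1 - c ^ 2) ^ 2 *
      (c ^ 2 * (1 - c ^ 2) ^ 2 * (m ^ 3 * (r + m) / polSigma m r c ^ 2) ^ 2) := by
    unfold polOmegaR; ring
  rw [e]
  have h4 : c ^ 2 * (1 - c ^ 2) ^ 2 * (m ^ 3 * (r + m) / polSigma m r c ^ 2) ^ 2 ≤
      1 * 1 ^ 2 * 1 ^ 2 := by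
    gcongr
    nlinarith [sq_nonneg c]
  calc _ ≤ 16 * m ^ 2 * (1 - c ^ 2) ^ 2 * (1 * 1 ^ 2 * 1 ^ 2) := by gcongr
    _ = _ := by ring

/-- What matters is the factor 1 - c², the vanishing of the derivative of the twist on the axis. The
remaining bracket is a polynomial in c² and x = m²/Σ, both in [0, 1], and is crudely bounded by 20.
-/
lemma polOmegaC_sq_le (hm : 0 < m) (hr : 0 < r) (hc : c ^ 2 ≤ 1) :
    polOmegaC m r c ^ 2 ≤ 400 * m ^ 4 * (1 - c ^ 2) ^ 2 := by
  have hS := polSigma_pos (c := c) hm hr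
  have h1 : 0 ≤ 1 - c ^ 2 := by linarith
  have hmS : m ^ 2 ≤ polSigma m r c := le_trans (by gcongr; linarith) sq_le_polSigma
  set x := m ^ 2 / polSigma m r c with hx
  have hx0 : 0 ≤ x := by positivity
  have hx1 : x ≤ 1 := (div_le_one hS).2 hmS
  have e : polOmegaC m r c = (1 - c ^ 2) * m ^ 2 *
      (-6 - 2 * x * (1 - 5 * c ^ 2) + 4 * x ^ 2 * c ^ 2 * (1 - c ^ 2)) := by
    rw [hx]; unfold polOmegaC; ring
  have h5 : |(-6 - 2 * x * (1 - 5 * c ^ 2) + 4 * x ^ 2 * c ^ 2 * (1 - c ^ 2))| ≤ 20 := by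
    have hc0 := sq_nonneg c
    generalize c ^ 2 = d at *
    have k1 : x * d ≤ 1 := mul_le_one₀ hx1 hc0 hc
    have k2 : 0 ≤ x * d := mul_nonneg hx0 hc0
    have k3 : 0 ≤ x * (1 - d) := mul_nonneg hx0 h1
    have k4 : x * (1 - d) ≤ 1 := mul_le_one₀ hx1 h1 (by linarith)
    have k5 : (x * d) * (x * (1 - d)) ≤ 1 := mul_le_one₀ k1 k3 k4
    have k6 : 0 ≤ (x * d) * (x * (1 - d)) := mul_nonneg k2 k3
    rw [abs_le]
    constructor <;> nlinarith
  have h6 := sq_le_sq' (neg_le_of_abs_le h5) (le_of_abs_le h5)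
  rw [e, mul_pow]
  calc _ ≤ ((1 - c ^ 2) * m ^ 2) ^ 2 * 20 ^ 2 := by gcongr
    _ = _ := by ring

end Polar

/-! ### Bounds of the background fields on the half plane -/

section Background

variable {m : ℝ} {p : ℝ × ℝ}

lemma radius_sq (p : ℝ × ℝ) : radius p ^ 2 = p.1 ^ 2 + p.2 ^ 2 := Real.sq_sqrt (by positivity)

lemma cos_sq_le (p : ℝ × ℝ) : (p.2 / radius p) ^ 2 ≤ 1 := by
  rw [div_pow, radius_sq]
  exact div_le_one_of_le₀ (by nlinarith [sq_nonneg p.1]) (by positivity)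

lemma one_sub_cos_sq (hp : 0 < p.1) : 1 - (p.2 / radius p) ^ 2 = p.1 ^ 2 / radius p ^ 2 := by
  have := (radius_pos hp).ne'
  have h := radius_sq p
  field_simp
  linarith

lemma le_radius (p : ℝ × ℝ) : p.1 ≤ radius p := by
  refine Real.le_sqrt_of_sq_le ?_
  nlinarith [sq_nonneg p.2]

/-- Dividing the numerator by Σ = (r + m)² + m² - m² sin² θ absorbs the negative term: the remainder
carries (r + m)² + m² - r² = 2m(r + m). In this form η₀ is visibly positive. -/
lemma eta0_eq_polEta (hm : 0 < m) (hp : 0 < p.1) :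
    eta0 m p = polEta m (radius p) (p.2 / radius p) := by
  have hS := (polSigma_pos (c := p.2 / radius p) hm (radius_pos hp)).ne'
  have hr := (radius_pos hp).ne'
  have h := one_sub_cos_sq hp
  have e : kerrSigma m p = polSigma m (radius p) (p.2 / radius p) := rfl
  have e2 : polSigma m (radius p) (p.2 / radius p) =
      (radius p + m) ^ 2 + m ^ 2 * (1 - p.1 ^ 2 / radius p ^ 2) := by
    rw [← h]; unfold polSigma; ring
  unfold polEta polH eta0
  rw [e, h]
  generalize polSigma m (radius p) (p.2 / radius p) = S at *
  field_simp
  rw [e2]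
  field_simp
  ring

lemma omega0_eq_polOmega (hp : 0 < p.1) :
    omega0 m p = polOmega m (radius p) (p.2 / radius p) := by
  have e : kerrSigma m p = polSigma m (radius p) (p.2 / radius p) := rfl
  unfold polOmega omega0
  rw [e, one_sub_cos_sq hp]
  ring

lemma hasDerivAt_radius_fst (hp : 0 < p.1) :
    HasDerivAt (fun s : ℝ => radius (s, p.2)) (p.1 / radius p) p.1 := by
  have h := (((hasDerivAt_id p.1).pow 2).add_const (p.2 ^ 2)).sqrt (by simp; positivity)
  convert! h using 1
  simp [radius]
  field_simp

lemma hasDerivAt_radius_snd (hp : 0 < p.1) :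
    HasDerivAt (fun s : ℝ => radius (p.1, s)) (p.2 / radius p) p.2 := by
  have h := (((hasDerivAt_id p.2).pow 2).const_add (p.1 ^ 2)).sqrt (by simp; positivity)
  convert! h using 1
  simp [radius]
  field_simp

lemma hasDerivAt_cos_fst (hp : 0 < p.1) :
    HasDerivAt (fun s : ℝ => p.2 / radius (s, p.2)) (-(p.2 * p.1) / radius p ^ 3) p.1 := by
  have h := (hasDerivAt_const p.1 p.2).div (hasDerivAt_radius_fst hp) (radius_pos hp).ne'
  have := (radius_pos hp).ne'
  convert! h using 1
  field_simp
  simp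

lemma hasDerivAt_cos_snd (hp : 0 < p.1) :
    HasDerivAt (fun s : ℝ => s / radius (p.1, s)) (p.1 ^ 2 / radius p ^ 3) p.2 := by
  have h := (hasDerivAt_id p.2).div (hasDerivAt_radius_snd hp) (radius_pos hp).ne'
  have := (radius_pos hp).ne'
  have h2 := radius_sq p
  convert! h using 1
  simp only [id]
  field_simp
  linarith

/-- The gradient of a function of `r` and `c`. -/
lemma normSq_grad_polar (hp : 0 < p.1) {f : ℝ × ℝ → ℝ} {fr fc : ℝ}
    (h1 : dRho f p = fr * (p.1 / radius p) + fc * (-(p.2 * p.1) / radius p ^ 3))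
    (h2 : dZ f p = fr * (p.2 / radius p) + fc * (p.1 ^ 2 / radius p ^ 3)) :
    normSq (grad f p) = fr ^ 2 + fc ^ 2 * (p.1 ^ 2 / radius p ^ 4) := by
  have hr := (radius_pos hp).ne'
  have h := radius_sq p
  simp only [normSq, grad, dotProduct, Fin.sum_univ_two, Matrix.cons_val_zero, Matrix.cons_val_one,
    h1, h2]
  field_simp
  linear_combination (-(fr ^ 2 * radius p ^ 4) - fc ^ 2 * p.1 ^ 2) * h

lemma normSq_grad_eta0 (hm : 0 < m) (hp : 0 < p.1) : normSq (grad (eta0 m) p) =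
    polEtaR m (radius p) (p.2 / radius p) ^ 2 +
      polEtaC m (radius p) (p.2 / radius p) ^ 2 * (p.1 ^ 2 / radius p ^ 4) := by
  refine normSq_grad_polar hp ?_ ?_
  · have h := hasDerivAt_polEta hm (hasDerivAt_radius_fst hp) (hasDerivAt_cos_fst hp)
      (radius_pos hp)
    refine (h.congr_of_eventuallyEq ?_).deriv
    filter_upwards [lt_mem_nhds hp] with s hs
    exact eta0_eq_polEta (p := (s, p.2)) hm hs
  · have h := hasDerivAt_polEta hm (hasDerivAt_radius_snd hp) (hasDerivAt_cos_snd hp)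
      (radius_pos hp)
    refine (h.congr_of_eventuallyEq (Eventually.of_forall fun s => ?_)).deriv
    exact eta0_eq_polEta (p := (p.1, s)) hm hp

lemma normSq_grad_omega0 (hm : 0 < m) (hp : 0 < p.1) : normSq (grad (omega0 m) p) =
    polOmegaR m (radius p) (p.2 / radius p) ^ 2 +
      polOmegaC m (radius p) (p.2 / radius p) ^ 2 * (p.1 ^ 2 / radius p ^ 4) := by
  refine normSq_grad_polar hp ?_ ?_
  · have h := hasDerivAt_polOmega hm (hasDerivAt_radius_fst hp) (hasDerivAt_cos_fst hp)
      (radius_pos hp)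
    refine (h.congr_of_eventuallyEq ?_).deriv
    filter_upwards [lt_mem_nhds hp] with s hs
    exact omega0_eq_polOmega (p := (s, p.2)) hs
  · have h := hasDerivAt_polOmega hm (hasDerivAt_radius_snd hp) (hasDerivAt_cos_snd hp)
      (radius_pos hp)
    refine (h.congr_of_eventuallyEq (Eventually.of_forall fun s => ?_)).deriv
    exact omega0_eq_polOmega (p := (p.1, s)) hp

lemma sq_le_eta0 (hm : 0 < m) (hp : 0 < p.1) : p.1 ^ 2 ≤ eta0 m p := by
  have hr := radius_pos hp
  have h := sq_le_polH hm hr (cos_sq_le p)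
  rw [eta0_eq_polEta hm hp, polEta, one_sub_cos_sq hp, div_mul_eq_mul_div,
    le_div_iff₀ (by positivity)]
  have : radius p ^ 2 ≤ (radius p + m) ^ 2 := by gcongr; linarith
  gcongr
  exact this.trans h

lemma eta0_pos (hm : 0 < m) (hp : 0 < p.1) : 0 < eta0 m p :=
  lt_of_lt_of_le (by positivity) (sq_le_eta0 hm hp)

lemma add_le_mul_radius (hm : 0 < m) {d : ℝ} (hd : 0 < d) (hdp : d ≤ radius p) :
    radius p + m ≤ (1 + m / d) * radius p := by
  have : m ≤ m / d * radius p := by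
    calc m = m / d * d := by field_simp
      _ ≤ _ := by gcongr
  linarith

lemma eta0_le (hm : 0 < m) {d : ℝ} (hd : 0 < d) (hp : 0 < p.1) (hdp : d ≤ radius p) :
    eta0 m p ≤ 4 * (1 + m / d) ^ 2 * p.1 ^ 2 := by
  have hr := radius_pos hp
  have h := polH_le hm hr (cos_sq_le p)
  have h2 := add_le_mul_radius hm hd hdp
  rw [eta0_eq_polEta hm hp, polEta, one_sub_cos_sq hp]
  calc p.1 ^ 2 / radius p ^ 2 * polH m (radius p) (p.2 / radius p)
      ≤ p.1 ^ 2 / radius p ^ 2 * (4 * ((1 + m / d) * radius p) ^ 2) := by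
        gcongr
        refine h.trans ?_
        gcongr
    _ = _ := by field_simp

/-- Both partial derivatives carry sin² θ = ρ²/r², and ρ² ≤ η₀. The resulting decay |∂ω₀|/η₀ =
O(1/r) is what matches the Hardy weight. -/
lemma normSq_grad_omega0_le (hm : 0 < m) {d : ℝ} (hd : 0 < d) (hp : 0 < p.1)
    (hdp : d ≤ radius p) :
    normSq (grad (omega0 m) p) ≤
      (16 * m ^ 2 / d ^ 2 + 400 * m ^ 4 / d ^ 4) * (eta0 m p ^ 2 / radius p ^ 2) := by
  have hr := radius_pos hp
  have hc := cos_sq_le p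
  have h1 := polOmegaR_sq_le hm hr hc
  have h2 := polOmegaC_sq_le hm hr hc
  rw [one_sub_cos_sq hp] at h1 h2
  rw [normSq_grad_omega0 hm hp]
  have hη := sq_le_eta0 hm hp
  have hρ := le_radius p
  calc _ ≤ 16 * m ^ 2 * (p.1 ^ 2 / radius p ^ 2) ^ 2 +
        400 * m ^ 4 * (p.1 ^ 2 / radius p ^ 2) ^ 2 * (radius p ^ 2 / radius p ^ 4) := by
          gcongr
    _ = (16 * m ^ 2 / radius p ^ 2 + 400 * m ^ 4 / radius p ^ 4) *
        ((p.1 ^ 2) ^ 2 / radius p ^ 2) := by field_simp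
    _ ≤ _ := by gcongr

/-- The radial and angular parts contribute 4 and 256; the factor 1/ρ² in the radial part comes from
ρ ≤ r + m. -/
lemma normSq_grad_eta0_le (hm : 0 < m) (hp : 0 < p.1) :
    normSq (grad (eta0 m) p) ≤ 260 * (eta0 m p ^ 2 / p.1 ^ 2) := by
  have hr := radius_pos hp
  have hc := cos_sq_le p
  obtain ⟨h1, h2⟩ := polEtaR_mem hm hr hc
  have h3 := (polEtaC_sq_mem hm hr hc).2
  have hH := sq_le_polH hm hr hc
  have hη : p.1 ^ 2 / radius p ^ 2 * (radius p + m) ^ 2 ≤ eta0 m p := by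
    rw [eta0_eq_polEta hm hp, polEta, one_sub_cos_sq hp]
    gcongr
  rw [one_sub_cos_sq hp] at h1 h2
  rw [normSq_grad_eta0 hm hp]
  have hρ : p.1 ≤ radius p + m := (le_radius p).trans (by linarith)
  have h4 : polEtaR m (radius p) (p.2 / radius p) ^ 2 ≤
      (p.1 ^ 2 / radius p ^ 2 * (2 * (radius p + m))) ^ 2 :=
    pow_le_pow_left₀ (le_trans (by positivity) h1) h2 2
  have h5 : (p.1 ^ 2 / radius p ^ 2 * (radius p + m) ^ 2) ^ 2 ≤ eta0 m p ^ 2 := by gcongr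
  calc _ ≤ (p.1 ^ 2 / radius p ^ 2 * (2 * (radius p + m))) ^ 2 +
        256 * (radius p + m) ^ 4 * (p.1 ^ 2 / radius p ^ 4) := by gcongr
    _ = 4 * (p.1 ^ 2 / radius p ^ 2) ^ 2 * (radius p + m) ^ 2 +
        256 * ((p.1 ^ 2 / radius p ^ 2 * (radius p + m) ^ 2) ^ 2 / p.1 ^ 2) := by
          field_simp
          norm_num
    _ ≤ 4 * (p.1 ^ 2 / radius p ^ 2) ^ 2 * (radius p + m) ^ 2 * ((radius p + m) ^ 2 / p.1 ^ 2) +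
        256 * (eta0 m p ^ 2 / p.1 ^ 2) := by
          refine add_le_add (le_mul_of_one_le_right (by positivity) ?_) (by gcongr)
          rw [one_le_div (by positivity)]
          gcongr
    _ = 4 * ((p.1 ^ 2 / radius p ^ 2 * (radius p + m) ^ 2) ^ 2 / p.1 ^ 2) +
        256 * (eta0 m p ^ 2 / p.1 ^ 2) := by ring
    _ ≤ 4 * (eta0 m p ^ 2 / p.1 ^ 2) + 256 * (eta0 m p ^ 2 / p.1 ^ 2) := by gcongr
    _ = _ := by ring

/-- Nondegeneracy of the gradient of η₀, which behaves like ρ². It lets the third energy term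
control the twist with the weight 1/ρ². Neither partial derivative suffices alone: the radial one
degenerates at the axis and the lower bound for the angular one at the equator, so the left side is
split with weights sin² θ and cos² θ. -/
lemma le_normSq_grad_eta0 (hm : 0 < m) {d : ℝ} (hd : 0 < d) (hp : 0 < p.1)
    (hdp : d ≤ radius p) :
    eta0 m p ^ 2 / p.1 ^ 2 ≤ 4 * (1 + m / d) ^ 4 * normSq (grad (eta0 m) p) := by
  have hr := radius_pos hp
  have hc := cos_sq_le p
  have h1 := (polEtaR_mem hm hr hc).1
  have h3 := (polEtaC_sq_mem hm hr hc).1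
  have hH1 := polH_le hm hr hc
  have hH0 : 0 ≤ polH m (radius p) (p.2 / radius p) :=
    (sq_nonneg _).trans (sq_le_polH hm hr hc)
  have hk := add_le_mul_radius hm hd hdp
  have hk1 : 1 ≤ 1 + m / d := le_add_of_nonneg_right (by positivity)
  have hu := one_sub_cos_sq hp
  rw [hu] at h1
  rw [normSq_grad_eta0 hm hp]
  have hη : eta0 m p = p.1 ^ 2 / radius p ^ 2 * polH m (radius p) (p.2 / radius p) := by
    rw [eta0_eq_polEta hm hp, polEta, hu]
  have hz : (p.2 / radius p) ^ 2 = 1 - p.1 ^ 2 / radius p ^ 2 := by linarith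
  have hR : (p.1 ^ 2 / radius p ^ 2 * (2 * radius p)) ^ 2 ≤
      polEtaR m (radius p) (p.2 / radius p) ^ 2 := pow_le_pow_left₀ (by positivity) h1 2
  set k := 1 + m / d with hkdef
  set H := polH m (radius p) (p.2 / radius p) with hHdef
  have hH2 : H ≤ 4 * (k * radius p) ^ 2 := hH1.trans (by gcongr)
  have hH3 : H ^ 2 ≤ (4 * (k * radius p) ^ 2) ^ 2 := by gcongr
  have hk4 : 1 ≤ k ^ 4 := one_le_pow₀ hk1
  rw [hz] at h3
  have hle1 : 0 ≤ 1 - p.1 ^ 2 / radius p ^ 2 := hz ▸ sq_nonneg _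
  have g1 : p.1 ^ 2 / radius p ^ 4 * H ^ 2 * (p.1 ^ 2 / radius p ^ 2) ≤
      4 * k ^ 4 * polEtaR m (radius p) (p.2 / radius p) ^ 2 := by
    calc p.1 ^ 2 / radius p ^ 4 * H ^ 2 * (p.1 ^ 2 / radius p ^ 2)
        ≤ p.1 ^ 2 / radius p ^ 4 * (4 * (k * radius p) ^ 2) ^ 2 * (p.1 ^ 2 / radius p ^ 2) := by
          gcongr
      _ = 4 * k ^ 4 * (p.1 ^ 2 / radius p ^ 2 * (2 * radius p)) ^ 2 := by field_simp; norm_num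
      _ ≤ _ := by gcongr
  have g2 : p.1 ^ 2 / radius p ^ 4 * H ^ 2 * (1 - p.1 ^ 2 / radius p ^ 2) ≤
      4 * k ^ 4 * (polEtaC m (radius p) (p.2 / radius p) ^ 2 * (p.1 ^ 2 / radius p ^ 4)) := by
    calc p.1 ^ 2 / radius p ^ 4 * H ^ 2 * (1 - p.1 ^ 2 / radius p ^ 2)
        ≤ 16 * 1 * (p.1 ^ 2 / radius p ^ 4 * H ^ 2 * (1 - p.1 ^ 2 / radius p ^ 2)) := by
          refine le_mul_of_one_le_left (by positivity) (by norm_num)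
      _ = 4 * 1 * ((4 * (1 - p.1 ^ 2 / radius p ^ 2) * H ^ 2) * (p.1 ^ 2 / radius p ^ 4)) := by ring
      _ ≤ _ := by gcongr
  calc eta0 m p ^ 2 / p.1 ^ 2 = p.1 ^ 2 / radius p ^ 4 * H ^ 2 * (p.1 ^ 2 / radius p ^ 2) +
        p.1 ^ 2 / radius p ^ 4 * H ^ 2 * (1 - p.1 ^ 2 / radius p ^ 2) := by
        rw [hη]; field_simp; ring
    _ ≤ _ := by linarith

/-- The exponential equals η₀ Σ / (ρ² r²), and away from the horizon η₀ is O(ρ²) and Σ is O(r²). -/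
lemma exp_sigma0_q0_le (hm : 0 < m) {d : ℝ} (hd : 0 < d) (hp : 0 < p.1) (hdp : d ≤ radius p) :
    Real.exp (2 * (sigma0 m p + q0 m p)) ≤ 8 * (1 + m / d) ^ 4 := by
  have hr := radius_pos hp
  have hη := eta0_pos hm hp
  have hS : 0 < kerrSigma m p := polSigma_pos (c := p.2 / radius p) hm hr
  have h1 : 2 * (sigma0 m p + q0 m p) = Real.log (eta0 m p / p.1 ^ 2) +
      Real.log (eta0 m p / p.1 ^ 2) + Real.log (kerrSigma m p * (p.1 / radius p) ^ 2 / eta0 m p) := by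
    unfold sigma0 q0; ring
  rw [h1, Real.exp_add, Real.exp_add, Real.exp_log (by positivity), Real.exp_log (by positivity)]
  have hk := add_le_mul_radius hm hd hdp
  have hS2 : kerrSigma m p ≤ 2 * (radius p + m) ^ 2 := by
    have hc := cos_sq_le p
    unfold kerrSigma
    have : m ^ 2 * (p.2 / radius p) ^ 2 ≤ m ^ 2 * 1 := by gcongr
    nlinarith
  have hη2 := eta0_le hm hd hp hdp
  calc _ = eta0 m p * kerrSigma m p / (p.1 ^ 2 * radius p ^ 2) := by field_simp
    _ ≤ (4 * (1 + m / d) ^ 2 * p.1 ^ 2) * (2 * ((1 + m / d) * radius p) ^ 2) /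
        (p.1 ^ 2 * radius p ^ 2) := by
        gcongr
        refine hS2.trans ?_
        gcongr
    _ = _ := by field_simp; norm_num

lemma contDiffOn_radius : ContDiffOn ℝ 2 radius interiorPlane := by
  intro p hp
  have hp : 0 < p.1 := hp
  have h1 : ContDiffAt ℝ 2 (fun x : ℝ × ℝ => x.1 ^ 2 + x.2 ^ 2) p := by fun_prop
  exact (h1.sqrt (by positivity)).contDiffWithinAt

lemma contDiffOn_kerrSigma (m : ℝ) : ContDiffOn ℝ 2 (kerrSigma m) interiorPlane := by
  have hc : ContDiffOn ℝ 2 (fun p : ℝ × ℝ => p.2 / radius p) interiorPlane :=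
    contDiffOn_snd.div contDiffOn_radius fun p hp => (radius_pos hp).ne'
  exact ((contDiffOn_radius.add contDiffOn_const).pow 2).add (contDiffOn_const.mul (hc.pow 2))

lemma contDiffOn_eta0 (hm : 0 < m) : ContDiffOn ℝ 2 (eta0 m) interiorPlane := by
  have hs : ContDiffOn ℝ 2 (fun p : ℝ × ℝ => p.1 / radius p) interiorPlane :=
    contDiffOn_fst.div contDiffOn_radius fun p hp => (radius_pos hp).ne'
  refine ContDiffOn.div (((((contDiffOn_radius.add contDiffOn_const).pow 2).add
    contDiffOn_const).pow 2 |>.sub (contDiffOn_const.mul (contDiffOn_fst.pow 2))).mul (hs.pow 2))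
    (contDiffOn_kerrSigma m) fun p hp => ?_
  exact (polSigma_pos (c := p.2 / radius p) hm (radius_pos hp)).ne'

lemma contDiffOn_omega0 (hm : 0 < m) : ContDiffOn ℝ 2 (omega0 m) interiorPlane := by
  have hs : ContDiffOn ℝ 2 (fun p : ℝ × ℝ => p.1 / radius p) interiorPlane :=
    contDiffOn_fst.div contDiffOn_radius fun p hp => (radius_pos hp).ne'
  have hc : ContDiffOn ℝ 2 (fun p : ℝ × ℝ => p.2 / radius p) interiorPlane :=
    contDiffOn_snd.div contDiffOn_radius fun p hp => (radius_pos hp).ne'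
  refine (contDiffOn_const.mul ((hc.pow 3).sub (contDiffOn_const.mul hc))).sub
    (((contDiffOn_const.mul hc).mul (hs.pow 4)).div (contDiffOn_kerrSigma m) fun p hp => ?_)
  exact (polSigma_pos (c := p.2 / radius p) hm (radius_pos hp)).ne'

end Background

/-! ### The energy controls the right-hand sides of the evolution equations -/

/-- The part of the energy density without time derivatives. -/
def potentialDensity (m : ℝ) (s w : ℝ × ℝ → ℝ) (p : ℝ × ℝ) : ℝ :=
  normSq (grad s p + (w p / eta0 m p ^ 2) • grad (omega0 m) p)
  + normSq (grad (fun y => w y / eta0 m y) p - (s p / eta0 m p) • grad (omega0 m) p)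
  + normSq ((s p / eta0 m p) • grad (omega0 m) p - (w p / eta0 m p ^ 2) • grad (eta0 m) p)

/-- The part of the energy density quadratic in the momenta of the norm and the twist. -/
def kineticDensity (m : ℝ) (P D : ℝ × ℝ → ℝ) (p : ℝ × ℝ) : ℝ :=
  2 * Real.exp (2 * (sigma0 m p + q0 m p)) * P p ^ 2
  + 2 * (Real.exp (2 * (sigma0 m p + q0 m p)) / eta0 m p ^ 2) * D p ^ 2

/-- The square amplitude of the perturbation in the hyperbolic metric, with a Hardy weight. -/
def amplitudeDensity (m : ℝ) (s w : ℝ × ℝ → ℝ) (p : ℝ × ℝ) : ℝ :=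
  (s p ^ 2 + (w p / eta0 m p) ^ 2) / radius p ^ 2

lemma potentialDensity_nonneg (m : ℝ) (s w : ℝ × ℝ → ℝ) (p : ℝ × ℝ) :
    0 ≤ potentialDensity m s w p :=
  add_nonneg (add_nonneg (normSq_nonneg _) (normSq_nonneg _)) (normSq_nonneg _)

lemma kineticDensity_nonneg (m : ℝ) (P D : ℝ × ℝ → ℝ) (p : ℝ × ℝ) :
    0 ≤ kineticDensity m P D p := by
  unfold kineticDensity; positivity

lemma amplitudeDensity_nonneg (m : ℝ) (s w : ℝ × ℝ → ℝ) (p : ℝ × ℝ) :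
    0 ≤ amplitudeDensity m s w p := by
  unfold amplitudeDensity; positivity

/-! ### Algebraic bounds of the source terms -/

lemma sq_mul_add_mul_le (x₀ x₁ y₀ y₁ : ℝ) :
    (x₀ * y₀ + x₁ * y₁) ^ 2 ≤ (x₀ ^ 2 + x₁ ^ 2) * (y₀ ^ 2 + y₁ ^ 2) := by
  nlinarith [sq_nonneg (x₀ * y₁ - x₁ * y₀)]

lemma sq_add_add_le (x y z : ℝ) : (x + y + z) ^ 2 ≤ 3 * (x ^ 2 + y ^ 2 + z ^ 2) := by
  nlinarith [sq_nonneg (x - y), sq_nonneg (y - z), sq_nonneg (x - z)]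

lemma sq_sub_add_sq_sub_le (x₀ x₁ y₀ y₁ : ℝ) :
    (x₀ - y₀) ^ 2 + (x₁ - y₁) ^ 2 ≤ 2 * (x₀ ^ 2 + x₁ ^ 2) + 2 * (y₀ ^ 2 + y₁ ^ 2) := by
  linarith [sq_nonneg (x₀ + y₀), sq_nonneg (x₁ + y₁)]

/-- Here A, B, C, b, s, v are as in the overview, X and V stand for s²/r² and v²/r², and F is the
momentum term. Since ∂w/η₀ = B - C + 2 s b, the equation for s reads l = F + 2 b · (C - B - s b),
and its gradient is A - v b. -/
lemma sigma_source_le {A₀ A₁ B₀ B₁ C₀ C₁ b₀ b₁ s v F l X V k β e T : ℝ}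
    (hb : b₀ ^ 2 + b₁ ^ 2 ≤ β) (hs : s ^ 2 * (b₀ ^ 2 + b₁ ^ 2) ≤ k * X)
    (hv : v ^ 2 * (b₀ ^ 2 + b₁ ^ 2) ≤ k * V) (hF : F ^ 2 ≤ e * T)
    (hl : l = F + 2 * (b₀ * (C₀ - B₀ - s * b₀) + b₁ * (C₁ - B₁ - s * b₁))) :
    (A₀ - v * b₀) ^ 2 + (A₁ - v * b₁) ^ 2 + l ^ 2 ≤
      2 * (A₀ ^ 2 + A₁ ^ 2) + 2 * (k * V) + 2 * (e * T) +
        24 * β * (C₀ ^ 2 + C₁ ^ 2 + (B₀ ^ 2 + B₁ ^ 2) + k * X) := by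
  have h1 : (A₀ - v * b₀) ^ 2 + (A₁ - v * b₁) ^ 2 ≤ 2 * (A₀ ^ 2 + A₁ ^ 2) + 2 * (k * V) := by
    linarith [sq_sub_add_sq_sub_le A₀ A₁ (v * b₀) (v * b₁)]
  have h2 := sq_mul_add_mul_le b₀ b₁ (C₀ - B₀ - s * b₀) (C₁ - B₁ - s * b₁)
  have h3 : (C₀ - B₀ - s * b₀) ^ 2 + (C₁ - B₁ - s * b₁) ^ 2 ≤
      3 * (C₀ ^ 2 + C₁ ^ 2 + (B₀ ^ 2 + B₁ ^ 2) + k * X) := by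
    have := sq_add_add_le C₀ (-B₀) (-(s * b₀))
    have := sq_add_add_le C₁ (-B₁) (-(s * b₁))
    linarith
  have h4 : (b₀ * (C₀ - B₀ - s * b₀) + b₁ * (C₁ - B₁ - s * b₁)) ^ 2 ≤
      β * (3 * (C₀ ^ 2 + C₁ ^ 2 + (B₀ ^ 2 + B₁ ^ 2) + k * X)) :=
    h2.trans (mul_le_mul hb h3 (by positivity) (le_trans (by positivity) hb))
  generalize b₀ * (C₀ - B₀ - s * b₀) + b₁ * (C₁ - B₁ - s * b₁) = Z at *
  have h5 : l ^ 2 ≤ 2 * F ^ 2 + 8 * Z ^ 2 := by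
    rw [hl]; linarith [sq_nonneg (F - 2 * Z)]
  linarith

/-- Here a is ∂η₀/η₀ and i stands for 1/ρ². The gradient of w is η (B - C + 2 s b), and the equation
reads l = F + 2 ∂w · a + 2 η b · ∂s with ∂s = A - v b. -/
lemma omega_source_le {A₀ A₁ B₀ B₁ C₀ C₁ a₀ a₁ b₀ b₁ s v η F l X V k α β e T i c : ℝ}
    (hb : b₀ ^ 2 + b₁ ^ 2 ≤ β) (hs : s ^ 2 * (b₀ ^ 2 + b₁ ^ 2) ≤ k * X)
    (hv : v ^ 2 * (b₀ ^ 2 + b₁ ^ 2) ≤ k * V) (hF : F ^ 2 ≤ η ^ 2 * (e * T))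
    (ha : a₀ ^ 2 + a₁ ^ 2 ≤ α) (hi : i ≤ c * (a₀ ^ 2 + a₁ ^ 2)) (hc : 0 ≤ c)
    (hC₀ : C₀ = s * b₀ - v * a₀) (hC₁ : C₁ = s * b₁ - v * a₁)
    (hl : l = F + 2 * η * (((B₀ - C₀ + 2 * s * b₀) * a₀ + (B₁ - C₁ + 2 * s * b₁) * a₁) +
      (b₀ * (A₀ - v * b₀) + b₁ * (A₁ - v * b₁)))) :
    (η * (B₀ - C₀ + 2 * s * b₀)) ^ 2 + (η * (B₁ - C₁ + 2 * s * b₁)) ^ 2 +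
      64 * ((η * v) ^ 2 * i) + l ^ 2 ≤
      η ^ 2 * ((3 + 36 * α) * (B₀ ^ 2 + B₁ ^ 2 + (C₀ ^ 2 + C₁ ^ 2) + 4 * (k * X)) +
        128 * c * (k * X + (C₀ ^ 2 + C₁ ^ 2)) + 3 * (e * T) +
        24 * β * (A₀ ^ 2 + A₁ ^ 2 + k * V)) := by
  have hη := sq_nonneg η
  have h1 : (B₀ - C₀ + 2 * s * b₀) ^ 2 + (B₁ - C₁ + 2 * s * b₁) ^ 2 ≤
      3 * (B₀ ^ 2 + B₁ ^ 2 + (C₀ ^ 2 + C₁ ^ 2) + 4 * (k * X)) := by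
    have := sq_add_add_le B₀ (-C₀) (2 * s * b₀)
    have := sq_add_add_le B₁ (-C₁) (2 * s * b₁)
    linarith
  -- The weight i is traded for |a|², and v a = s b - C is controlled by the third energy term and
  -- the Hardy term.
  have h2 : v ^ 2 * i ≤ c * (2 * (k * X + (C₀ ^ 2 + C₁ ^ 2))) := by
    have h3 : v ^ 2 * (a₀ ^ 2 + a₁ ^ 2) ≤ 2 * (k * X + (C₀ ^ 2 + C₁ ^ 2)) := by
      have e0 : v * a₀ = s * b₀ - C₀ := by linarith
      have e1 : v * a₁ = s * b₁ - C₁ := by linarith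
      have : v ^ 2 * (a₀ ^ 2 + a₁ ^ 2) = (s * b₀ - C₀) ^ 2 + (s * b₁ - C₁) ^ 2 := by
        rw [← e0, ← e1]; ring
      rw [this]
      linarith [sq_sub_add_sq_sub_le (s * b₀) (s * b₁) C₀ C₁]
    calc v ^ 2 * i ≤ v ^ 2 * (c * (a₀ ^ 2 + a₁ ^ 2)) := by gcongr
      _ = c * (v ^ 2 * (a₀ ^ 2 + a₁ ^ 2)) := by ring
      _ ≤ _ := by gcongr
  have h3 : ((B₀ - C₀ + 2 * s * b₀) * a₀ + (B₁ - C₁ + 2 * s * b₁) * a₁) ^ 2 ≤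
      (3 * (B₀ ^ 2 + B₁ ^ 2 + (C₀ ^ 2 + C₁ ^ 2) + 4 * (k * X))) * α :=
    (sq_mul_add_mul_le _ _ _ _).trans
      (mul_le_mul h1 ha (by positivity) (le_trans (by positivity) h1))
  have h4 : (b₀ * (A₀ - v * b₀) + b₁ * (A₁ - v * b₁)) ^ 2 ≤
      β * (2 * (A₀ ^ 2 + A₁ ^ 2 + k * V)) := by
    refine (sq_mul_add_mul_le _ _ _ _).trans
      (mul_le_mul hb ?_ (by positivity) (le_trans (by positivity) hb))
    linarith [sq_sub_add_sq_sub_le A₀ A₁ (v * b₀) (v * b₁)]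
  rw [mul_pow, mul_pow, mul_pow]
  generalize (B₀ - C₀ + 2 * s * b₀) * a₀ + (B₁ - C₁ + 2 * s * b₁) * a₁ = Y at *
  generalize b₀ * (A₀ - v * b₀) + b₁ * (A₁ - v * b₁) = Z at *
  have h5 : l ^ 2 ≤ 3 * F ^ 2 + η ^ 2 * (12 * Y ^ 2 + 12 * Z ^ 2) := by
    rw [hl]; linarith [sq_add_add_le F (2 * η * Y) (2 * η * Z)]
  have h6 := mul_le_mul_of_nonneg_left h1 hη
  have h7 := mul_le_mul_of_nonneg_left h2 hη
  have h8 := mul_le_mul_of_nonneg_left h3 hη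
  have h9 := mul_le_mul_of_nonneg_left h4 hη
  linarith

/-! ### The evolution equations in terms of the densities -/

section Pointwise

variable {m d R : ℝ} {p : ℝ × ℝ} {s w P D : ℝ × ℝ → ℝ}

lemma hasDerivAt_fst {S : ℝ × ℝ → ℝ} (hS : DifferentiableAt ℝ S p) :
    HasDerivAt (fun t => S (t, p.2)) (dRho S p) p.1 := by
  have hc : DifferentiableAt ℝ (fun t : ℝ => S (t, p.2)) p.1 :=
    DifferentiableAt.comp p.1 (g := S) (f := fun t : ℝ => (t, p.2)) hS (by fun_prop)
  exact hc.hasDerivAt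

lemma hasDerivAt_snd {S : ℝ × ℝ → ℝ} (hS : DifferentiableAt ℝ S p) :
    HasDerivAt (fun t => S (p.1, t)) (dZ S p) p.2 := by
  have hc : DifferentiableAt ℝ (fun t : ℝ => S (p.1, t)) p.2 :=
    DifferentiableAt.comp p.2 (g := S) (f := fun t : ℝ => (p.1, t)) hS (by fun_prop)
  exact hc.hasDerivAt

lemma differentiableAt_eta0 (hm : 0 < m) (hp : 0 < p.1) : DifferentiableAt ℝ (eta0 m) p :=
  differentiableAt_of_interior ((contDiffOn_eta0 hm).of_le (by norm_num)) hp

lemma grad_div_eta0 (hm : 0 < m) (hp : 0 < p.1) (hw : DifferentiableAt ℝ w p) :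
    dRho (fun y => w y / eta0 m y) p =
      dRho w p / eta0 m p - w p / eta0 m p ^ 2 * dRho (eta0 m) p ∧
    dZ (fun y => w y / eta0 m y) p =
      dZ w p / eta0 m p - w p / eta0 m p ^ 2 * dZ (eta0 m) p := by
  have hη := (eta0_pos hm hp).ne'
  have he := differentiableAt_eta0 hm hp
  constructor
  · refine ((hasDerivAt_fst hw).div (hasDerivAt_fst he) hη).deriv.trans ?_
    field_simp
  · refine ((hasDerivAt_snd hw).div (hasDerivAt_snd he) hη).deriv.trans ?_
    field_simp

/-- As σ₀ = log η₀ - 2 log ρ, the term -2/ρ here cancels the singular term 4 ∂_ρ ω₁/ρ in the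
evolution equation of the twist. -/
lemma grad_sigma0 (hm : 0 < m) (hp : 0 < p.1) :
    dRho (sigma0 m) p = dRho (eta0 m) p / eta0 m p - 2 / p.1 ∧
    dZ (sigma0 m) p = dZ (eta0 m) p / eta0 m p := by
  have hη := eta0_pos hm hp
  have he := differentiableAt_eta0 hm hp
  constructor
  · have h := ((hasDerivAt_fst he).div ((hasDerivAt_id p.1).pow 2)
      (by simp; exact hp.ne')).log (by simp; exact ⟨hη.ne', hp.ne'⟩)
    refine h.deriv.trans ?_
    simp
    field_simp
  · have h := ((hasDerivAt_snd he).div_const (p.1 ^ 2)).log (by positivity)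
    refine h.deriv.trans ?_
    field_simp

/-- The bound of `|∂ω₀|² r² / η₀²` on the region `d ≤ r`. -/
def twistConst (m d : ℝ) : ℝ := 16 * m ^ 2 / d ^ 2 + 400 * m ^ 4 / d ^ 4

lemma twistConst_nonneg (m d : ℝ) : 0 ≤ twistConst m d := by unfold twistConst; positivity

lemma twist_le (hm : 0 < m) (hd : 0 < d) (hp : 0 < p.1) (hdp : d ≤ radius p) :
    (dRho (omega0 m) p / eta0 m p) ^ 2 + (dZ (omega0 m) p / eta0 m p) ^ 2 ≤
      twistConst m d / radius p ^ 2 := by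
  have h := normSq_grad_omega0_le hm hd hp hdp
  have hη := eta0_pos hm hp
  have hr := radius_pos hp
  simp only [normSq, grad, dotProduct, Fin.sum_univ_two, Matrix.cons_val_zero,
    Matrix.cons_val_one] at h
  have e : (dRho (omega0 m) p / eta0 m p) ^ 2 + (dZ (omega0 m) p / eta0 m p) ^ 2 =
      (dRho (omega0 m) p * dRho (omega0 m) p + dZ (omega0 m) p * dZ (omega0 m) p) /
        eta0 m p ^ 2 := by ring
  rw [e, div_le_iff₀ (by positivity)]
  refine h.trans (le_of_eq ?_)
  unfold twistConst
  ring

/-- The constant in the bound of the sources of the norm. -/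
def sigmaConst (m d : ℝ) : ℝ :=
  66 + 2 * twistConst m d + 8 * (1 + m / d) ^ 4 +
    24 * (twistConst m d / d ^ 2) * (1 + twistConst m d)

/-- The equation for the norm is read as a formula for its Laplacian. The region d ≤ r gives bounded
coefficients even at the axis, so that no lower bound on ρ is needed. -/
lemma sigma_pointwise_le (hm : 0 < m) (hd : 0 < d) (hp : 0 < p.1) (hdp : d ≤ radius p)
    (hR : 0 < R) (hpR : radius p < 2 * R) (hw : DifferentiableAt ℝ w p)
    (heq : -Real.exp (2 * (sigma0 m p + q0 m p)) * P p + lap3 s p = 2 / eta0 m p ^ 2 *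
      (s p * normSq (grad (omega0 m) p) - grad w p ⬝ᵥ grad (omega0 m) p)) :
    normSq (grad s p) + s p ^ 2 / (R / 4) ^ 2 + lap3 s p ^ 2 ≤ sigmaConst m d *
      (potentialDensity m s w p + amplitudeDensity m s w p + kineticDensity m P D p) := by
  have hη := eta0_pos hm hp
  have hr := radius_pos hp
  have hb := twist_le hm hd hp hdp
  have hb2 : twistConst m d / radius p ^ 2 ≤ twistConst m d / d ^ 2 := by
    have := twistConst_nonneg m d
    gcongr
  have hE := exp_sigma0_q0_le hm hd hp hdp
  have hE0 := Real.exp_pos (2 * (sigma0 m p + q0 m p))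
  obtain ⟨gr, gz⟩ := grad_div_eta0 hm hp hw
  have hK := kineticDensity_nonneg m P D p
  have hF : (Real.exp (2 * (sigma0 m p + q0 m p)) * P p) ^ 2 ≤
      4 * (1 + m / d) ^ 4 * kineticDensity m P D p := by
    have h1 : 2 * (Real.exp (2 * (sigma0 m p + q0 m p)) * P p ^ 2) ≤ kineticDensity m P D p := by
      have : 0 ≤ 2 * (Real.exp (2 * (sigma0 m p + q0 m p)) / eta0 m p ^ 2) * D p ^ 2 := by
        positivity
      unfold kineticDensity
      linarith
    calc _ = Real.exp (2 * (sigma0 m p + q0 m p)) *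
          (Real.exp (2 * (sigma0 m p + q0 m p)) * P p ^ 2) := by ring
      _ ≤ 8 * (1 + m / d) ^ 4 * (kineticDensity m P D p / 2) := by gcongr; linarith
      _ = _ := by ring
  have hs : s p ^ 2 * ((dRho (omega0 m) p / eta0 m p) ^ 2 + (dZ (omega0 m) p / eta0 m p) ^ 2) ≤
      twistConst m d * (s p ^ 2 / radius p ^ 2) :=
    (mul_le_mul_of_nonneg_left hb (sq_nonneg _)).trans (le_of_eq (by ring))
  have hv : (w p / eta0 m p) ^ 2 *
      ((dRho (omega0 m) p / eta0 m p) ^ 2 + (dZ (omega0 m) p / eta0 m p) ^ 2) ≤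
      twistConst m d * ((w p / eta0 m p) ^ 2 / radius p ^ 2) :=
    (mul_le_mul_of_nonneg_left hb (sq_nonneg _)).trans (le_of_eq (by ring))
  -- The factor 64 is 4² · 2², from the radius R/4 of the ball and r < 2R on the shell.
  have hRR : s p ^ 2 / (R / 4) ^ 2 ≤ 64 * (s p ^ 2 / radius p ^ 2) := by
    rw [div_le_iff₀ (by positivity), mul_assoc, div_mul_eq_mul_div, ← mul_div_assoc,
      le_div_iff₀ (by positivity)]
    have : radius p ^ 2 ≤ (2 * R) ^ 2 := by gcongr
    nlinarith [mul_le_mul_of_nonneg_left this (sq_nonneg (s p))]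
  have key := sigma_source_le
    (A₀ := dRho s p + w p / eta0 m p ^ 2 * dRho (omega0 m) p)
    (A₁ := dZ s p + w p / eta0 m p ^ 2 * dZ (omega0 m) p)
    (B₀ := dRho w p / eta0 m p - w p / eta0 m p ^ 2 * dRho (eta0 m) p
      - s p / eta0 m p * dRho (omega0 m) p)
    (B₁ := dZ w p / eta0 m p - w p / eta0 m p ^ 2 * dZ (eta0 m) p
      - s p / eta0 m p * dZ (omega0 m) p)
    (C₀ := s p / eta0 m p * dRho (omega0 m) p - w p / eta0 m p ^ 2 * dRho (eta0 m) p)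
    (C₁ := s p / eta0 m p * dZ (omega0 m) p - w p / eta0 m p ^ 2 * dZ (eta0 m) p)
    (l := lap3 s p) (hb.trans hb2) hs hv hF (by
      simp only [normSq, grad, dotProduct, Fin.sum_univ_two, Matrix.cons_val_zero,
        Matrix.cons_val_one] at heq
      have : lap3 s p = Real.exp (2 * (sigma0 m p + q0 m p)) * P p + 2 / eta0 m p ^ 2 *
        (s p * (dRho (omega0 m) p * dRho (omega0 m) p + dZ (omega0 m) p * dZ (omega0 m) p) -
          (dRho w p * dRho (omega0 m) p + dZ w p * dZ (omega0 m) p)) := by linarith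
      rw [this]
      field_simp
      ring)
  have hpot : potentialDensity m s w p =
      (dRho s p + w p / eta0 m p ^ 2 * dRho (omega0 m) p) ^ 2 +
      (dZ s p + w p / eta0 m p ^ 2 * dZ (omega0 m) p) ^ 2 +
      ((dRho w p / eta0 m p - w p / eta0 m p ^ 2 * dRho (eta0 m) p
        - s p / eta0 m p * dRho (omega0 m) p) ^ 2 +
      (dZ w p / eta0 m p - w p / eta0 m p ^ 2 * dZ (eta0 m) p
        - s p / eta0 m p * dZ (omega0 m) p) ^ 2) +
      ((s p / eta0 m p * dRho (omega0 m) p - w p / eta0 m p ^ 2 * dRho (eta0 m) p) ^ 2 +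
      (s p / eta0 m p * dZ (omega0 m) p - w p / eta0 m p ^ 2 * dZ (eta0 m) p) ^ 2) := by
    simp only [potentialDensity, normSq, grad, dotProduct, Fin.sum_univ_two, Pi.add_apply,
      Pi.sub_apply, Pi.smul_apply, smul_eq_mul, Matrix.cons_val_zero, Matrix.cons_val_one, gr, gz]
    ring
  have hamp : amplitudeDensity m s w p =
      s p ^ 2 / radius p ^ 2 + (w p / eta0 m p) ^ 2 / radius p ^ 2 := by
    unfold amplitudeDensity; ring
  have hgs : normSq (grad s p) =
      (dRho s p + w p / eta0 m p ^ 2 * dRho (omega0 m) p -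
        w p / eta0 m p * (dRho (omega0 m) p / eta0 m p)) ^ 2 +
      (dZ s p + w p / eta0 m p ^ 2 * dZ (omega0 m) p -
        w p / eta0 m p * (dZ (omega0 m) p / eta0 m p)) ^ 2 := by
    simp only [normSq, grad, dotProduct, Fin.sum_univ_two, Matrix.cons_val_zero,
      Matrix.cons_val_one]
    ring
  rw [hpot, hamp, hgs]
  have hX : 0 ≤ s p ^ 2 / radius p ^ 2 := by positivity
  have hV : 0 ≤ (w p / eta0 m p) ^ 2 / radius p ^ 2 := by positivity
  have hk := twistConst_nonneg m d
  have hβ : 0 ≤ twistConst m d / d ^ 2 := by positivity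
  have he : 0 ≤ (1 + m / d) ^ 4 := by positivity
  unfold sigmaConst
  generalize s p ^ 2 / radius p ^ 2 = X at *
  generalize (w p / eta0 m p) ^ 2 / radius p ^ 2 = V at *
  generalize twistConst m d / d ^ 2 = β at *
  generalize twistConst m d = k at *
  generalize (1 + m / d) ^ 4 = e at *
  generalize kineticDensity m P D p = T at *
  have hA := add_nonneg (sq_nonneg (dRho s p + w p / eta0 m p ^ 2 * dRho (omega0 m) p))
    (sq_nonneg (dZ s p + w p / eta0 m p ^ 2 * dZ (omega0 m) p))
  have hB := add_nonneg (sq_nonneg (dRho w p / eta0 m p - w p / eta0 m p ^ 2 * dRho (eta0 m) p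
        - s p / eta0 m p * dRho (omega0 m) p))
      (sq_nonneg (dZ w p / eta0 m p - w p / eta0 m p ^ 2 * dZ (eta0 m) p
        - s p / eta0 m p * dZ (omega0 m) p))
  have hC := add_nonneg
    (sq_nonneg (s p / eta0 m p * dRho (omega0 m) p - w p / eta0 m p ^ 2 * dRho (eta0 m) p))
    (sq_nonneg (s p / eta0 m p * dZ (omega0 m) p - w p / eta0 m p ^ 2 * dZ (eta0 m) p))
  generalize (dRho s p + w p / eta0 m p ^ 2 * dRho (omega0 m) p) ^ 2 +
      (dZ s p + w p / eta0 m p ^ 2 * dZ (omega0 m) p) ^ 2 = A at *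
  generalize (dRho w p / eta0 m p - w p / eta0 m p ^ 2 * dRho (eta0 m) p
        - s p / eta0 m p * dRho (omega0 m) p) ^ 2 +
      (dZ w p / eta0 m p - w p / eta0 m p ^ 2 * dZ (eta0 m) p
        - s p / eta0 m p * dZ (omega0 m) p) ^ 2 = B at *
  generalize (s p / eta0 m p * dRho (omega0 m) p - w p / eta0 m p ^ 2 * dRho (eta0 m) p) ^ 2 +
      (s p / eta0 m p * dZ (omega0 m) p - w p / eta0 m p ^ 2 * dZ (eta0 m) p) ^ 2 = C at *
  have f1 : 24 * β * (C + B + k * X) ≤ 24 * β * (1 + k) * (A + B + C + (X + V) + T) := by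
    rw [mul_assoc (24 * β)]
    gcongr
    linarith [mul_nonneg hk hA, mul_nonneg hk hB, mul_nonneg hk hC, mul_nonneg hk hV,
      mul_nonneg hk hK]
  have f2 : 2 * (k * V) ≤ 2 * k * (A + B + C + (X + V) + T) := by
    rw [← mul_assoc]; gcongr; linarith
  have f3 : 2 * (4 * e * T) ≤ 8 * e * (A + B + C + (X + V) + T) := by
    rw [show 2 * (4 * e * T) = 8 * e * T by ring]; gcongr; linarith
  linarith

/-- The constant in the bound of the sources of the twist. -/
def omegaConst (m d : ℝ) : ℝ :=
  (3 + 36 * (260 / d ^ 2)) * (1 + 4 * twistConst m d) +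
    512 * (1 + m / d) ^ 4 * (1 + twistConst m d) + 12 * (1 + m / d) ^ 4 +
    24 * (twistConst m d / d ^ 2) * (1 + twistConst m d)

/-- Now R is a scale for ρ rather than r: the zeroth-order term becomes w²/ρ², and d ≤ ρ bounds a =
∂η₀/η₀. The factor η₀² remains outside because the equation is for w = η₀ v. -/
lemma omega_pointwise_le (hm : 0 < m) (hd : 0 < d) (hp : 0 < p.1) (hdp : d ≤ p.1)
    (hR : 0 < R) (hpR : p.1 < 2 * R) (hw : DifferentiableAt ℝ w p)
    (heq : -Real.exp (2 * (sigma0 m p + q0 m p)) * D p + lap3 w p =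
      4 * (dRho w p / p.1) + 2 * (grad w p ⬝ᵥ grad (sigma0 m) p)
        + 2 * (grad (omega0 m) p ⬝ᵥ grad s p)) :
    normSq (grad w p) + w p ^ 2 / (R / 4) ^ 2 + lap3 w p ^ 2 ≤ eta0 m p ^ 2 * (omegaConst m d *
      (potentialDensity m s w p + amplitudeDensity m s w p + kineticDensity m P D p)) := by
  have hη := eta0_pos hm hp
  have hr := radius_pos hp
  have hdr : d ≤ radius p := hdp.trans (le_radius p)
  have hb := twist_le hm hd hp hdr
  have hb2 : twistConst m d / radius p ^ 2 ≤ twistConst m d / d ^ 2 := by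
    have := twistConst_nonneg m d
    gcongr
  have hE := exp_sigma0_q0_le hm hd hp hdr
  have hE0 := Real.exp_pos (2 * (sigma0 m p + q0 m p))
  obtain ⟨gr, gz⟩ := grad_div_eta0 hm hp hw
  have hK := kineticDensity_nonneg m P D p
  have hF : (Real.exp (2 * (sigma0 m p + q0 m p)) * D p) ^ 2 ≤
      eta0 m p ^ 2 * (4 * (1 + m / d) ^ 4 * kineticDensity m P D p) := by
    have h1 : 2 * (Real.exp (2 * (sigma0 m p + q0 m p)) / eta0 m p ^ 2 * D p ^ 2) ≤
        kineticDensity m P D p := by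
      have : 0 ≤ 2 * Real.exp (2 * (sigma0 m p + q0 m p)) * P p ^ 2 := by
        positivity
      unfold kineticDensity
      linarith
    calc _ = eta0 m p ^ 2 * (Real.exp (2 * (sigma0 m p + q0 m p)) *
          (Real.exp (2 * (sigma0 m p + q0 m p)) / eta0 m p ^ 2 * D p ^ 2)) := by field_simp
      _ ≤ eta0 m p ^ 2 * (8 * (1 + m / d) ^ 4 * (kineticDensity m P D p / 2)) := by
          gcongr; linarith
      _ = _ := by ring
  have hs : s p ^ 2 * ((dRho (omega0 m) p / eta0 m p) ^ 2 + (dZ (omega0 m) p / eta0 m p) ^ 2) ≤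
      twistConst m d * (s p ^ 2 / radius p ^ 2) :=
    (mul_le_mul_of_nonneg_left hb (sq_nonneg _)).trans (le_of_eq (by ring))
  have hv : (w p / eta0 m p) ^ 2 *
      ((dRho (omega0 m) p / eta0 m p) ^ 2 + (dZ (omega0 m) p / eta0 m p) ^ 2) ≤
      twistConst m d * ((w p / eta0 m p) ^ 2 / radius p ^ 2) :=
    (mul_le_mul_of_nonneg_left hb (sq_nonneg _)).trans (le_of_eq (by ring))
  have hRR : w p ^ 2 / (R / 4) ^ 2 ≤ 64 * ((eta0 m p * (w p / eta0 m p)) ^ 2 * (1 / p.1 ^ 2)) := by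
    rw [mul_div_cancel₀ _ hη.ne', mul_one_div, div_le_iff₀ (by positivity), mul_assoc,
      div_mul_eq_mul_div, ← mul_div_assoc, le_div_iff₀ (by positivity)]
    have : p.1 ^ 2 ≤ (2 * R) ^ 2 := by gcongr
    nlinarith [mul_le_mul_of_nonneg_left this (sq_nonneg (w p))]
  have hge : (dRho (eta0 m) p / eta0 m p) ^ 2 + (dZ (eta0 m) p / eta0 m p) ^ 2 =
      normSq (grad (eta0 m) p) / eta0 m p ^ 2 := by
    simp only [normSq, grad, dotProduct, Fin.sum_univ_two, Matrix.cons_val_zero,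
      Matrix.cons_val_one]
    ring
  have ha : (dRho (eta0 m) p / eta0 m p) ^ 2 + (dZ (eta0 m) p / eta0 m p) ^ 2 ≤ 260 / d ^ 2 := by
    rw [hge, div_le_iff₀ (by positivity)]
    refine (normSq_grad_eta0_le hm hp).trans ?_
    calc 260 * (eta0 m p ^ 2 / p.1 ^ 2) = 260 / p.1 ^ 2 * eta0 m p ^ 2 := by ring
      _ ≤ _ := by gcongr
  have hi : 1 / p.1 ^ 2 ≤ 4 * (1 + m / d) ^ 4 *
      ((dRho (eta0 m) p / eta0 m p) ^ 2 + (dZ (eta0 m) p / eta0 m p) ^ 2) := by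
    rw [hge, ← mul_div_assoc, le_div_iff₀ (by positivity)]
    exact le_trans (le_of_eq (by ring)) (le_normSq_grad_eta0 hm hd hp hdr)
  obtain ⟨sr, sz⟩ := grad_sigma0 hm hp
  have key := omega_source_le
    (A₀ := dRho s p + w p / eta0 m p ^ 2 * dRho (omega0 m) p)
    (A₁ := dZ s p + w p / eta0 m p ^ 2 * dZ (omega0 m) p)
    (B₀ := dRho w p / eta0 m p - w p / eta0 m p ^ 2 * dRho (eta0 m) p
      - s p / eta0 m p * dRho (omega0 m) p)
    (B₁ := dZ w p / eta0 m p - w p / eta0 m p ^ 2 * dZ (eta0 m) p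
      - s p / eta0 m p * dZ (omega0 m) p)
    (C₀ := s p / eta0 m p * dRho (omega0 m) p - w p / eta0 m p ^ 2 * dRho (eta0 m) p)
    (C₁ := s p / eta0 m p * dZ (omega0 m) p - w p / eta0 m p ^ 2 * dZ (eta0 m) p)
    (l := lap3 w p) (hb.trans hb2) hs hv hF ha hi (by positivity) (by ring) (by ring) (by
      simp only [grad, dotProduct, Fin.sum_univ_two, Matrix.cons_val_zero,
        Matrix.cons_val_one, sr, sz] at heq
      have : lap3 w p = Real.exp (2 * (sigma0 m p + q0 m p)) * D p + (4 * (dRho w p / p.1) +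
        2 * (dRho w p * (dRho (eta0 m) p / eta0 m p - 2 / p.1) +
          dZ w p * (dZ (eta0 m) p / eta0 m p)) +
        2 * (dRho (omega0 m) p * dRho s p + dZ (omega0 m) p * dZ s p)) := by linarith
      rw [this]
      field_simp
      ring)
  have hpot : potentialDensity m s w p =
      (dRho s p + w p / eta0 m p ^ 2 * dRho (omega0 m) p) ^ 2 +
      (dZ s p + w p / eta0 m p ^ 2 * dZ (omega0 m) p) ^ 2 +
      ((dRho w p / eta0 m p - w p / eta0 m p ^ 2 * dRho (eta0 m) p
        - s p / eta0 m p * dRho (omega0 m) p) ^ 2 +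
      (dZ w p / eta0 m p - w p / eta0 m p ^ 2 * dZ (eta0 m) p
        - s p / eta0 m p * dZ (omega0 m) p) ^ 2) +
      ((s p / eta0 m p * dRho (omega0 m) p - w p / eta0 m p ^ 2 * dRho (eta0 m) p) ^ 2 +
      (s p / eta0 m p * dZ (omega0 m) p - w p / eta0 m p ^ 2 * dZ (eta0 m) p) ^ 2) := by
    simp only [potentialDensity, normSq, grad, dotProduct, Fin.sum_univ_two, Pi.add_apply,
      Pi.sub_apply, Pi.smul_apply, smul_eq_mul, Matrix.cons_val_zero, Matrix.cons_val_one, gr, gz]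
    ring
  have hamp : amplitudeDensity m s w p =
      s p ^ 2 / radius p ^ 2 + (w p / eta0 m p) ^ 2 / radius p ^ 2 := by
    unfold amplitudeDensity; ring
  -- This is the identity η₀ (B - C + 2 s b) = ∂w, with y and z the components of v a and s b.
  have hgw : ∀ x y z : ℝ, eta0 m p * (x / eta0 m p - y - z -
      (z - y) + 2 * z) = x := by
    intro x y z
    field_simp
    ring
  have hgs : normSq (grad w p) = dRho w p ^ 2 + dZ w p ^ 2 := by
    simp only [normSq, grad, dotProduct, Fin.sum_univ_two, Matrix.cons_val_zero,
      Matrix.cons_val_one]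
    ring
  have e0 : 2 * s p * (dRho (omega0 m) p / eta0 m p) =
    2 * (s p / eta0 m p * dRho (omega0 m) p) := by ring
  have e1 : 2 * s p * (dZ (omega0 m) p / eta0 m p) =
    2 * (s p / eta0 m p * dZ (omega0 m) p) := by ring
  rw [e0, e1, hgw, hgw] at key
  rw [hpot, hamp, hgs]
  have hX : 0 ≤ s p ^ 2 / radius p ^ 2 := by positivity
  have hV : 0 ≤ (w p / eta0 m p) ^ 2 / radius p ^ 2 := by positivity
  have hk := twistConst_nonneg m d
  have hβ : 0 ≤ twistConst m d / d ^ 2 := by positivity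
  have hα : 0 ≤ 260 / d ^ 2 := by positivity
  have he : 0 ≤ (1 + m / d) ^ 4 := by positivity
  refine le_trans (by linarith) (key.trans (mul_le_mul_of_nonneg_left ?_ (sq_nonneg _)))
  unfold omegaConst
  clear key hpot hamp hgs hgw hRR hi ha hge
  have hA := add_nonneg (sq_nonneg (dRho s p + w p / eta0 m p ^ 2 * dRho (omega0 m) p))
    (sq_nonneg (dZ s p + w p / eta0 m p ^ 2 * dZ (omega0 m) p))
  have hB := add_nonneg (sq_nonneg (dRho w p / eta0 m p - w p / eta0 m p ^ 2 * dRho (eta0 m) p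
        - s p / eta0 m p * dRho (omega0 m) p))
      (sq_nonneg (dZ w p / eta0 m p - w p / eta0 m p ^ 2 * dZ (eta0 m) p
        - s p / eta0 m p * dZ (omega0 m) p))
  have hC := add_nonneg
    (sq_nonneg (s p / eta0 m p * dRho (omega0 m) p - w p / eta0 m p ^ 2 * dRho (eta0 m) p))
    (sq_nonneg (s p / eta0 m p * dZ (omega0 m) p - w p / eta0 m p ^ 2 * dZ (eta0 m) p))
  generalize s p ^ 2 / radius p ^ 2 = X at *
  generalize (w p / eta0 m p) ^ 2 / radius p ^ 2 = V at *
  generalize twistConst m d / d ^ 2 = β at *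
  generalize twistConst m d = k at *
  generalize (1 + m / d) ^ 4 = e at *
  generalize 260 / d ^ 2 = α at *
  generalize kineticDensity m P D p = T at *
  generalize (dRho s p + w p / eta0 m p ^ 2 * dRho (omega0 m) p) ^ 2 +
      (dZ s p + w p / eta0 m p ^ 2 * dZ (omega0 m) p) ^ 2 = A at *
  generalize (dRho w p / eta0 m p - w p / eta0 m p ^ 2 * dRho (eta0 m) p
        - s p / eta0 m p * dRho (omega0 m) p) ^ 2 +
      (dZ w p / eta0 m p - w p / eta0 m p ^ 2 * dZ (eta0 m) p
        - s p / eta0 m p * dZ (omega0 m) p) ^ 2 = B at *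
  generalize (s p / eta0 m p * dRho (omega0 m) p - w p / eta0 m p ^ 2 * dRho (eta0 m) p) ^ 2 +
      (s p / eta0 m p * dZ (omega0 m) p - w p / eta0 m p ^ 2 * dZ (eta0 m) p) ^ 2 = C at *
  have hkX := mul_nonneg hk hX
  have hkS : ∀ Z, 0 ≤ Z → 0 ≤ k * Z := fun Z hZ => mul_nonneg hk hZ
  have f1 : (3 + 36 * α) * (B + C + 4 * (k * X)) ≤
      (3 + 36 * α) * (1 + 4 * k) * (A + B + C + (X + V) + T) := by
    rw [mul_assoc (3 + 36 * α)]
    gcongr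
    linarith [hkS A hA, hkS B hB, hkS C hC, hkS V hV, hkS T hK]
  have f2 : 128 * (4 * e) * (k * X + C) ≤ 512 * e * (1 + k) * (A + B + C + (X + V) + T) := by
    rw [mul_assoc (512 * e), show 128 * (4 * e) = 512 * e by ring]
    gcongr
    linarith [hkS A hA, hkS B hB, hkS C hC, hkS V hV, hkS T hK]
  have f3 : 3 * (4 * e * T) ≤ 12 * e * (A + B + C + (X + V) + T) := by
    rw [show 3 * (4 * e * T) = 12 * e * T by ring]; gcongr; linarith
  have f4 : 24 * β * (A + k * V) ≤ 24 * β * (1 + k) * (A + B + C + (X + V) + T) := by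
    rw [mul_assoc (24 * β)]
    gcongr
    linarith [hkS A hA, hkS B hB, hkS C hC, hkS X hX, hkS T hK]
  linarith

end Pointwise

/-! ### The energies -/

lemma potentialDensity_le_energyDensity (m : ℝ) (p d : ℝ × ℝ → ℝ)
    (χ : Fin 2 → Fin 2 → ℝ × ℝ → ℝ) (s w : ℝ × ℝ → ℝ) (x : ℝ × ℝ) :
    potentialDensity m s w x ≤ energyDensity m p d χ s w x := by
  have h1 := kineticDensity_nonneg m p d x
  have h2 : 0 ≤ 4 * Real.exp (-2 * u0 m x) * ∑ A, ∑ B, χ A B x ^ 2 :=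
    mul_nonneg (by positivity) (Finset.sum_nonneg fun A _ => Finset.sum_nonneg fun B _ =>
      sq_nonneg _)
  unfold kineticDensity at h1
  unfold potentialDensity energyDensity
  linarith

lemma kineticDensity_le_energyDensity (m : ℝ) (p d : ℝ × ℝ → ℝ)
    (χ : Fin 2 → Fin 2 → ℝ × ℝ → ℝ) (s w : ℝ × ℝ → ℝ) (x : ℝ × ℝ) :
    kineticDensity m p d x ≤ energyDensity m p d χ s w x := by
  have h1 := potentialDensity_nonneg m s w x
  have h2 : 0 ≤ 4 * Real.exp (-2 * u0 m x) * ∑ A, ∑ B, χ A B x ^ 2 :=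
    mul_nonneg (by positivity) (Finset.sum_nonneg fun A _ => Finset.sum_nonneg fun B _ =>
      sq_nonneg _)
  unfold potentialDensity at h1
  unfold kineticDensity energyDensity
  linarith

lemma lintegral_le_energy {f : ℝ × ℝ → ℝ} {m : ℝ} {p d : ℝ × ℝ → ℝ}
    {χ : Fin 2 → Fin 2 → ℝ × ℝ → ℝ} {s w : ℝ × ℝ → ℝ}
    (h : ∀ x, f x ≤ energyDensity m p d χ s w x) :
    ∫⁻ x in interiorPlane, ENNReal.ofReal (f x * x.1) ≤ 16 * energy m p d χ s w := by
  have hsub : interiorPlane ⊆ halfPlane := fun x hx =>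
    show 0 ≤ x.1 from le_of_lt (show 0 < x.1 from hx)
  unfold energy
  rw [← mul_assoc, one_div, ENNReal.mul_inv_cancel (by norm_num) (by norm_num), one_mul]
  refine le_trans ?_ (lintegral_mono_set hsub)
  refine setLIntegral_mono' isOpen_interiorPlane.measurableSet fun x hx => ?_
  exact ENNReal.ofReal_le_ofReal (mul_le_mul_of_nonneg_right (h x) (le_of_lt hx))

section Shell

variable {m : ℝ} {s w P D : ℝ × ℝ → ℝ}

lemma continuousOn_normSq {u : ℝ × ℝ → Fin 2 → ℝ} (hu : ContinuousOn u interiorPlane) :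
    ContinuousOn (fun p => normSq (u p)) interiorPlane := by
  have : Continuous normSq := by
    unfold normSq dotProduct
    fun_prop
  exact this.comp_continuousOn hu

lemma continuousOn_grad {S : ℝ × ℝ → ℝ} (hS : ContDiffOn ℝ 1 S interiorPlane) :
    ContinuousOn (grad S) interiorPlane := by
  refine continuousOn_pi.2 fun i => ?_
  fin_cases i
  · exact continuousOn_dRho_of_contDiffOn hS
  · exact continuousOn_dZ_of_contDiffOn hS

lemma contDiffOn_div_eta0 (hm : 0 < m) (hw : ContDiffOn ℝ 1 w interiorPlane) :
    ContDiffOn ℝ 1 (fun p => w p / eta0 m p) interiorPlane :=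
  hw.div ((contDiffOn_eta0 hm).of_le (by norm_num)) fun _ hp => (eta0_pos hm hp).ne'

lemma continuousOn_covariant_terms (hm : 0 < m) (hs : ContDiffOn ℝ 1 s interiorPlane)
    (hw : ContDiffOn ℝ 1 w interiorPlane) :
    ContinuousOn (fun p => grad s p + (w p / eta0 m p ^ 2) • grad (omega0 m) p) interiorPlane ∧
    ContinuousOn (fun p => grad (fun y => w y / eta0 m y) p -
      (s p / eta0 m p) • grad (omega0 m) p) interiorPlane ∧
    ContinuousOn (fun p => (s p / eta0 m p) • grad (omega0 m) p -
      (w p / eta0 m p ^ 2) • grad (eta0 m) p) interiorPlane := by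
  have ho := continuousOn_grad ((contDiffOn_omega0 hm).of_le (by norm_num : (1 : ℕ∞ω) ≤ 2))
  have he := continuousOn_grad ((contDiffOn_eta0 hm).of_le (by norm_num : (1 : ℕ∞ω) ≤ 2))
  have h1 : ContinuousOn (fun p => s p / eta0 m p) interiorPlane :=
    hs.continuousOn.div (contDiffOn_eta0 hm).continuousOn fun _ hp => (eta0_pos hm hp).ne'
  have h2 : ContinuousOn (fun p => w p / eta0 m p ^ 2) interiorPlane :=
    hw.continuousOn.div ((contDiffOn_eta0 hm).continuousOn.pow 2) fun _ hp =>
      (pow_pos (eta0_pos hm hp) 2).ne'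
  exact ⟨(continuousOn_grad hs).add (h2.smul ho),
    (continuousOn_grad (contDiffOn_div_eta0 hm hw)).sub (h1.smul ho),
    (h1.smul ho).sub (h2.smul he)⟩

lemma continuousOn_potentialDensity (hm : 0 < m) (hs : ContDiffOn ℝ 1 s interiorPlane)
    (hw : ContDiffOn ℝ 1 w interiorPlane) :
    ContinuousOn (potentialDensity m s w) interiorPlane := by
  obtain ⟨h1, h2, h3⟩ := continuousOn_covariant_terms hm hs hw
  exact ((continuousOn_normSq h1).add (continuousOn_normSq h2)).add (continuousOn_normSq h3)

/-- The Hardy bound is applied with the connection b = ∂ω₀/η₀; the first two terms of the potential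
density are exactly the covariant derivative of (s, w/η₀). -/
lemma lintegral_shell_amplitude_le (hm : 0 < m) (hs : ContDiffOn ℝ 1 s interiorPlane)
    (hw : ContDiffOn ℝ 1 w interiorPlane)
    (hlim : ∀ θ, 0 < Real.cos θ →
      Tendsto (fun r => s (rayPoint θ r) ^ 2 + (w (rayPoint θ r) / eta0 m (rayPoint θ r)) ^ 2)
        atTop (𝓝 0)) {R : ℝ} (hR : 0 < R) :
    ∫⁻ p in shell R, ENNReal.ofReal (amplitudeDensity m s w p * p.1) ≤
      3 * ∫⁻ p in interiorPlane, ENNReal.ofReal (potentialDensity m s w p * p.1) := by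
  obtain ⟨h1, h2, -⟩ := continuousOn_covariant_terms hm hs hw
  have e1 : ∀ p, (w p / eta0 m p) • ((eta0 m p)⁻¹ • grad (omega0 m) p) =
      (w p / eta0 m p ^ 2) • grad (omega0 m) p := fun p => by
    rw [smul_smul]; congr 1; ring
  have e2 : ∀ p, s p • ((eta0 m p)⁻¹ • grad (omega0 m) p) =
      (s p / eta0 m p) • grad (omega0 m) p := fun p => by
    rw [smul_smul]; rfl
  have h := lintegral_shell_sq_le (s := s) (v := fun p => w p / eta0 m p)
    (b := fun p => (eta0 m p)⁻¹ • grad (omega0 m) p) hs (contDiffOn_div_eta0 hm hw) (by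
      simp only [e1, e2]
      exact (continuousOn_normSq h1).add (continuousOn_normSq h2)) hlim hR
  refine h.trans ?_
  gcongr 3 * ?_
  refine setLIntegral_mono' isOpen_interiorPlane.measurableSet fun p hp => ?_
  refine ENNReal.ofReal_le_ofReal (mul_le_mul_of_nonneg_right ?_ (le_of_lt hp))
  simp only [e1, e2]
  exact le_add_of_nonneg_right (normSq_nonneg _)

/-- A quantity bounded by the densities is integrable over a shell, uniformly in the shell. -/
lemma lintegral_shell_total_le (hm : 0 < m) (hs : ContDiffOn ℝ 1 s interiorPlane)
    (hw : ContDiffOn ℝ 1 w interiorPlane)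
    (hlim : ∀ θ, 0 < Real.cos θ →
      Tendsto (fun r => s (rayPoint θ r) ^ 2 + (w (rayPoint θ r) / eta0 m (rayPoint θ r)) ^ 2)
        atTop (𝓝 0)) {R K : ℝ} (hR : 0 < R) (hK : 0 ≤ K) {W : Set (ℝ × ℝ)}
    (hW : MeasurableSet W) (hWs : W ⊆ shell R) {f : ℝ × ℝ → ℝ}
    (hf : ∀ p ∈ W, f p ≤ K *
      (potentialDensity m s w p + amplitudeDensity m s w p + kineticDensity m P D p)) :
    ∫⁻ p in W, ENNReal.ofReal (f p * p.1) ≤ ENNReal.ofReal K *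
      (4 * (∫⁻ p in interiorPlane, ENNReal.ofReal (potentialDensity m s w p * p.1)) +
        ∫⁻ p in interiorPlane, ENNReal.ofReal (kineticDensity m P D p * p.1)) := by
  have hsub : W ⊆ interiorPlane := hWs.trans (shell_subset R)
  have m1 : AEMeasurable (fun p : ℝ × ℝ => ENNReal.ofReal (potentialDensity m s w p * p.1))
      (volume.restrict W) :=
    (((continuousOn_potentialDensity hm hs hw).mul continuousOn_fst).mono
      hsub |>.aemeasurable hW).ennreal_ofReal
  have m2 : AEMeasurable (fun p : ℝ × ℝ => ENNReal.ofReal (amplitudeDensity m s w p * p.1))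
      (volume.restrict W) := by
    have : ContinuousOn (amplitudeDensity m s w) interiorPlane :=
      ((hs.continuousOn.pow 2).add ((contDiffOn_div_eta0 hm hw).continuousOn.pow 2)).div
        (continuous_radius.pow 2).continuousOn fun p hp => pow_ne_zero 2 (radius_pos hp).ne'
    exact ((this.mul continuousOn_fst).mono hsub |>.aemeasurable hW).ennreal_ofReal
  calc _ ≤ ∫⁻ p in W, ENNReal.ofReal K * (ENNReal.ofReal (potentialDensity m s w p * p.1) +
        (ENNReal.ofReal (amplitudeDensity m s w p * p.1) +
          ENNReal.ofReal (kineticDensity m P D p * p.1))) := by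
        refine setLIntegral_mono' hW fun p hp => ?_
        have hp0 : 0 ≤ p.1 := le_of_lt (hsub hp)
        have k1 := mul_nonneg (potentialDensity_nonneg m s w p) hp0
        have k2 := mul_nonneg (amplitudeDensity_nonneg m s w p) hp0
        have k3 := mul_nonneg (kineticDensity_nonneg m P D p) hp0
        rw [← ENNReal.ofReal_add k2 k3, ← ENNReal.ofReal_add k1 (add_nonneg k2 k3),
          ← ENNReal.ofReal_mul hK]
        refine ENNReal.ofReal_le_ofReal ?_
        calc f p * p.1 ≤ _ := mul_le_mul_of_nonneg_right (hf p hp) hp0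
          _ = _ := by ring
    _ = ENNReal.ofReal K * ((∫⁻ p in W, ENNReal.ofReal (potentialDensity m s w p * p.1)) +
        ((∫⁻ p in W, ENNReal.ofReal (amplitudeDensity m s w p * p.1)) +
          ∫⁻ p in W, ENNReal.ofReal (kineticDensity m P D p * p.1))) := by
        rw [lintegral_const_mul' _ _ ENNReal.ofReal_ne_top, lintegral_add_left' m1,
          lintegral_add_left' m2]
    _ ≤ ENNReal.ofReal K *
        ((∫⁻ p in interiorPlane, ENNReal.ofReal (potentialDensity m s w p * p.1)) +
        (3 * (∫⁻ p in interiorPlane, ENNReal.ofReal (potentialDensity m s w p * p.1)) +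
          ∫⁻ p in interiorPlane, ENNReal.ofReal (kineticDensity m P D p * p.1))) := by
        gcongr ENNReal.ofReal K * (?_ + (?_ + ?_))
        · exact lintegral_mono_set hsub
        · exact (lintegral_mono_set hWs).trans (lintegral_shell_amplitude_le hm hs hw hlim hR)
        · exact lintegral_mono_set hsub
    _ = _ := by ring

end Shell

/-! ### Smoothness and decay of the perturbation -/

/-- The point of the meridian plane over a point of the half plane. -/
def meridian (p : ℝ × ℝ) : Space := ((p.1, 0), p.2)

lemma cyl_meridian {p : ℝ × ℝ} (hp : 0 ≤ p.1) : cyl (meridian p) = p := by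
  simp [cyl, meridian, Real.sqrt_sq hp]

lemma contDiffOn_lift_of_axiallySmooth {I : Set ℝ} {f : ℝ → ℝ × ℝ → ℝ} (hf : AxiallySmooth I f)
    {t : ℝ} (ht : t ∈ I) : ContDiffOn ℝ 2 (lift (f t)) {x | x ≠ 0} := by
  have hι : ContDiff ℝ ((⊤ : ℕ∞) : ℕ∞ω) fun x : Space =>
      (t, (WithLp.toLp 2 ![x.1.1, x.1.2, x.2] : EuclideanSpace ℝ (Fin 3))) := by
    refine contDiff_const.prodMk ?_
    refine contDiff_euclidean.2 fun i => ?_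
    fin_cases i <;> simp <;> fun_prop
  have hmaps : MapsTo (fun x : Space =>
      (t, (WithLp.toLp 2 ![x.1.1, x.1.2, x.2] : EuclideanSpace ℝ (Fin 3)))) {x | x ≠ 0}
      (I ×ˢ {(0 : EuclideanSpace ℝ (Fin 3))}ᶜ) := by
    intro x hx
    refine ⟨ht, fun h => hx ?_⟩
    have h : (WithLp.toLp 2 ![x.1.1, x.1.2, x.2] : EuclideanSpace ℝ (Fin 3)) = 0 := h
    have h0 := congrArg (· 0) h
    have h1 := congrArg (· 1) h
    have h2 := congrArg (· 2) h
    simp at h0 h1 h2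
    exact Prod.ext (Prod.ext h0 h1) h2
  have h := contDiffOn_infty.1 (hf.comp hι.contDiffOn hmaps) 2
  exact h.congr fun x _ => by simp [lift, cyl]

/-- The values on the half plane are recovered from the lift by restriction to a meridian plane,
which is a linear embedding. -/
lemma contDiffOn_of_lift {S : ℝ × ℝ → ℝ} (hS : ContDiffOn ℝ 2 (lift S) {x | x ≠ 0}) :
    ContDiffOn ℝ 2 S interiorPlane := by
  have h : ContDiffOn ℝ 2 (fun p => lift S (meridian p)) interiorPlane := by
    refine hS.comp (t := {x | x ≠ 0}) (by unfold meridian; fun_prop) fun p hp h => ?_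
    have h1 : p.1 = 0 := congrArg (fun x : Space => x.1.1) h
    exact (ne_of_gt hp) h1
  refine h.congr fun p hp => ?_
  unfold lift
  rw [cyl_meridian (le_of_lt hp)]

lemma tendsto_rayPoint {θ : ℝ} (hθ : 0 < Real.cos θ) :
    Tendsto (rayPoint θ) atTop atInfinity := by
  refine tendsto_inf.2 ⟨tendsto_comap_iff.2 ?_, tendsto_principal.2 ?_⟩
  · refine tendsto_id.congr' ?_
    filter_upwards [eventually_ge_atTop (0 : ℝ)] with r hr
    simp [radius_rayPoint hr]
  · filter_upwards [eventually_ge_atTop (0 : ℝ)] with r hr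
    exact mul_nonneg hr hθ.le

/-- Along a ray η₀ ≥ ρ² = r² cos² θ, so w/η₀ is at most (w/r²)/cos² θ in absolute value. The limit
is not uniform as the ray approaches the axis, but the Hardy bound uses one ray at a time. -/
lemma tendsto_ray_amplitude {m : ℝ} (hm : 0 < m) {s w : ℝ × ℝ → ℝ}
    (hs : Tendsto s atInfinity (𝓝 0))
    (hw : Tendsto (fun x => w x / radius x ^ 2) atInfinity (𝓝 0)) {θ : ℝ} (hθ : 0 < Real.cos θ) :
    Tendsto (fun r => s (rayPoint θ r) ^ 2 + (w (rayPoint θ r) / eta0 m (rayPoint θ r)) ^ 2)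
      atTop (𝓝 0) := by
  have h1 := (hs.comp (tendsto_rayPoint hθ)).pow 2
  have h2 := ((hw.comp (tendsto_rayPoint hθ)).pow 2).mul_const (1 / Real.cos θ ^ 4)
  have h3 : Tendsto (fun r => (w (rayPoint θ r) / eta0 m (rayPoint θ r)) ^ 2) atTop (𝓝 0) := by
    refine squeeze_zero' (Eventually.of_forall fun r => sq_nonneg _) ?_ (by simpa using h2)
    filter_upwards [eventually_gt_atTop (0 : ℝ)] with r hr
    have hp := (rayPoint_mem (θ := θ) hr).2 hθ
    have hη := sq_le_eta0 hm hp
    have hp1 : (rayPoint θ r).1 = r * Real.cos θ := rfl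
    rw [hp1] at hη
    simp only [radius_rayPoint hr.le]
    calc (w (rayPoint θ r) / eta0 m (rayPoint θ r)) ^ 2
        = w (rayPoint θ r) ^ 2 / eta0 m (rayPoint θ r) ^ 2 := div_pow _ _ _
      _ ≤ w (rayPoint θ r) ^ 2 / ((r * Real.cos θ) ^ 2) ^ 2 := by gcongr
      _ = _ := by field_simp
  simpa using h1.add h3

/-- The ball is a cube of half-side at most r/4, so a point of it is at Euclidean distance less than
r from the centre; the explicit estimates keep it inside the shell. -/
lemma ball_meridian_subset {p : ℝ × ℝ} (hr : 0 < radius p) {L : ℝ} (hL : L ≤ radius p / 4)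
    {x : Space} (hx : x ∈ Metric.ball (meridian p) L) :
    radius p / 2 < radius (cyl x) ∧ radius (cyl x) < 2 * radius p := by
  rw [Metric.mem_ball, Prod.dist_eq, Prod.dist_eq, max_lt_iff, max_lt_iff] at hx
  obtain ⟨⟨h1, h2⟩, h3⟩ := hx
  simp only [meridian, Real.dist_eq, sub_zero] at h1 h2 h3
  have e : radius (cyl x) ^ 2 = x.1.1 ^ 2 + x.1.2 ^ 2 + x.2 ^ 2 := by
    rw [radius_sq, cyl_fst_sq]; rfl
  have e0 := radius_sq p
  generalize radius p = r at *
  have hsq : ∀ a : ℝ, |a| < L → a ^ 2 ≤ r ^ 2 / 16 := fun a ha => by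
    have : |a| ^ 2 ≤ (r / 4) ^ 2 := pow_le_pow_left₀ (abs_nonneg a) (ha.le.trans hL) 2
    rw [sq_abs] at this
    linarith
  have q1 := hsq _ h1
  have q2 := hsq _ h2
  have q3 := hsq _ h3
  set a := x.1.1 - p.1 with ha
  set b := x.2 - p.2 with hb
  have ex : x.1.1 = p.1 + a := by rw [ha]; ring
  have ez : x.2 = p.2 + b := by rw [hb]; ring
  -- By Cauchy-Schwarz the inner product is at most r²/√8, and 9/25 is a rational number above 1/√8
  -- with 1 - 2 · 9/25 > 1/4.
  have hcs : (p.1 * a + p.2 * b) ^ 2 ≤ (9 / 25 * r ^ 2) ^ 2 := by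
    have h5 : (p.1 * a + p.2 * b) ^ 2 ≤ (p.1 ^ 2 + p.2 ^ 2) * (a ^ 2 + b ^ 2) :=
      sq_mul_add_mul_le _ _ _ _
    rw [← e0] at h5
    have h6 : r ^ 2 * (a ^ 2 + b ^ 2) ≤ r ^ 2 * (r ^ 2 / 8) := by gcongr; linarith
    nlinarith [sq_nonneg (r ^ 2)]
  have hab := abs_le.1 (abs_le_of_sq_le_sq hcs (by positivity))
  have e1 : radius (cyl x) ^ 2 =
      r ^ 2 + 2 * (p.1 * a + p.2 * b) + (a ^ 2 + x.1.2 ^ 2 + b ^ 2) := by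
    rw [e, ex, ez, e0]; ring
  have hr2 : 0 < r ^ 2 := by positivity
  have hn : 0 ≤ radius (cyl x) := Real.sqrt_nonneg _
  constructor
  · refine lt_of_pow_lt_pow_left₀ 2 hn ?_
    nlinarith [sq_nonneg a, sq_nonneg b, sq_nonneg x.1.2]
  · refine lt_of_pow_lt_pow_left₀ 2 (by positivity) ?_
    nlinarith

lemma ball_meridian_subset_rho {p : ℝ × ℝ} (hp : 0 < p.1)
    {x : Space} (hx : x ∈ Metric.ball (meridian p) (p.1 / 4)) :
    p.1 / 2 < (cyl x).1 ∧ (cyl x).1 < 2 * p.1 := by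
  rw [Metric.mem_ball, Prod.dist_eq, Prod.dist_eq, max_lt_iff, max_lt_iff] at hx
  obtain ⟨⟨h1, h2⟩, -⟩ := hx
  simp only [meridian, Real.dist_eq, sub_zero] at h1 h2
  have e := cyl_fst_sq x
  have hn : 0 ≤ (cyl x).1 := Real.sqrt_nonneg _
  rw [abs_lt] at h1 h2
  constructor
  · refine lt_of_pow_lt_pow_left₀ 2 hn ?_
    nlinarith [sq_nonneg x.1.2]
  · refine lt_of_pow_lt_pow_left₀ 2 (by positivity) ?_
    nlinarith

/-! ### The pointwise bounds -/

/-- The supremum is taken in [0, ∞], so no boundedness is needed beforehand; the square is removed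
by taking the square root of M. -/
lemma iSup_enorm_sq_le {S : Set (ℝ × ℝ)} {f : ℝ × ℝ → ℝ} {M : ℝ≥0∞}
    (h : ∀ x ∈ S, ENNReal.ofReal (f x ^ 2) ≤ M) : (⨆ x ∈ S, ‖f x‖ₑ) ^ 2 ≤ M := by
  have hsq : ∀ a : ℝ≥0∞, (a ^ (2⁻¹ : ℝ)) ^ 2 = a := fun a => by
    rw [← ENNReal.rpow_natCast, ← ENNReal.rpow_mul]; norm_num
  rw [← hsq M]
  refine pow_le_pow_left' (iSup₂_le fun x hx => ?_) 2
  refine (ENNReal.le_rpow_inv_iff (by norm_num)).2 ?_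
  refine le_trans (le_of_eq ?_) (h x hx)
  rw [Real.enorm_eq_ofReal_abs, ENNReal.rpow_ofNat, ← ENNReal.ofReal_pow (abs_nonneg _), sq_abs]

lemma sigmaConst_nonneg {m d : ℝ} (hm : 0 < m) (hd : 0 < d) : 0 ≤ sigmaConst m d := by
  have := twistConst_nonneg m d
  unfold sigmaConst
  positivity

lemma omegaConst_nonneg {m d : ℝ} (hm : 0 < m) (hd : 0 < d) : 0 ≤ omegaConst m d := by
  have := twistConst_nonneg m d
  unfold omegaConst
  positivity

section Bounds

variable {m : ℝ} {I : Set ℝ} {σ₁ ω₁ : ℝ → ℝ × ℝ → ℝ} {β : ℝ → ℝ × ℝ → Fin 2 → ℝ}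
  {χ₁ : Fin 2 → Fin 2 → ℝ → ℝ × ℝ → ℝ} {t : ℝ}

/-- A quantity bounded by the densities on a shell is controlled by the energies. -/
lemma lintegral_shell_le_energies (hm : 0 < m) (h : IsLinearPerturbation m I σ₁ ω₁ β χ₁)
    (ht : t ∈ I) {R K : ℝ} (hR : 0 < R) (hK : 0 ≤ K) {W : Set (ℝ × ℝ)}
    (hW : MeasurableSet W) (hWs : W ⊆ shell R) {f : ℝ × ℝ → ℝ}
    (hf : ∀ p ∈ W, f p ≤ K * (potentialDensity m (σ₁ t) (ω₁ t) p +
      amplitudeDensity m (σ₁ t) (ω₁ t) p +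
      kineticDensity m (dot (pField m σ₁ β) t) (dot (dField m ω₁ β) t) p)) :
    ∫⁻ p in W, ENNReal.ofReal (f p * p.1) ≤ ENNReal.ofReal K *
      (64 * (m2bar m σ₁ ω₁ β χ₁ t + m2 m σ₁ ω₁ β χ₁ t)) := by
  have hs := (contDiffOn_of_lift (contDiffOn_lift_of_axiallySmooth h.smooth_sigma ht)).of_le
    (by norm_num : (1 : ℕ∞ω) ≤ 2)
  have hw := (contDiffOn_of_lift (contDiffOn_lift_of_axiallySmooth h.smooth_omega ht)).of_le
    (by norm_num : (1 : ℕ∞ω) ≤ 2)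
  refine (lintegral_shell_total_le hm hs hw (fun θ hθ => tendsto_ray_amplitude hm
    (h.sigma_infinity t ht) (h.omega_infinity t ht) hθ) hR hK hW hWs hf).trans ?_
  gcongr
  have e1 : ∫⁻ p in interiorPlane,
      ENNReal.ofReal (potentialDensity m (σ₁ t) (ω₁ t) p * p.1) ≤ 16 * m2 m σ₁ ω₁ β χ₁ t :=
    lintegral_le_energy (potentialDensity_le_energyDensity _ _ _ _ _ _)
  have e2 : ∫⁻ p in interiorPlane, ENNReal.ofReal
      (kineticDensity m (dot (pField m σ₁ β) t) (dot (dField m ω₁ β) t) p * p.1) ≤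
      16 * m2bar m σ₁ ω₁ β χ₁ t :=
    lintegral_le_energy (kineticDensity_le_energyDensity _ _ _ _ _ _)
  calc _ ≤ 4 * (16 * m2 m σ₁ ω₁ β χ₁ t) + 16 * m2bar m σ₁ ω₁ β χ₁ t := by gcongr
    _ ≤ 4 * (16 * m2 m σ₁ ω₁ β χ₁ t) + 64 * m2bar m σ₁ ω₁ β χ₁ t := by
        gcongr; norm_num
    _ = _ := by ring

/-- Pointwise bound of the norm perturbation outside a neighbourhood of the horizon. -/
theorem exists_sigma_bound (hm : 0 < m) {δ : ℝ} (hδ : 0 < δ) :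
    ∃ C : ℝ≥0, ∀ (I : Set ℝ) (σ₁ ω₁ : ℝ → ℝ × ℝ → ℝ) (β : ℝ → ℝ × ℝ → Fin 2 → ℝ)
        (χ₁ : Fin 2 → Fin 2 → ℝ → ℝ × ℝ → ℝ), IsLinearPerturbation m I σ₁ ω₁ β χ₁ → ∀ t ∈ I,
      (⨆ x ∈ Omega δ, ‖σ₁ t x‖ₑ) ^ 2 ≤ C * (m2bar m σ₁ ω₁ β χ₁ t + m2 m σ₁ ω₁ β χ₁ t) := by
  obtain ⟨C, hC⟩ := exists_axial_pointwise_bound (show 0 < δ / 4 by positivity)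
  refine ⟨C * (Real.toNNReal (sigmaConst m (δ / 2)) * 64), fun I σ₁ ω₁ β χ₁ h t ht =>
    iSup_enorm_sq_le fun x₀ hx₀ => ?_⟩
  obtain ⟨hx0, hxδ⟩ := hx₀
  have hr : 0 < radius x₀ := hδ.trans_le hxδ
  have hl := contDiffOn_lift_of_axiallySmooth h.smooth_sigma ht
  have hw := contDiffOn_of_lift (contDiffOn_lift_of_axiallySmooth h.smooth_omega ht)
  -- With L = r₀/4 the ball lies in the shell r₀/2 < r < 2 r₀. It misses the origin, where
  -- smoothness may fail, and r ≥ δ/2 on it, hence the constants at δ/2.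
  have hsub : ∀ x ∈ Metric.ball (meridian x₀) (radius x₀ / 4), radius x₀ / 2 < radius (cyl x) ∧
      radius (cyl x) < 2 * radius x₀ := fun x hx => ball_meridian_subset hr le_rfl hx
  have hb := hC (σ₁ t) (meridian x₀) (radius x₀ / 4) (shell (radius x₀)) (by linarith)
    (contDiffOn_of_lift hl) (hl.mono fun x hx h0 => by
      have := (hsub x hx).1
      rw [h0] at this
      simp [cyl, radius] at this
      linarith [Real.sqrt_nonneg (x₀.1 ^ 2 + x₀.2 ^ 2), show radius x₀ =
        √(x₀.1 ^ 2 + x₀.2 ^ 2) from rfl])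
    (measurableSet_shell _) (shell_subset _) (fun x hx hp => ⟨hp, hsub x hx⟩)
  rw [cyl_meridian hx0] at hb
  refine hb.trans ?_
  have hE := lintegral_shell_le_energies (K := sigmaConst m (δ / 2))
    (f := fun p => normSq (grad (σ₁ t) p) + σ₁ t p ^ 2 / (radius x₀ / 4) ^ 2 +
      lap3 (σ₁ t) p ^ 2) hm h ht hr (sigmaConst_nonneg hm (by positivity))
    (measurableSet_shell _) subset_rfl (fun p hp =>
      sigma_pointwise_le hm (by positivity) hp.1 (by linarith [hp.2.1]) hr hp.2.2
        (differentiableAt_of_interior (hw.of_le (by norm_num)) hp.1)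
        (h.evolution_sigma t ht p hp.1))
  calc _ ≤ C * (ENNReal.ofReal (sigmaConst m (δ / 2)) *
        (64 * (m2bar m σ₁ ω₁ β χ₁ t + m2 m σ₁ ω₁ β χ₁ t))) := by gcongr
    _ = _ := by
        simp only [ENNReal.coe_mul, ENNReal.coe_ofNat, mul_assoc]
        rfl

/-- Pointwise bound of the rescaled twist perturbation away from the axis. -/
theorem exists_omega_bound (hm : 0 < m) {δ : ℝ} (hδ : 0 < δ) :
    ∃ C : ℝ≥0, ∀ (I : Set ℝ) (σ₁ ω₁ : ℝ → ℝ × ℝ → ℝ) (β : ℝ → ℝ × ℝ → Fin 2 → ℝ)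
        (χ₁ : Fin 2 → Fin 2 → ℝ → ℝ × ℝ → ℝ), IsLinearPerturbation m I σ₁ ω₁ β χ₁ → ∀ t ∈ I,
      (⨆ x ∈ Gamma δ, ‖omegaBar m ω₁ t x‖ₑ) ^ 2 ≤
        C * (m2bar m σ₁ ω₁ β χ₁ t + m2 m σ₁ ω₁ β χ₁ t) := by
  obtain ⟨C, hC⟩ := exists_axial_pointwise_bound (show 0 < δ / 4 by positivity)
  set k := 256 * (1 + m / (δ / 2)) ^ 4 * omegaConst m (δ / 2) with hk
  have hk0 : 0 ≤ k := by
    have := omegaConst_nonneg hm (half_pos hδ)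
    positivity
  refine ⟨C * (Real.toNNReal (k / δ ^ 4) * 64), fun I σ₁ ω₁ β χ₁ h t ht =>
    iSup_enorm_sq_le fun x₀ hx₀ => ?_⟩
  have hxδ : δ ≤ x₀.1 := hx₀.2
  have hx0 : 0 < x₀.1 := hδ.trans_le hxδ
  have hr : 0 < radius x₀ := radius_pos hx0
  have hl := contDiffOn_lift_of_axiallySmooth h.smooth_omega ht
  have hw := contDiffOn_of_lift hl
  -- The shell is needed for the Hardy bound, the strip for comparing ρ with ρ₀; the ball of radius
  -- ρ₀/4 projects into both because ρ₀ ≤ r₀.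
  set W : Set (ℝ × ℝ) := shell (radius x₀) ∩ {p | x₀.1 / 2 < p.1 ∧ p.1 < 2 * x₀.1} with hWdef
  have hW : MeasurableSet W := (measurableSet_shell _).inter
    ((isOpen_lt continuous_const continuous_fst).inter
      (isOpen_lt continuous_fst continuous_const)).measurableSet
  have hsub := fun (x : Space) (hx : x ∈ Metric.ball (meridian x₀) (x₀.1 / 4)) =>
    ball_meridian_subset_rho hx0 hx
  have hsub2 := fun (x : Space) (hx : x ∈ Metric.ball (meridian x₀) (x₀.1 / 4)) =>
    ball_meridian_subset hr (by linarith [le_radius x₀]) hx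
  have hb := hC (ω₁ t) (meridian x₀) (x₀.1 / 4) W (by linarith)
    (contDiffOn_of_lift hl) (hl.mono fun x hx h0 => by
      have := (hsub x hx).1
      rw [h0] at this
      simp [cyl] at this
      linarith)
    hW (inter_subset_left.trans (shell_subset _))
    (fun x hx hp => ⟨⟨hp, hsub2 x hx⟩, hsub x hx⟩)
  rw [cyl_meridian hx0.le] at hb
  -- On the strip η₀² ≤ 256 (1 + 2m/δ)⁴ ρ₀⁴, which accounts for k and for the factor ρ₀⁴.
  have hE := lintegral_shell_le_energies (K := k * x₀.1 ^ 4)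
    (f := fun p => normSq (grad (ω₁ t) p) + ω₁ t p ^ 2 / (x₀.1 / 4) ^ 2 +
      lap3 (ω₁ t) p ^ 2) hm h ht hr (by positivity) hW inter_subset_left (fun p hp => by
      have hp1 : 0 < p.1 := hp.1.1
      have hdp : δ / 2 ≤ p.1 := by linarith [hp.2.1]
      refine (omega_pointwise_le (P := dot (pField m σ₁ β) t) hm (half_pos hδ) hp1 hdp hx0 hp.2.2
        (differentiableAt_of_interior (hw.of_le (by norm_num)) hp1)
        (h.evolution_omega t ht p hp1)).trans ?_
      rw [← mul_assoc]
      have hη := eta0_le hm (half_pos hδ) hp1 (hdp.trans (le_radius p))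
      have hη2 : eta0 m p ^ 2 ≤ 256 * (1 + m / (δ / 2)) ^ 4 * x₀.1 ^ 4 := by
        have hη3 : eta0 m p ≤ 16 * (1 + m / (δ / 2)) ^ 2 * x₀.1 ^ 2 := by
          calc _ ≤ 4 * (1 + m / (δ / 2)) ^ 2 * p.1 ^ 2 := hη
            _ ≤ 4 * (1 + m / (δ / 2)) ^ 2 * (2 * x₀.1) ^ 2 := by gcongr; exact hp.2.2.le
            _ = _ := by ring
        calc _ ≤ (16 * (1 + m / (δ / 2)) ^ 2 * x₀.1 ^ 2) ^ 2 :=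
              pow_le_pow_left₀ (eta0_pos hm hp1).le hη3 2
          _ = _ := by ring
      have ho := omegaConst_nonneg hm (half_pos hδ)
      refine mul_le_mul_of_nonneg_right ?_ (add_nonneg (add_nonneg
        (potentialDensity_nonneg _ _ _ _) (amplitudeDensity_nonneg _ _ _ _))
        (kineticDensity_nonneg _ _ _ _))
      calc _ ≤ 256 * (1 + m / (δ / 2)) ^ 4 * x₀.1 ^ 4 * omegaConst m (δ / 2) := by gcongr
        _ = _ := by rw [hk]; ring)
  have hη := sq_le_eta0 hm hx0
  -- Dividing by η₀⁴ ≥ ρ₀⁸ beats the growth ρ₀⁴ of the bound for ω₁² and leaves ρ₀⁻⁴ ≤ δ⁻⁴.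
  have ho : omegaBar m ω₁ t x₀ ^ 2 ≤ 1 / x₀.1 ^ 8 * ω₁ t x₀ ^ 2 := by
    unfold omegaBar
    calc _ = ω₁ t x₀ ^ 2 / (eta0 m x₀) ^ 4 := by ring
      _ ≤ ω₁ t x₀ ^ 2 / (x₀.1 ^ 2) ^ 4 := by gcongr
      _ = _ := by ring
  calc _ ≤ ENNReal.ofReal (1 / x₀.1 ^ 8 * ω₁ t x₀ ^ 2) := ENNReal.ofReal_le_ofReal ho
    _ = ENNReal.ofReal (1 / x₀.1 ^ 8) * ENNReal.ofReal (ω₁ t x₀ ^ 2) :=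
        ENNReal.ofReal_mul (by positivity)
    _ ≤ ENNReal.ofReal (1 / x₀.1 ^ 8) * (C * (ENNReal.ofReal (k * x₀.1 ^ 4) *
        (64 * (m2bar m σ₁ ω₁ β χ₁ t + m2 m σ₁ ω₁ β χ₁ t)))) := by
        gcongr
        exact hb.trans (by gcongr)
    _ = C * (ENNReal.ofReal (k / x₀.1 ^ 4) *
        (64 * (m2bar m σ₁ ω₁ β χ₁ t + m2 m σ₁ ω₁ β χ₁ t))) := by
        rw [mul_left_comm, ← mul_assoc (ENNReal.ofReal (1 / x₀.1 ^ 8)),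
          ← ENNReal.ofReal_mul (by positivity)]
        rw [show 1 / x₀.1 ^ 8 * (k * x₀.1 ^ 4) = k / x₀.1 ^ 4 by field_simp]
    _ ≤ C * (ENNReal.ofReal (k / δ ^ 4) *
        (64 * (m2bar m σ₁ ω₁ β χ₁ t + m2 m σ₁ ω₁ β χ₁ t))) := by gcongr
    _ = _ := by
        simp only [ENNReal.coe_mul, ENNReal.coe_ofNat, mul_assoc]
        rfl

end Bounds

end ExtremeKerr
end

theorem corollary1 (m₀ : ℝ) (hm₀ : 0 < m₀) (δ : ℝ) (hδ : 0 < δ) :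
    ∃ C : ℝ≥0, 0 < C ∧
      ∀ (I : Set ℝ) (σ₁ ω₁ : ℝ → ℝ × ℝ → ℝ) (β : ℝ → ℝ × ℝ → Fin 2 → ℝ)
        (χ₁ : Fin 2 → Fin 2 → ℝ → ℝ × ℝ → ℝ),
        IsOpen I →
        ExtremeKerr.IsLinearPerturbation m₀ I σ₁ ω₁ β χ₁ →
        ∀ t ∈ I,
          (⨆ x ∈ ExtremeKerr.Omega δ, ‖σ₁ t x‖ₑ) ^ 2 ≤
              C * (ExtremeKerr.m2bar m₀ σ₁ ω₁ β χ₁ t + ExtremeKerr.m2 m₀ σ₁ ω₁ β χ₁ t) ∧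
          (⨆ x ∈ ExtremeKerr.Gamma δ, ‖ExtremeKerr.omegaBar m₀ ω₁ t x‖ₑ) ^ 2 ≤
              C * (ExtremeKerr.m2bar m₀ σ₁ ω₁ β χ₁ t + ExtremeKerr.m2 m₀ σ₁ ω₁ β χ₁ t) := by
  obtain ⟨C₁, h₁⟩ := ExtremeKerr.exists_sigma_bound hm₀ hδ
  obtain ⟨C₂, h₂⟩ := ExtremeKerr.exists_omega_bound hm₀ hδ
  -- The summand 1 only ensures that the common constant is positive.
  refine ⟨C₁ + C₂ + 1, by positivity, fun I σ₁ ω₁ β χ₁ _ h t ht => ⟨?_, ?_⟩⟩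
  · refine (h₁ I σ₁ ω₁ β χ₁ h t ht).trans ?_
    gcongr
    rw [add_assoc]
    exact le_self_add
  · refine (h₂ I σ₁ ω₁ β χ₁ h t ht).trans ?_
    gcongr
    rw [add_right_comm]
    exact le_add_self
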